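/- Consider $n$ fermionic modes with Majorana operators $c_1,\dots,c_{2n}$, $\{c_k,c_l\}=2\delta_{kl}$. A Gaussian state is a state satisfying Wick's theorem; its covariance matrix is $\gamma_{kl}=\frac i2\operatorname{tr}(\rho[c_k,c_l])$. Let $A,B$ be real $2n\times 2n$ matrices and let $\mathcal T=\mathcal T_{(A;B)}$ be an $n\to n$ fermionic Gaussian channel: a trace-preserving completely positive map which, also when applied to one part of a system with additional reference modes, maps Gaussian states to Gaussian states and acts on the covariance matrix by $\gamma\mapsto A\gamma A^T+B$ (with reference modes: $\gamma\mapsto(\mathbb 1\oplus A)\gamma(\mathbb 1\oplus A)^T+(0\oplus B)$). Suppose that $\mathcal T$ has Choi rank $n'\le n$ in modes, i.e. its Choi matrix has rank $2^{n'}$ with $n'\le n$. A complementary channel $\mathcal T^c$ of $\mathcal T$ is obtained by writing $\mathcal T(\rho)$ as the reduced state of the system in $U(\rho\otimes|\psi\rangle\langle\psi|)U^\dagger$, where $|\psi\rangle$ is a pure state of definite parity of finitely many fermionic environment modes and $U$ is a unitary on system and environment that commutes or anticommutes with the total parity, and taking the reduced state of the environment instead. $\mathcal T$ is antidegradable if there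 are a complementary channel $\mathcal T^c$ and a completely positive map $\mathcal P$ with $\mathcal P\circ\mathcal T^c=\mathcal T$. Then $\mathcal T_{(A;B)}$ is antidegradable if and only if, in standard form, it is a direct sum of channels with $A_k=d_k\mathbb 1$, $0\le d_k\le 1/\sqrt2$. That is: if and only if there are $O_1,O_2\in \mathrm O(2n)$, numbers $d_1\ge\dots\ge d_n$ with $0\le d_k\le 1/\sqrt2$, and a matrix $B'$ such that $$A=O_1\Bigl(\bigoplus_{k=1}^n d_k\mathbb 1_2\Bigr)O_2,\qquad B=O_1B'O_1^T,$$ and $B'$ has no entries between modes with different values of $d$ (the $2\times2$ block $B'_{jk}$ is $0$ whenever $d_j\ne d_k$). -/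

import Mathlib

open scoped Kronecker ComplexOrder

noncomputable section

namespace Fermion

/-- Occupation number basis of the Fock space of `n` fermionic modes (`true` means occupied). -/
abbrev Fock (n : ℕ) : Type := Fin n → Bool

/-- Operators on the Fock space of `n` modes. -/
abbrev Op (n : ℕ) : Type := Matrix (Fock n) (Fock n) ℂ

/-- Labels of the `2n` Majorana operators of `n` modes: `(k, 0)` and `(k, 1)` are the two
Majorana operators of the mode `k`. -/
abbrev Maj (n : ℕ) : Type := Fin n × Fin 2

/-- The Majorana operators in the Jordan-Wigner representation. They are Hermitian, satisfy
`{c i, c j} = 2 δ i j`, and `a k = (c (k, 0) - I * c (k, 1)) / 2` is the annihilation operator of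
the mode `k`. -/
def majorana {n : ℕ} (i : Maj n) : Op n := Matrix.of fun x y =>
  if x = Function.update y i.1 (!y i.1) then
    (∏ j ∈ Finset.univ.filter (fun j => j < i.1), if y j then (-1 : ℂ) else 1) *
      (if i.2 = 0 then 1 else if y i.1 then Complex.I else -Complex.I)
  else 0

/-- The fermion parity operator. -/
def parity (n : ℕ) : Op n :=
  Matrix.diagonal fun x => ∏ j, if x j then (-1 : ℂ) else 1

/-- The Majorana operators of a system composed of `r` modes followed by `n` modes, whose Fock
space is the tensor product of the two Fock spaces (Jordan-Wigner representation of `r + n`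
modes: the operators of the second party carry the parity string of the first one). -/
def pairMajorana {r n : ℕ} :
    Maj r ⊕ Maj n → Matrix (Fock r × Fock n) (Fock r × Fock n) ℂ :=
  Sum.elim (fun i => majorana i ⊗ₖ (1 : Op n)) (fun j => parity r ⊗ₖ majorana j)

/-- The sum over all complete pairings prescribed by Wick's theorem (for a list of odd length
it is zero), for the two-point function `E`. -/
def wick {ι : Type} (E : ι → ι → ℂ) : List ι → ℂ
  | [] => 1
  | a :: l => ∑ j : Fin l.length, (-1) ^ (j : ℕ) * E a (l.get j) * wick E (l.eraseIdx j)
termination_by l => l.length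
decreasing_by
  have := List.length_eraseIdx_le l j
  simp only [List.length_cons]
  omega

section States

variable {K ι : Type} [Fintype K] [DecidableEq K]

/-- Density operators. -/
def IsState (ρ : Matrix K K ℂ) : Prop := ρ.PosSemidef ∧ ρ.trace = 1

/-- The covariance matrix `γ k l = (i / 2) tr (ρ [c k, c l])` of a state, with respect to the
Majorana operators `c`. -/
def covMatrix (c : ι → Matrix K K ℂ) (ρ : Matrix K K ℂ) : Matrix ι ι ℝ := Matrix.of fun k l =>
  (Complex.I / 2 * (ρ * (c k * c l - c l * c k)).trace).re

/-- Gaussian states: the states for which Wick's theorem holds. -/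
def IsGaussianState (c : ι → Matrix K K ℂ) (ρ : Matrix K K ℂ) : Prop :=
  IsState ρ ∧ ∀ l : List ι, l.Nodup →
    (ρ * (l.map c).prod).trace = wick (fun i j => (ρ * (c i * c j)).trace) l

/-- `σ` is the reduction of `ρ` to the subsystem whose Majorana operators, as operators on the
composite system, are the `c' i`; the `c i` are the Majorana operators of the subsystem on its own
Fock space. That is, all expectation values of subsystem operators agree. -/
def IsReduction {K' : Type} [Fintype K'] [DecidableEq K'] (c : ι → Matrix K K ℂ)
    (c' : ι → Matrix K' K' ℂ) (σ : Matrix K K ℂ) (ρ : Matrix K' K' ℂ) : Prop :=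
  ∀ l : List ι, (σ * (l.map c).prod).trace = (ρ * (l.map c').prod).trace

end States

section Channels

variable {n m : ℕ}

/-- The map `id ⊗ T`. If `K` is the Fock space of modes preceding the modes `T` acts on and `T`
preserves parity, this is also the fermionic extension of `T`. -/
def ampliation (K : Type) (T : Op n →ₗ[ℂ] Op m)
    (X : Matrix (K × Fock n) (K × Fock n) ℂ) : Matrix (K × Fock m) (K × Fock m) ℂ :=
  Matrix.of fun p q => T (Matrix.of fun x y => X (p.1, x) (q.1, y)) p.2 q.2

/-- Complete positivity. -/
def IsCompletelyPositive (T : Op n →ₗ[ℂ] Op m) : Prop :=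
  ∀ (k : ℕ) (X : Matrix (Fin k × Fock n) (Fin k × Fock n) ℂ),
    X.PosSemidef → (ampliation (Fin k) T X).PosSemidef

/-- Quantum channels: trace-preserving completely positive maps. -/
def IsChannel (T : Op n →ₗ[ℂ] Op m) : Prop :=
  IsCompletelyPositive T ∧ ∀ X, (T X).trace = X.trace

/-- `T` is the fermionic Gaussian channel `T_(A;B) : γ ↦ A γ Aᵀ + B`. It is a quantum channel
which, acting on `n` modes of a system of `r + n` modes (any `r`, also `r = 0`), maps Gaussian
states to Gaussian states and transforms the covariance matrix by `A` and `B`. -/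
def IsFGC (A : Matrix (Maj m) (Maj n) ℝ) (B : Matrix (Maj m) (Maj m) ℝ)
    (T : Op n →ₗ[ℂ] Op m) : Prop :=
  IsChannel T ∧ ∀ (r : ℕ) (ρ : Matrix (Fock r × Fock n) (Fock r × Fock n) ℂ),
    IsGaussianState pairMajorana ρ →
      IsGaussianState pairMajorana (ampliation (Fock r) T ρ) ∧
      covMatrix pairMajorana (ampliation (Fock r) T ρ) =
        Matrix.fromBlocks (1 : Matrix (Maj r) (Maj r) ℝ) 0 0 A * covMatrix pairMajorana ρ *
            (Matrix.fromBlocks (1 : Matrix (Maj r) (Maj r) ℝ) 0 0 A).transpose +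
          Matrix.fromBlocks (0 : Matrix (Maj r) (Maj r) ℝ) 0 0 B

/-- The Choi matrix `∑ E x y ⊗ T (E x y)`. -/
def choiMatrix (T : Op n →ₗ[ℂ] Op m) : Matrix (Fock n × Fock m) (Fock n × Fock m) ℂ :=
  Matrix.of fun p q => T (Matrix.single p.1 q.1 1) p.2 q.2

/-- The Choi rank. -/
def choiRank (T : Op n →ₗ[ℂ] Op m) : ℕ := (choiMatrix T).rank

/-- `(T, Tc)` is a channel on `n` modes together with its complementary channel, for an environment
of `k` modes: there are a pure environment state `ψ` of definite parity and a unitary `U` on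
system and environment which preserves parity (up to a global flip) such that `T ρ` is the reduced
state of the system and `Tc ρ` the reduced state of the environment in
`U (ρ ⊗ |ψ⟩⟨ψ|) U†`. -/
def IsComplementaryPair {k : ℕ} (T : Op n →ₗ[ℂ] Op n) (Tc : Op n →ₗ[ℂ] Op k) : Prop :=
  ∃ (ψ : Fock k → ℂ) (U : Matrix (Fock n × Fock k) (Fock n × Fock k) ℂ),
    star ψ ⬝ᵥ ψ = 1 ∧
    ((parity k).mulVec ψ = ψ ∨ (parity k).mulVec ψ = -ψ) ∧
    U ∈ Matrix.unitaryGroup (Fock n × Fock k) ℂ ∧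
    (U * (parity n ⊗ₖ parity k) = (parity n ⊗ₖ parity k) * U ∨
      U * (parity n ⊗ₖ parity k) = -((parity n ⊗ₖ parity k) * U)) ∧
    ∀ ρ : Op n,
      IsReduction majorana (fun i => pairMajorana (Sum.inl i)) (T ρ)
        (U * (ρ ⊗ₖ Matrix.vecMulVec ψ (star ψ)) * U.conjTranspose) ∧
      IsReduction majorana (fun j => pairMajorana (Sum.inr j)) (Tc ρ)
        (U * (ρ ⊗ₖ Matrix.vecMulVec ψ (star ψ)) * U.conjTranspose)

/-- Antidegradable channels: a completely positive map recovers the output of the channel from the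
output of the complementary channel. -/
def IsAntidegradable (T : Op n →ₗ[ℂ] Op n) : Prop :=
  ∃ (k : ℕ) (Tc : Op n →ₗ[ℂ] Op k) (P : Op k →ₗ[ℂ] Op n),
    IsComplementaryPair T Tc ∧ IsCompletelyPositive P ∧ P ∘ₗ Tc = T

end Channels

end Fermion

end

set_option linter.unusedSectionVars false

/-! Write H = A Aᵀ. Everything is read off from the Choi state, the image of a Gaussian maximally
entangled state under T acting on one half. It is Gaussian, its covariance matrix is built from A
(up to signs caused by transposition) and B, and its rank is at most the Choi rank. A Gaussian state
of 2n modes with rank at most 2^n has at least n pure modes (`IsGaussianState.card_le`): if M is its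
covariance matrix, the Majorana combinations belonging to nonzero eigenvalues of 1 + M² can be
pulled through the density operator, hence act on its range, and r Clifford generators (r even) on a
nonzero space of dimension q require 2^r ≤ q². Consequently N = ker(1 - H - iB) (`pureSpace`) has at
least half the dimension of the ambient space.

Let T be antidegradable. Applying the recovery map to the environment of the dilated maximally
entangled state gives a joint state of a reference, the output S and a second output S'. Reference
and S' have the covariances of the Choi state; on reference and S, the annihilators of the pure
modes survive, because the recovery map acts elsewhere. If Y records the correlations between S and
S', then L = B + Y acts as -i on N. Since N contains no nonzero vector together with its conjugate,
a real matrix is determined by its action on N (`eq_zero_of_realMulVec`). So L is a complex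
structure commuting with H, and B = (1 - H)L. Positivity gives 2H ≤ 1, a monogamy bound: S and S'
share the same correlations with the reference (`exists_complexStructure_of_extension`).
Diagonalising H and L simultaneously (`exists_orthogonal_normalForm`) and splitting A into a
diagonal and an orthogonal factor yields the standard form.

Conversely, the block form makes (1 - H)⁻¹ commute with B, and the rank hypothesis forces J = (1 -
H)⁻¹B to satisfy J² = -1 (`exists_isAntidegradableCov`). This allows B = O₁(1 - d²)Ω O₁ᵀ with Ω the
vacuum covariance, for possibly new O₁, O₂ and d. Because 2d² ≤ 1 there is an orthogonal matrix on n
+ 2n modes with rows (A, S, G) and (A, -S, G), where S Sᵀ = 1/2 and G Gᵀ = 1/2 - H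
(`exists_dilationRotation`). A product of reflections implements it by a unitary of definite parity
(`exists_implements`). With the environment in the vacuum, the system and the first n environment
modes both carry the data (A, B), which determine the channel by Wick's theorem
(`IsFGC.eq_of_isReduction`). The recovery map is then the partial trace over the other n environment
modes. -/

namespace Fermion

/-! ### Clifford relations and independence of Majorana monomials -/

section Clifford

variable {𝒜 ι : Type*} [Ring 𝒜] [DecidableEq ι]

/-- The canonical anticommutation relations for Majorana operators. -/
def IsCAR (c : ι → 𝒜) : Prop := ∀ a b, c a * c b + c b * c a = if a = b then 2 else 0

theorem IsCAR.mul_swap {c : ι → 𝒜} (hc : IsCAR c) {a b : ι} (hab : a ≠ b) :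
    c a * c b = -(c b * c a) := by
  have h := hc a b
  rw [if_neg hab] at h
  exact eq_neg_of_add_eq_zero_left h

variable [Algebra ℂ 𝒜]

/-- The sign picked up by moving `c a` through the product of the `c b`, `b ∈ l`. -/
def moveSign (a : ι) (l : List ι) : ℂ := (l.map fun b => if a = b then (1 : ℂ) else -1).prod

theorem IsCAR.mul_self {c : ι → 𝒜} (hc : IsCAR c) (a : ι) : c a * c a = 1 := by
  have h := hc a a
  rw [if_pos rfl, ← two_smul ℂ] at h
  have h2 : (2 : ℂ)⁻¹ • ((2 : ℂ) • (c a * c a)) = (2 : ℂ)⁻¹ • (2 : 𝒜) := by rw [h]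
  rw [smul_smul, inv_mul_cancel₀ two_ne_zero, one_smul] at h2
  rw [h2, show (2 : 𝒜) = (2 : ℂ) • (1 : 𝒜) by rw [two_smul]; norm_num, smul_smul,
    inv_mul_cancel₀ two_ne_zero, one_smul]

theorem IsCAR.mul_prod {c : ι → 𝒜} (hc : IsCAR c) (a : ι) (l : List ι) :
    c a * (l.map c).prod = moveSign a l • ((l.map c).prod * c a) := by
  induction l with
  | nil => simp [moveSign]
  | cons b l ih =>
    have : moveSign a (b :: l) = (if a = b then 1 else -1) * moveSign a l := by simp [moveSign]
    rw [this, List.map_cons, List.prod_cons, ← mul_assoc]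
    by_cases hab : a = b
    · subst hab
      conv_lhs => rw [mul_assoc, ih]
      simp [mul_assoc]
    · rw [hc.mul_swap hab, neg_mul, mul_assoc, ih]
      simp [hab, mul_assoc]

theorem IsCAR.reverse_mul {c : ι → 𝒜} (hc : IsCAR c) (l : List ι) :
    (l.reverse.map c).prod * (l.map c).prod = 1 := by
  induction l with
  | nil => simp
  | cons b l ih =>
    simp only [List.reverse_cons, List.map_append, List.prod_append, List.map_cons, List.map_nil,
      List.prod_cons, List.prod_nil, mul_one]
    rw [mul_assoc, ← mul_assoc (c b), hc.mul_self, one_mul, ih]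

theorem moveSign_toList (a : ι) (s : Finset ι) :
    moveSign a s.toList = (-1) ^ s.card * if a ∈ s then -1 else 1 := by
  rw [moveSign, Finset.prod_map_toList]
  by_cases ha : a ∈ s
  · rw [← Finset.mul_prod_erase s _ ha, Finset.prod_congr rfl (g := fun _ => (-1 : ℂ)),
      Finset.prod_const, ← Finset.card_erase_add_one ha]
    · simp [ha, pow_succ]
    · intro x hx
      rw [if_neg (Finset.ne_of_mem_erase hx).symm]
  · rw [Finset.prod_congr rfl (g := fun _ => (-1 : ℂ)), Finset.prod_const]
    · simp [ha]
    · intro x hx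
      rw [if_neg]
      rintro rfl
      exact ha hx

theorem moveSign_append (a : ι) (l l' : List ι) :
    moveSign a (l ++ l') = moveSign a l * moveSign a l' := by
  simp [moveSign]

theorem moveSign_reverse (a : ι) (l : List ι) : moveSign a l.reverse = moveSign a l := by
  simp [moveSign, List.map_reverse, List.prod_reverse]

/-- The sign depends only on the symmetric difference of the two sets. If that has even size, any
element of it works; if odd, any element outside it, which exists because the number of generators
is even. -/
theorem exists_moveSign_eq_neg_one [Fintype ι] (hι : Even (Fintype.card ι)) {s t : Finset ι}
    (hst : s ≠ t) : ∃ a, moveSign a (t.toList.reverse ++ s.toList) = -1 := by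
  simp only [moveSign_append, moveSign_reverse, moveSign_toList]
  have key : ∀ a : ι, ((-1 : ℂ) ^ t.card * if a ∈ t then -1 else 1) *
      ((-1) ^ s.card * if a ∈ s then -1 else 1) =
      (-1) ^ (symmDiff s t).card * if a ∈ symmDiff s t then -1 else 1 := by
    intro a
    have hcard : s.card + t.card = (symmDiff s t).card + 2 * (s ∩ t).card := by
      have h1 := Finset.card_sdiff_add_card_inter s t
      have h2 := Finset.card_sdiff_add_card_inter t s
      rw [Finset.inter_comm t s] at h2
      have h3 : (symmDiff s t).card = (s \ t).card + (t \ s).card := by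
        rw [symmDiff_def, Finset.sup_eq_union, Finset.card_union_of_disjoint]
        exact disjoint_sdiff_sdiff
      omega
    have hp : (-1 : ℂ) ^ t.card * (-1) ^ s.card = (-1) ^ (symmDiff s t).card := by
      rw [← pow_add, add_comm, hcard, pow_add, pow_mul]
      simp
    rw [mul_mul_mul_comm, hp]
    by_cases h1 : a ∈ s <;> by_cases h2 : a ∈ t <;> simp [h1, h2, Finset.mem_symmDiff]
  simp only [key]
  rcases Nat.even_or_odd (symmDiff s t).card with he | ho
  · obtain ⟨a, ha⟩ : (symmDiff s t).Nonempty := by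
      rw [Finset.nonempty_iff_ne_empty]
      intro h
      exact hst (symmDiff_eq_bot.1 h)
    exact ⟨a, by simp [ha, he.neg_one_pow]⟩
  · obtain ⟨a, ha⟩ : ∃ a, a ∉ symmDiff s t := by
      by_contra! h
      rw [Finset.eq_univ_iff_forall.2 h, Finset.card_univ] at ho
      exact (Nat.not_odd_iff_even.2 hι) ho
    exact ⟨a, by simp [ha, ho.neg_one_pow]⟩

/-- Insert c a * c a = 1, move one factor through the product and bring it back by cyclicity: the
trace equals its negative. -/
theorem IsCAR.trace_prod_eq_zero {c : ι → 𝒜} (hc : IsCAR c) (tr : 𝒜 →ₗ[ℂ] ℂ)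
    (htr : ∀ x y, tr (x * y) = tr (y * x)) {l : List ι} {a : ι} (ha : moveSign a l = -1) :
    tr (l.map c).prod = 0 := by
  have h : tr (l.map c).prod = -tr (l.map c).prod := by
    conv_lhs => rw [← one_mul (l.map c).prod, ← hc.mul_self a, mul_assoc, hc.mul_prod, ha, htr,
      smul_mul_assoc, mul_assoc, hc.mul_self]
    simp
  linear_combination h / 2

/-- The products of distinct Majorana operators are linearly independent. -/
theorem IsCAR.linearIndependent [Fintype ι] {c : ι → 𝒜} (hc : IsCAR c) (tr : 𝒜 →ₗ[ℂ] ℂ)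
    (htr : ∀ x y, tr (x * y) = tr (y * x)) (h1 : tr 1 ≠ 0) (hι : Even (Fintype.card ι)) :
    LinearIndependent ℂ fun s : Finset ι => (s.toList.map c).prod := by
  rw [Fintype.linearIndependent_iff]
  intro g hg t
  -- Testing against the reversed monomial of t isolates the coefficient g t, all other monomials
  -- giving trace zero.
  have h := congrArg (fun x => tr ((t.toList.reverse.map c).prod * x)) hg
  simp only [Finset.mul_sum, map_sum, mul_smul_comm, map_smul, mul_zero, map_zero] at h
  rw [Finset.sum_eq_single t] at h
  · rw [hc.reverse_mul, smul_eq_mul] at h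
    exact (mul_eq_zero.1 h).resolve_right h1
  · intro s _ hst
    obtain ⟨a, ha⟩ := exists_moveSign_eq_neg_one hι hst
    rw [← List.prod_append, ← List.map_append, hc.trace_prod_eq_zero tr htr ha, smul_zero]
  · simp

/-- Stated for abstract algebras so that it applies to the endomorphisms of the range of a density
operator, where the rank bound comes from. -/
theorem IsCAR.two_pow_card_le [Fintype ι] [Module.Finite ℂ 𝒜] {c : ι → 𝒜} (hc : IsCAR c)
    (tr : 𝒜 →ₗ[ℂ] ℂ) (htr : ∀ x y, tr (x * y) = tr (y * x)) (h1 : tr 1 ≠ 0)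
    (hι : Even (Fintype.card ι)) : 2 ^ Fintype.card ι ≤ Module.finrank ℂ 𝒜 := by
  simpa using (hc.linearIndependent tr htr h1 hι).fintype_card_le_finrank

end Clifford

/-! ### Operators determined by their Majorana moments -/

section Matrices

variable {K ι : Type*} [Fintype K] [DecidableEq K] [Fintype ι] [DecidableEq ι]

/-- If the Fock space has the right dimension, then the products of distinct Majorana operators
span the space of all operators. -/
theorem IsCAR.linearMap_ext {c : ι → Matrix K K ℂ} (hc : IsCAR c) (hι : Even (Fintype.card ι))
    (hK : 2 ^ Fintype.card ι = Fintype.card K ^ 2) {V : Type*} [AddCommGroup V] [Module ℂ V]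
    {f g : Matrix K K ℂ →ₗ[ℂ] V} (h : ∀ l : List ι, l.Nodup → f (l.map c).prod = g (l.map c).prod) :
    f = g := by
  have hK0 : Fintype.card K ≠ 0 := by
    intro h0
    rw [h0] at hK
    simp at hK
  have hli := hc.linearIndependent (Matrix.traceLinearMap K ℂ ℂ)
    (fun x y => Matrix.trace_mul_comm x y) (by simpa using hK0) hι
  have hspan := hli.span_eq_top_of_card_eq_finrank' (by
    rw [Fintype.card_finset, hK, Module.finrank_matrix]; simp [sq])
  refine LinearMap.ext_on_range hspan fun s => h _ s.nodup_toList

/-- If the Fock space has the right dimension, then an operator is determined by the expectation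
values of the products of distinct Majorana operators. -/
theorem IsCAR.ext_of_trace {c : ι → Matrix K K ℂ} (hc : IsCAR c) (hι : Even (Fintype.card ι))
    (hK : 2 ^ Fintype.card ι = Fintype.card K ^ 2) {X Y : Matrix K K ℂ}
    (h : ∀ l : List ι, l.Nodup → (X * (l.map c).prod).trace = (Y * (l.map c).prod).trace) :
    X = Y := by
  have key := hc.linearMap_ext hι hK
    (f := Matrix.traceLinearMap K ℂ ℂ ∘ₗ LinearMap.mulLeft ℂ X)
    (g := Matrix.traceLinearMap K ℂ ℂ ∘ₗ LinearMap.mulLeft ℂ Y) h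
  exact Matrix.ext_iff_trace_mul_right.2 fun Z => LinearMap.congr_fun key Z

end Matrices


/-! ### Jordan–Wigner operators as monomial matrices -/

section Monomial

variable {K : Type*} [Fintype K] [DecidableEq K]

/-- The matrix that maps the basis vector `y` to `s y` times the basis vector `f y`. -/
def monomialMatrix (f : K → K) (s : K → ℂ) : Matrix K K ℂ :=
  Matrix.of fun x y => if x = f y then s y else 0

theorem monomialMatrix_mul (f g : K → K) (s t : K → ℂ) :
    monomialMatrix f s * monomialMatrix g t = monomialMatrix (f ∘ g) fun y => s (g y) * t y := by
  ext x y
  simp only [Matrix.mul_apply, monomialMatrix, Matrix.of_apply, Function.comp]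
  rw [Finset.sum_eq_single (g y)]
  · simp
  · intro b _ hb
    simp [hb]
  · simp

theorem monomialMatrix_add (f : K → K) (s t : K → ℂ) :
    monomialMatrix f s + monomialMatrix f t = monomialMatrix f fun y => s y + t y := by
  ext x y
  by_cases h : x = f y <;> simp [monomialMatrix, h]

theorem monomialMatrix_neg (f : K → K) (s : K → ℂ) :
    -monomialMatrix f s = monomialMatrix f fun y => -s y := by
  ext x y
  by_cases h : x = f y <;> simp [monomialMatrix, h]

theorem monomialMatrix_id (s : K → ℂ) : monomialMatrix id s = Matrix.diagonal s := by
  ext x y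
  by_cases h : x = y
  · simp [monomialMatrix, h]
  · simp [monomialMatrix, h]

theorem monomialMatrix_transpose {f : K → K} (hf : ∀ x, f (f x) = x) (s : K → ℂ) :
    (monomialMatrix f s).transpose = monomialMatrix f fun y => s (f y) := by
  ext x y
  have : y = f x ↔ x = f y := ⟨fun h => by rw [h, hf], fun h => by rw [h, hf]⟩
  by_cases h : x = f y
  · simp [monomialMatrix, h, hf]
  · simp [monomialMatrix, h, this]

end Monomial

section JordanWigner

variable {n : ℕ}

/-- The change of the occupation of the mode `k`. -/
def flipMode (k : Fin n) (y : Fock n) : Fock n := Function.update y k (!y k)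

/-- The Jordan-Wigner string of the mode `k`. -/
def jwString (k : Fin n) (y : Fock n) : ℂ :=
  ∏ j ∈ Finset.univ.filter (fun j => j < k), if y j then (-1 : ℂ) else 1

/-- The phase of a Majorana operator of a single mode. -/
def majPhase (e : Fin 2) (b : Bool) : ℂ :=
  if e = 0 then 1 else if b then Complex.I else -Complex.I

/-- The eigenvalues of the parity operator. -/
def paritySign (y : Fock n) : ℂ := ∏ j, if y j then (-1 : ℂ) else 1

theorem majorana_eq (i : Maj n) :
    majorana i = monomialMatrix (flipMode i.1) fun y => jwString i.1 y * majPhase i.2 (y i.1) := rfl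

theorem parity_eq : parity n = monomialMatrix id paritySign := (monomialMatrix_id _).symm

theorem flipMode_flipMode (k : Fin n) (y : Fock n) : flipMode k (flipMode k y) = y := by
  simp [flipMode]

theorem flipMode_self (k : Fin n) (y : Fock n) : flipMode k y k = !y k := by simp [flipMode]

theorem flipMode_of_ne {k l : Fin n} (h : k ≠ l) (y : Fock n) : flipMode l y k = y k := by
  simp [flipMode, h]

theorem flipMode_comm {k l : Fin n} (h : k ≠ l) (y : Fock n) :
    flipMode k (flipMode l y) = flipMode l (flipMode k y) := by
  simp only [flipMode, Function.update_of_ne h, Function.update_of_ne h.symm]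
  rw [Function.update_comm h]

theorem sign_flipMode (k j : Fin n) (y : Fock n) :
    (if flipMode k y j then (-1 : ℂ) else 1) =
      (if j = k then -1 else 1) * if y j then (-1 : ℂ) else 1 := by
  by_cases h : j = k
  · subst h
    cases hy : y j <;> simp [flipMode_self, hy]
  · simp [flipMode_of_ne h, h]

theorem jwString_flipMode (k l : Fin n) (y : Fock n) :
    jwString k (flipMode l y) = (if l < k then -1 else 1) * jwString k y := by
  simp only [jwString, sign_flipMode, Finset.prod_mul_distrib]
  congr 1
  rw [Finset.prod_ite_eq']
  simp

theorem paritySign_flipMode (k : Fin n) (y : Fock n) :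
    paritySign (flipMode k y) = -paritySign y := by
  simp only [paritySign, sign_flipMode, Finset.prod_mul_distrib]
  rw [Finset.prod_ite_eq']
  simp

theorem jwString_sq (k : Fin n) (y : Fock n) : jwString k y * jwString k y = 1 := by
  rw [jwString, ← Finset.prod_mul_distrib]
  refine Finset.prod_eq_one fun j _ => ?_
  split_ifs <;> simp

theorem paritySign_sq (y : Fock n) : paritySign y * paritySign y = 1 := by
  rw [paritySign, ← Finset.prod_mul_distrib]
  refine Finset.prod_eq_one fun j _ => ?_
  split_ifs <;> simp

theorem star_jwString (k : Fin n) (y : Fock n) : star (jwString k y) = jwString k y := by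
  rw [jwString, star_prod]
  refine Finset.prod_congr rfl fun j _ => ?_
  split_ifs <;> simp

theorem star_paritySign (y : Fock n) : star (paritySign y) = paritySign y := by
  rw [paritySign, star_prod]
  refine Finset.prod_congr rfl fun j _ => ?_
  split_ifs <;> simp

theorem isCAR_majorana : IsCAR (majorana (n := n)) := by
  rintro ⟨k, e⟩ ⟨l, f⟩
  simp only [majorana_eq, monomialMatrix_mul]
  by_cases hkl : k = l
  · subst hkl
    have hid : flipMode k ∘ flipMode k = id := funext (flipMode_flipMode k)
    rw [hid, monomialMatrix_add, monomialMatrix_id]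
    have h2 : (2 : Op n) = Matrix.diagonal fun _ => 2 := by
      rw [show (2 : Op n) = 1 + 1 by norm_num, ← Matrix.diagonal_one, Matrix.diagonal_add]
      norm_num
    have h0 : (0 : Op n) = Matrix.diagonal fun _ => 0 := by simp
    rw [h2, h0, ← apply_ite Matrix.diagonal]
    congr 1
    funext y
    simp only [jwString_flipMode, lt_irrefl, if_false, one_mul, flipMode_self]
    have hs := jwString_sq k y
    have hI := Complex.I_mul_I
    fin_cases e <;> fin_cases f <;> cases y k <;> simp [majPhase] <;>
      first
      | ring1
      | linear_combination 2 * hs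
      | linear_combination 2 * hs - 2 * jwString k y * jwString k y * hI
  · have hc : flipMode l ∘ flipMode k = flipMode k ∘ flipMode l :=
      funext fun y => (flipMode_comm hkl y).symm
    rw [hc, monomialMatrix_add, if_neg (by simp [hkl])]
    ext x y
    simp only [monomialMatrix, Matrix.of_apply, jwString_flipMode, flipMode_of_ne hkl,
      flipMode_of_ne (Ne.symm hkl), Matrix.zero_apply]
    rcases lt_or_gt_of_ne hkl with h | h
    · rw [if_neg h.asymm, if_pos h]
      split_ifs <;> ring
    · rw [if_neg h.asymm, if_pos h]
      split_ifs <;> ring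

theorem parity_mul_self : parity n * parity n = 1 := by
  rw [parity_eq, monomialMatrix_mul, Function.comp_id, monomialMatrix_id, ← Matrix.diagonal_one]
  simp [paritySign_sq]

theorem parity_conjTranspose : (parity n).conjTranspose = parity n := by
  rw [parity_eq, monomialMatrix_id, Matrix.diagonal_conjTranspose]
  congr 1
  funext y
  simp [star_paritySign]

theorem parity_mul_majorana (i : Maj n) : parity n * majorana i = -(majorana i * parity n) := by
  rw [parity_eq, majorana_eq, monomialMatrix_mul, monomialMatrix_mul, monomialMatrix_neg]
  simp only [Function.id_comp, Function.comp_id, id_eq, paritySign_flipMode]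
  congr 1
  funext y
  ring

theorem majorana_transpose (i : Maj n) :
    (majorana i).transpose = (if i.2 = 0 then (1 : ℂ) else -1) • majorana i := by
  rw [majorana_eq, monomialMatrix_transpose (flipMode_flipMode i.1)]
  ext x y
  obtain ⟨k, e⟩ := i
  simp only [monomialMatrix, Matrix.smul_apply, Matrix.of_apply, jwString_flipMode, flipMode_self,
    lt_irrefl, if_false, one_mul]
  fin_cases e <;> cases y k <;> simp [majPhase]

theorem majorana_conjTranspose (i : Maj n) : (majorana i).conjTranspose = majorana i := by
  have h : (majorana i).map star = (if i.2 = 0 then (1 : ℂ) else -1) • majorana i := by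
    rw [majorana_eq]
    ext x y
    obtain ⟨k, e⟩ := i
    simp only [monomialMatrix, Matrix.smul_apply, Matrix.map_apply, Matrix.of_apply, apply_ite star,
      star_mul', star_jwString, star_zero]
    fin_cases e <;> cases y k <;> simp [majPhase]
  rw [Matrix.conjTranspose, majorana_transpose, Matrix.map_smul' _ _ _ star_mul', h, smul_smul]
  split_ifs <;> simp

end JordanWigner

/-! ### Graded tensor products -/

section Composite

variable {K K' ι ι' : Type*} [Fintype K] [DecidableEq K] [Fintype K'] [DecidableEq K']
  [DecidableEq ι] [DecidableEq ι']

/-- A Hermitian involution anticommuting with the given operators. -/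
structure IsGrading (P : Matrix K K ℂ) (c : ι → Matrix K K ℂ) : Prop where
  mul_self : P * P = 1
  conjTranspose : P.conjTranspose = P
  anticomm : ∀ i, P * c i = -(c i * P)

/-- The Majorana operators of a composite system. -/
def joinMajorana (P : Matrix K K ℂ) (c : ι → Matrix K K ℂ) (d : ι' → Matrix K' K' ℂ) :
    ι ⊕ ι' → Matrix (K × K') (K × K') ℂ :=
  Sum.elim (fun i => c i ⊗ₖ (1 : Matrix K' K' ℂ)) (fun j => P ⊗ₖ d j)

/-- The grading `P` on the first party turns commuting tensor factors into anticommuting ones, and P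
* P = 1 leaves the relations within the second party intact. -/
theorem isCAR_joinMajorana {P : Matrix K K ℂ} {c : ι → Matrix K K ℂ} {d : ι' → Matrix K' K' ℂ}
    (hP : IsGrading P c) (hc : IsCAR c) (hd : IsCAR d) : IsCAR (joinMajorana P c d) := by
  rintro (i | i) (j | j)
  · simp only [joinMajorana, Sum.elim_inl, ← Matrix.mul_kronecker_mul, ← Matrix.add_kronecker,
      mul_one, hc i j, Sum.inl.injEq]
    split_ifs
    · rw [show (2 : Matrix K K ℂ) = 1 + 1 by norm_num, Matrix.add_kronecker,
        Matrix.one_kronecker_one]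
      norm_num
    · simp
  · simp only [joinMajorana, Sum.elim_inl, Sum.elim_inr, ← Matrix.mul_kronecker_mul, hP.anticomm]
    simp [← Matrix.add_kronecker]
  · simp only [joinMajorana, Sum.elim_inl, Sum.elim_inr, ← Matrix.mul_kronecker_mul, hP.anticomm]
    simp [← Matrix.add_kronecker]
  · simp only [joinMajorana, Sum.elim_inr, ← Matrix.mul_kronecker_mul, ← Matrix.kronecker_add,
      hP.mul_self, hd i j, Sum.inr.injEq]
    split_ifs
    · rw [show (2 : Matrix K' K' ℂ) = 1 + 1 by norm_num, Matrix.kronecker_add,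
        Matrix.one_kronecker_one]
      norm_num
    · simp

theorem isGrading_joinMajorana {P : Matrix K K ℂ} {c : ι → Matrix K K ℂ} {Q : Matrix K' K' ℂ}
    {d : ι' → Matrix K' K' ℂ} (hP : IsGrading P c) (hQ : IsGrading Q d) :
    IsGrading (P ⊗ₖ Q) (joinMajorana P c d) where
  mul_self := by
    rw [← Matrix.mul_kronecker_mul, hP.mul_self, hQ.mul_self, Matrix.one_kronecker_one]
  conjTranspose := by rw [Matrix.conjTranspose_kronecker, hP.conjTranspose, hQ.conjTranspose]
  anticomm := by
    rintro (i | i)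
    · simp only [joinMajorana, Sum.elim_inl, ← Matrix.mul_kronecker_mul, hP.anticomm]
      ext
      simp [Matrix.kroneckerMap_apply]
    · simp only [joinMajorana, Sum.elim_inr, ← Matrix.mul_kronecker_mul, hQ.anticomm]
      ext
      simp [Matrix.kroneckerMap_apply]

theorem joinMajorana_conjTranspose {P : Matrix K K ℂ} {c : ι → Matrix K K ℂ}
    {d : ι' → Matrix K' K' ℂ} (hP : P.conjTranspose = P) (hc : ∀ i, (c i).conjTranspose = c i)
    (hd : ∀ i, (d i).conjTranspose = d i) (a : ι ⊕ ι') :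
    (joinMajorana P c d a).conjTranspose = joinMajorana P c d a := by
  rcases a with i | i <;>
    simp [joinMajorana, Matrix.conjTranspose_kronecker, hP, hc, hd]

/-- A product of Majorana operators of a composite system is a product operator. -/
theorem prod_map_joinMajorana (P : Matrix K K ℂ) (c : ι → Matrix K K ℂ) (d : ι' → Matrix K' K' ℂ)
    (l : List (ι ⊕ ι')) :
    (l.map (joinMajorana P c d)).prod =
      (l.map (Sum.elim c fun _ => P)).prod ⊗ₖ ((l.filterMap Sum.getRight?).map d).prod := by
  induction l with
  | nil => simp
  | cons a l ih =>
    rw [List.map_cons, List.prod_cons, ih]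
    rcases a with i | i <;>
      simp [joinMajorana, ← Matrix.mul_kronecker_mul, List.filterMap_cons]

variable {r n : ℕ}

theorem pairMajorana_eq :
    pairMajorana (r := r) (n := n) = joinMajorana (parity r) majorana majorana := rfl

theorem isGrading_parity : IsGrading (parity n) majorana :=
  ⟨parity_mul_self, parity_conjTranspose, parity_mul_majorana⟩

theorem isCAR_pairMajorana : IsCAR (pairMajorana (r := r) (n := n)) :=
  isCAR_joinMajorana isGrading_parity isCAR_majorana isCAR_majorana

theorem isGrading_pairMajorana : IsGrading (parity r ⊗ₖ parity n) pairMajorana :=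
  isGrading_joinMajorana isGrading_parity isGrading_parity

theorem pairMajorana_conjTranspose (a : Maj r ⊕ Maj n) :
    (pairMajorana a).conjTranspose = pairMajorana a :=
  joinMajorana_conjTranspose parity_conjTranspose majorana_conjTranspose majorana_conjTranspose a

theorem ext_of_trace_majorana {X Y : Op n}
    (h : ∀ l : List (Maj n), l.Nodup → (X * (l.map majorana).prod).trace =
      (Y * (l.map majorana).prod).trace) : X = Y := by
  refine isCAR_majorana.ext_of_trace (by simp) ?_ h
  simp [pow_mul]

theorem ext_of_trace_pairMajorana {X Y : Matrix (Fock r × Fock n) (Fock r × Fock n) ℂ}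
    (h : ∀ l : List (Maj r ⊕ Maj n), l.Nodup → (X * (l.map pairMajorana).prod).trace =
      (Y * (l.map pairMajorana).prod).trace) : X = Y := by
  refine isCAR_pairMajorana.ext_of_trace ?_ ?_ h
  · exact ⟨r + n, by simp; ring⟩
  · simp [pow_add, pow_mul, mul_pow]

end Composite


/-! ### Wick's theorem for pure Gaussian states -/

section Wick

variable {K : Type*} {ι : Type} [Fintype K] [DecidableEq K]

/-- Moving an annihilator through a product of Majorana operators. -/
theorem annihilator_mul_prod {c : ι → Matrix K K ℂ} {α : Matrix K K ℂ} {e : ι → ℂ}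
    (h : ∀ b, α * c b + c b * α = e b • (1 : Matrix K K ℂ)) (l : List ι) :
    α * (l.map c).prod = ∑ j : Fin l.length,
      ((-1) ^ (j : ℕ) * e (l.get j)) • ((l.eraseIdx j).map c).prod +
      (-1 : ℂ) ^ l.length • ((l.map c).prod * α) := by
  induction l with
  | nil => simp
  | cons b l ih =>
    have hb : α * c b = e b • (1 : Matrix K K ℂ) - c b * α := eq_sub_of_add_eq (h b)
    simp only [List.map_cons, List.prod_cons, List.length_cons]
    rw [← mul_assoc, hb, sub_mul, mul_assoc, ih, Fin.sum_univ_succ]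
    simp only [Fin.val_zero, pow_zero, one_mul, List.get_cons_zero, List.eraseIdx_cons_zero,
      Fin.val_succ, List.eraseIdx_cons_succ, List.map_cons, List.prod_cons,
      mul_add, Finset.mul_sum, smul_mul_assoc, mul_smul_comm, pow_succ]
    rw [sub_add_eq_sub_sub, sub_eq_add_neg, sub_eq_add_neg, ← Finset.sum_neg_distrib]
    congr 1
    · congr 1
      refine Finset.sum_congr rfl fun j _ => ?_
      rw [← neg_smul, show (b :: l).get j.succ = l.get j from rfl]
      congr 1
      ring
    · rw [← neg_smul, mul_assoc]
      congr 1
      ring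

/-- Replace the first Majorana operator by its annihilating part α, push α to the right through the
remaining product and drop it against ρ by cyclicity. What is left is the recursion defining `wick`.
-/
theorem trace_prod_eq_wick {c α : ι → Matrix K K ℂ} {ρ : Matrix K K ℂ} {E : ι → ι → ℂ}
    (htr : ρ.trace = 1) (h1 : ∀ a x, (ρ * (c a * x)).trace = (ρ * (α a * x)).trace)
    (h2 : ∀ a, α a * ρ = 0) (h3 : ∀ a b, α a * c b + c b * α a = E a b • (1 : Matrix K K ℂ))
    (l : List ι) : (ρ * (l.map c).prod).trace = wick E l := by
  induction hl : l.length using Nat.strong_induction_on generalizing l with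
  | _ m ih =>
    cases l with
    | nil => simp [wick, htr]
    | cons a l =>
      rw [List.map_cons, List.prod_cons, h1, annihilator_mul_prod (h3 a), wick, mul_add,
        Matrix.trace_add]
      have : (ρ * (-1 : ℂ) ^ l.length • ((l.map c).prod * α a)).trace = 0 := by
        rw [mul_smul_comm, Matrix.trace_smul, Matrix.trace_mul_comm, mul_assoc, h2]
        simp
      rw [this, add_zero, Finset.mul_sum, Matrix.trace_sum]
      refine Finset.sum_congr rfl fun j _ => ?_
      rw [mul_smul_comm, Matrix.trace_smul, smul_eq_mul, ih _ _ _ rfl]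
      rw [← hl, List.length_eraseIdx_of_lt j.2, List.length_cons]
      omega

end Wick

section Pure

variable {K : Type*} {ι : Type} [Fintype K] [DecidableEq K] [Fintype ι] [DecidableEq ι]

/-- The pure state of a vector. -/
def pureState (Ψ : K → ℂ) : Matrix K K ℂ := Matrix.vecMulVec Ψ (star Ψ)

/-- The complex linear combinations of Majorana operators. -/
def majComb (c : ι → Matrix K K ℂ) (v : ι → ℂ) : Matrix K K ℂ := ∑ b, v b • c b

/-- The two-point function with covariance matrix `M`. -/
def twoPoint (M : Matrix ι ι ℝ) : Matrix ι ι ℂ := 1 - Complex.I • M.map Complex.ofReal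

theorem twoPoint_apply (M : Matrix ι ι ℝ) (a b : ι) :
    twoPoint M a b = (if a = b then 1 else 0) - Complex.I * M a b := by
  simp [twoPoint, Matrix.one_apply]

theorem majComb_add (c : ι → Matrix K K ℂ) (v w : ι → ℂ) :
    majComb c (v + w) = majComb c v + majComb c w := by
  simp [majComb, add_smul, Finset.sum_add_distrib]

theorem majComb_smul (c : ι → Matrix K K ℂ) (r : ℂ) (v : ι → ℂ) :
    majComb c (r • v) = r • majComb c v := by
  simp [majComb, smul_smul, Finset.smul_sum]

theorem majComb_single (c : ι → Matrix K K ℂ) (a : ι) : majComb c (Pi.single a 1) = c a := by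
  simp [majComb, Pi.single_apply, ite_smul]

theorem majComb_anticomm {c : ι → Matrix K K ℂ} (hc : IsCAR c) (v w : ι → ℂ) :
    majComb c v * majComb c w + majComb c w * majComb c v = (2 * v ⬝ᵥ w) • (1 : Matrix K K ℂ) := by
  simp only [majComb, Finset.sum_mul_sum, dotProduct]
  rw [Finset.sum_comm (s := Finset.univ) (f := fun i j => w i • c i * v j • c j),
    ← Finset.sum_add_distrib]
  have : ∀ i, (∑ j, v i • c i * w j • c j + ∑ j, w j • c j * v i • c i) =
      (2 * (v i * w i)) • (1 : Matrix K K ℂ) := by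
    intro i
    rw [← Finset.sum_add_distrib, Finset.sum_eq_single i]
    · have := hc.mul_self i
      simp only [smul_mul_assoc, mul_smul_comm, this, smul_smul, ← add_smul]
      congr 1
      ring
    · intro j _ hj
      have := hc i j
      rw [if_neg (Ne.symm hj)] at this
      simp only [smul_mul_assoc, mul_smul_comm, smul_smul]
      rw [mul_comm (w j), ← smul_add, this, smul_zero]
    · simp
  simp only [this, ← Finset.sum_smul, Finset.mul_sum]

theorem majComb_conjTranspose {c : ι → Matrix K K ℂ} (hc : ∀ i, (c i).conjTranspose = c i)
    (v : ι → ℂ) : (majComb c v).conjTranspose = majComb c (star v) := by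
  simp [majComb, Matrix.conjTranspose_sum, hc]

theorem trace_pureState_mul (Ψ : K → ℂ) (X : Matrix K K ℂ) :
    (pureState Ψ * X).trace = star Ψ ⬝ᵥ X.mulVec Ψ := by
  rw [pureState, Matrix.vecMulVec_mul, Matrix.trace_vecMulVec, dotProduct_comm,
    ← Matrix.dotProduct_mulVec]

theorem pureState_posSemidef (Ψ : K → ℂ) : (pureState Ψ).PosSemidef :=
  Matrix.posSemidef_vecMulVec_self_star Ψ

theorem isState_pureState {K : Type} [Fintype K] [DecidableEq K] {Ψ : K → ℂ} (h : star Ψ ⬝ᵥ Ψ = 1) :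
    IsState (pureState Ψ) :=
  ⟨pureState_posSemidef Ψ, by rw [pureState, Matrix.trace_vecMulVec, dotProduct_comm, h]⟩

/-- Wick's theorem for pure Gaussian states. -/
theorem trace_pureState_prod {c : ι → Matrix K K ℂ} (hc : IsCAR c)
    (hh : ∀ i, (c i).conjTranspose = c i) (M : Matrix ι ι ℝ) {Ψ : K → ℂ} (h1 : star Ψ ⬝ᵥ Ψ = 1)
    (h : ∀ a, (majComb c (twoPoint M a)).mulVec Ψ = 0) (l : List ι) :
    (pureState Ψ * (l.map c).prod).trace = wick (twoPoint M) l := by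
  -- Conjugating a row of 1 - iM flips the sign of the covariance part, so the two conjugate rows
  -- add up to twice a basis vector.
  have hβ : ∀ a, majComb c (star (twoPoint M a)) = 2 • c a - majComb c (twoPoint M a) := by
    intro a
    rw [eq_sub_iff_add_eq, ← majComb_add, two_smul, ← majComb_single c a, ← majComb_add]
    congr 1
    funext b
    simp [twoPoint_apply, Pi.single_apply, eq_comm (a := a) (b := b), apply_ite (starRingEnd ℂ)]
  refine trace_prod_eq_wick (α := fun a => (2 : ℂ)⁻¹ • majComb c (twoPoint M a)) ?_ ?_ ?_ ?_ l
  · rw [pureState, Matrix.trace_vecMulVec, dotProduct_comm, h1]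
  · intro a x
    have h0 : pureState Ψ * majComb c (star (twoPoint M a)) = 0 := by
      rw [pureState, Matrix.vecMulVec_mul, ← majComb_conjTranspose hh,
        Matrix.vecMul_conjTranspose, star_star, h]
      simp
    -- The splitting into creation and annihilation parts; the creation part is killed by the bra.
    have h2 : c a = (2 : ℂ)⁻¹ • majComb c (star (twoPoint M a)) +
        (2 : ℂ)⁻¹ • majComb c (twoPoint M a) := by
      rw [hβ, ← smul_add, sub_add_cancel, ← Nat.cast_smul_eq_nsmul ℂ, smul_smul]
      norm_num
    conv_lhs => rw [h2, add_mul, mul_add, Matrix.trace_add, smul_mul_assoc, mul_smul_comm,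
      ← mul_assoc, h0]
    simp
  · intro a
    rw [smul_mul_assoc, pureState, Matrix.mul_vecMulVec, h]
    simp
  · intro a b
    have := majComb_anticomm hc (twoPoint M a) (Pi.single b 1)
    rw [majComb_single] at this
    rw [smul_mul_assoc, mul_smul_comm, ← smul_add, this, smul_smul]
    simp

theorem wick_pair {ι : Type} (E : ι → ι → ℂ) (a b : ι) : wick E [a, b] = E a b := by
  simp [wick]

theorem isGaussianState_pureState {K : Type} [Fintype K] [DecidableEq K] {c : ι → Matrix K K ℂ}
    (hc : IsCAR c) (hh : ∀ i, (c i).conjTranspose = c i) (M : Matrix ι ι ℝ) {Ψ : K → ℂ}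
    (h1 : star Ψ ⬝ᵥ Ψ = 1) (h : ∀ a, (majComb c (twoPoint M a)).mulVec Ψ = 0) :
    IsGaussianState c (pureState Ψ) := by
  refine ⟨isState_pureState h1, fun l _ => ?_⟩
  rw [trace_pureState_prod hc hh M h1 h]
  congr 1
  funext a b
  have := (trace_pureState_prod hc hh M h1 h [a, b]).trans (wick_pair _ a b)
  simpa using this.symm

/-- The two-point function of a state. -/
theorem trace_mul_mul_eq_twoPoint {K : Type} [Fintype K] [DecidableEq K] {c : ι → Matrix K K ℂ}
    (hc : IsCAR c) (hh : ∀ i, (c i).conjTranspose = c i) {ρ : Matrix K K ℂ} (hρ : IsState ρ)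
    (a b : ι) : (ρ * (c a * c b)).trace = twoPoint (covMatrix c ρ) a b := by
  have h1 : star (ρ * (c a * c b)).trace = (ρ * (c b * c a)).trace := by
    rw [← Matrix.trace_conjTranspose, Matrix.conjTranspose_mul, Matrix.conjTranspose_mul, hh, hh,
      hρ.1.1, Matrix.trace_mul_comm]
  have h2 : (ρ * (c a * c b)).trace + (ρ * (c b * c a)).trace = if a = b then 2 else 0 := by
    rw [← Matrix.trace_add, ← mul_add, hc a b]
    split_ifs
    · rw [mul_two, Matrix.trace_add, hρ.2]
      norm_num
    · simp
  rw [twoPoint_apply, covMatrix, Matrix.of_apply, mul_sub, Matrix.trace_sub, ← h1]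
  rw [← h1] at h2
  set z := (ρ * (c a * c b)).trace
  have hre := congrArg Complex.re h2
  apply Complex.ext
  · split_ifs at hre ⊢ <;> simp at hre ⊢ <;> linarith
  · split_ifs <;> simp <;> ring

theorem covMatrix_eq_of_twoPoint {K : Type} [Fintype K] [DecidableEq K] {c : ι → Matrix K K ℂ}
    (hc : IsCAR c) (hh : ∀ i, (c i).conjTranspose = c i) {ρ : Matrix K K ℂ} (hρ : IsState ρ)
    {M : Matrix ι ι ℝ} (h : ∀ a b, (ρ * (c a * c b)).trace = twoPoint M a b) :
    covMatrix c ρ = M := by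
  ext a b
  have h2 := h a b
  rw [trace_mul_mul_eq_twoPoint hc hh hρ, twoPoint_apply, twoPoint_apply] at h2
  have h3 : Complex.I * (covMatrix c ρ a b : ℂ) = Complex.I * (M a b : ℂ) := by
    linear_combination -h2
  exact_mod_cast mul_left_cancel₀ Complex.I_ne_zero h3

end Pure

/-! ### A Gaussian maximally entangled state -/

section MaximallyEntangled

variable {n : ℕ}

/-- The diagonal unitary in the definition of the maximally entangled state. -/
noncomputable def parityPhase (n : ℕ) : Op n :=
  ((1 + Complex.I) / 2) • (1 : Op n) + ((1 - Complex.I) / 2) • parity n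

/-- A Gaussian maximally entangled vector of two copies of `n` modes. -/
noncomputable def maxEntangled (n : ℕ) : Fock n × Fock n → ℂ :=
  ((Real.sqrt (2 ^ n))⁻¹ : ℂ) • Matrix.vec (parityPhase n)

/-- The sign of a Majorana operator under transposition. -/
def majSign (i : Maj n) : ℝ := if i.2 = 0 then 1 else -1

/-- The covariance matrix of the maximally entangled state. -/
def maxEntangledCov (n : ℕ) : Matrix (Maj n ⊕ Maj n) (Maj n ⊕ Maj n) ℝ :=
  Matrix.fromBlocks 0 (Matrix.diagonal majSign) (-Matrix.diagonal majSign) 0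

theorem parityPhase_conjTranspose_mul : (parityPhase n).conjTranspose * parityPhase n = 1 := by
  simp only [parityPhase, Matrix.conjTranspose_add, Matrix.conjTranspose_smul,
    Matrix.conjTranspose_one, parity_conjTranspose, add_mul, mul_add, smul_mul_assoc,
    mul_smul_comm, parity_mul_self, one_mul, mul_one, smul_add, smul_smul]
  rw [add_assoc, ← add_assoc (_ • parity n), ← add_smul, add_left_comm, ← add_smul]
  have hI := Complex.I_mul_I
  rw [show (1 + Complex.I) / 2 * star ((1 - Complex.I) / 2) +
      (1 - Complex.I) / 2 * star ((1 + Complex.I) / 2) = 0 by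
    simp; linear_combination hI / 2]
  rw [show (1 + Complex.I) / 2 * star ((1 + Complex.I) / 2) +
      (1 - Complex.I) / 2 * star ((1 - Complex.I) / 2) = 1 by
    simp; linear_combination -hI / 2]
  simp

theorem star_maxEntangled_dotProduct : star (maxEntangled n) ⬝ᵥ maxEntangled n = 1 := by
  have h : star (Matrix.vec (parityPhase n)) ⬝ᵥ Matrix.vec (parityPhase n) = 2 ^ n := by
    rw [Matrix.star_vec_dotProduct_vec, parityPhase_conjTranspose_mul]
    simp
  rw [maxEntangled, star_smul, smul_dotProduct, dotProduct_smul, h, smul_smul, smul_eq_mul]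
  have h2 : (Real.sqrt (2 ^ n) : ℂ) * (Real.sqrt (2 ^ n) : ℂ) = 2 ^ n := by
    rw [← Complex.ofReal_mul, Real.mul_self_sqrt (by positivity)]
    simp
  have h3 : (2 : ℂ) ^ n ≠ 0 := by simp
  simp only [star_inv₀, Complex.star_def, Complex.conj_ofReal]
  rw [← mul_inv, h2, inv_mul_cancel₀ h3]

/-- Transposition moves a Majorana operator to the other copy, but the Jordan–Wigner string leaves a
stray parity operator. The phase `parityPhase`, equal to 1 on even and i on odd vectors, absorbs it,
so that the state is annihilated by operators linear in the Majorana operators. -/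
theorem majorana_mulVec_maxEntangled (i : Maj n) :
    (majorana i ⊗ₖ (1 : Op n)).mulVec (maxEntangled n) =
      (Complex.I * majSign i) • (parity n ⊗ₖ majorana i).mulVec (maxEntangled n) := by
  have hs : ((majSign i : ℝ) : ℂ) = if i.2 = 0 then 1 else -1 := by
    simp only [majSign]; split_ifs <;> simp
  have hpt : (parity n).transpose = parity n := by simp [parity]
  have key : parityPhase n * majorana i = Complex.I • (majorana i * parityPhase n * parity n) := by
    simp only [parityPhase, add_mul, mul_add, smul_mul_assoc, mul_smul_comm, one_mul, mul_one,
      mul_assoc, parity_mul_self, parity_mul_majorana, smul_add, smul_smul]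
    have hI := Complex.I_mul_I
    rw [smul_neg, ← neg_smul, add_comm]
    congr 1 <;> congr 1
    · linear_combination -hI / 2
    · linear_combination hI / 2
  rw [maxEntangled, Matrix.mulVec_smul, Matrix.mulVec_smul, Matrix.kronecker_mulVec_vec,
    Matrix.kronecker_mulVec_vec, smul_comm]
  congr 1
  rw [hpt, majorana_transpose, one_mul, mul_smul_comm, key, ← hs, ← Matrix.vec_smul, smul_smul,
    mul_comm]

theorem twoPoint_mulVec_maxEntangled (a : Maj n ⊕ Maj n) :
    (majComb pairMajorana (twoPoint (maxEntangledCov n) a)).mulVec (maxEntangled n) = 0 := by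
  have hI := Complex.I_mul_I
  rcases a with i | i
  · have hi : majComb pairMajorana (twoPoint (maxEntangledCov n) (Sum.inl i)) =
        majorana i ⊗ₖ (1 : Op n) - (Complex.I * majSign i) • (parity n ⊗ₖ majorana i) := by
      simp only [majComb, Fintype.sum_sum_type, twoPoint_apply, maxEntangledCov,
        Matrix.fromBlocks_apply₁₁, Matrix.fromBlocks_apply₁₂, Matrix.diagonal_apply, pairMajorana]
      simp [apply_ite Complex.ofReal, mul_ite, ite_smul, sub_eq_add_neg]
    rw [hi, Matrix.sub_mulVec, majorana_mulVec_maxEntangled, Matrix.smul_mulVec, sub_self]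
  · have hi : majComb pairMajorana (twoPoint (maxEntangledCov n) (Sum.inr i)) =
        (Complex.I * majSign i) • (majorana i ⊗ₖ (1 : Op n)) + parity n ⊗ₖ majorana i := by
      simp only [majComb, Fintype.sum_sum_type, twoPoint_apply, maxEntangledCov,
        Matrix.fromBlocks_apply₂₁, Matrix.fromBlocks_apply₂₂, Matrix.diagonal_apply, pairMajorana,
        Matrix.neg_apply]
      simp [apply_ite Complex.ofReal, mul_ite, ite_smul]
    have hs : ((majSign i : ℝ) : ℂ) * majSign i = 1 := by
      simp only [majSign]; split_ifs <;> simp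
    rw [hi, Matrix.add_mulVec, Matrix.smul_mulVec, majorana_mulVec_maxEntangled, smul_smul,
      show Complex.I * (majSign i : ℂ) * (Complex.I * (majSign i : ℂ)) = -1 by
        linear_combination (majSign i : ℂ) * majSign i * hI - hs]
    simp

theorem isGaussianState_maxEntangled :
    IsGaussianState pairMajorana (pureState (maxEntangled n)) :=
  isGaussianState_pureState isCAR_pairMajorana pairMajorana_conjTranspose _
    star_maxEntangled_dotProduct twoPoint_mulVec_maxEntangled

theorem covMatrix_maxEntangled :
    covMatrix pairMajorana (pureState (maxEntangled n)) = maxEntangledCov n := by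
  refine covMatrix_eq_of_twoPoint isCAR_pairMajorana pairMajorana_conjTranspose
    isGaussianState_maxEntangled.1 fun a b => ?_
  have := trace_pureState_prod isCAR_pairMajorana pairMajorana_conjTranspose _
    star_maxEntangled_dotProduct (twoPoint_mulVec_maxEntangled (n := n)) [a, b]
  replace this := this.trans (wick_pair _ a b)
  simpa using this

end MaximallyEntangled


/-! ### Wick's theorem in operator form -/

theorem wick_of_odd {ι : Type} (E : ι → ι → ℂ) (l : List ι) (hl : Odd l.length) :
    wick E l = 0 := by
  induction hm : l.length using Nat.strong_induction_on generalizing l with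
  | _ m ih =>
    cases l with
    | nil => simp at hl
    | cons a l =>
      rw [wick]
      refine Finset.sum_eq_zero fun j _ => ?_
      have hlen : (l.eraseIdx j).length + 1 = l.length := by
        rw [List.length_eraseIdx_of_lt j.2]
        have := j.2
        omega
      rw [List.length_cons] at hl hm
      rw [ih (l.eraseIdx j).length (by omega) _ ?_ rfl, mul_zero]
      rw [Nat.odd_iff] at hl ⊢
      omega

section QuasiFree

variable {K ι : Type} [Fintype K] [DecidableEq K] [Fintype ι] [DecidableEq ι]
  {c : ι → Matrix K K ℂ} {P : Matrix K K ℂ}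

theorem IsGrading.conj_prod (hP : IsGrading P c) (l : List ι) :
    P * (l.map c).prod * P = (-1 : ℂ) ^ l.length • (l.map c).prod := by
  induction l with
  | nil => simp [hP.mul_self]
  | cons a l ih =>
    have h : P * (c a * (l.map c).prod) * P = -(c a * (P * (l.map c).prod * P)) := by
      rw [← mul_assoc, hP.anticomm]
      simp only [neg_mul, mul_assoc]
    rw [List.map_cons, List.prod_cons, h, ih, List.length_cons, pow_succ]
    simp

/-- The derivation-like map that removes a Majorana operator. -/
noncomputable def oddDeriv (P : Matrix K K ℂ) (c : ι → Matrix K K ℂ) (b : ι) :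
    Matrix K K ℂ →ₗ[ℂ] Matrix K K ℂ where
  toFun y := (2 : ℂ)⁻¹ • (c b * y - P * y * P * c b)
  map_add' x y := by
    rw [← smul_add]
    congr 1
    noncomm_ring
  map_smul' r x := by
    simp only [mul_smul_comm, smul_mul_assoc, RingHom.id_apply, ← smul_sub]
    rw [smul_comm]

theorem oddDeriv_apply (P : Matrix K K ℂ) (c : ι → Matrix K K ℂ) (b : ι) (y : Matrix K K ℂ) :
    oddDeriv P c b y = (2 : ℂ)⁻¹ • (c b * y - P * y * P * c b) := rfl

theorem oddDeriv_one (hP : IsGrading P c) (b : ι) : oddDeriv P c b 1 = 0 := by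
  simp [oddDeriv_apply, hP.mul_self]

/-- The conjugation by `P` in `oddDeriv` supplies the degree sign, making the map an antiderivation:
contraction with the generator b. -/
theorem oddDeriv_mul (hc : IsCAR c) (hP : IsGrading P c) (a b : ι) (y : Matrix K K ℂ) :
    oddDeriv P c b (c a * y) = (if b = a then (1 : ℂ) else 0) • y - c a * oddDeriv P c b y := by
  have h1 : P * (c a * y) * P * c b = -(c a * (P * y * P * c b)) := by
    rw [← mul_assoc P, hP.anticomm]
    simp only [neg_mul, mul_assoc]
  have h2 : c b * (c a * y) = (if b = a then (2 : ℂ) else 0) • y - c a * (c b * y) := by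
    rw [← mul_assoc, ← mul_assoc, eq_sub_iff_add_eq, ← add_mul, hc b a]
    split_ifs
    · rw [show (2 : Matrix K K ℂ) = (2 : ℂ) • 1 by rw [two_smul]; norm_num]
      simp
    · simp
  rw [oddDeriv_apply, oddDeriv_apply, h1, h2, mul_smul_comm, mul_sub]
  split_ifs
  · module
  · module

/-- Contractions anticommute; this disposes of the double contractions with the same two-point row
that arise when an index is repeated. -/
theorem oddDeriv_comm (hc : IsCAR c) (hP : IsGrading P c) (a b : ι) (y : Matrix K K ℂ) :
    oddDeriv P c a (oddDeriv P c b y) = -oddDeriv P c b (oddDeriv P c a y) := by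
  have hPP : ∀ x : Matrix K K ℂ, P * (P * x) = x := fun x => by
    rw [← mul_assoc, hP.mul_self, one_mul]
  have e : ∀ a b, P * (c b * y - P * y * P * c b) * P * c a =
      y * (c b * c a) - c b * (P * y * P * c a) := by
    intro a b
    have h1 : P * (c b * y) * P = -(c b * (P * y * P)) := by
      rw [← mul_assoc P, hP.anticomm]
      simp only [neg_mul, mul_assoc]
    have h2 : P * (P * y * P * c b) * P = -(y * c b) := by
      simp only [mul_assoc, hPP]
      rw [← mul_assoc P, hP.anticomm, neg_mul, mul_assoc, hP.mul_self]
      simp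
    rw [mul_sub, sub_mul, h1, h2]
    noncomm_ring
  simp only [oddDeriv_apply, mul_smul_comm, smul_mul_assoc, e]
  rw [← smul_sub, ← smul_sub, ← smul_neg, ← smul_neg]
  congr 2
  have h : c a * c b * y + c b * c a * y = y * (c b * c a) + y * (c a * c b) := by
    rw [← add_mul, ← mul_add, hc a b, hc b a]
    by_cases hab : a = b
    · simp [hab, two_mul, mul_two]
    · simp [hab, Ne.symm hab]
  have h' : c a * c b * y = y * (c b * c a) + y * (c a * c b) - c b * c a * y :=
    eq_sub_of_add_eq h
  rw [mul_sub, ← mul_assoc, h']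
  noncomm_ring

theorem sum_oddDeriv_prod (hc : IsCAR c) (hP : IsGrading P c) (e : ι → ℂ) (l : List ι) :
    ∑ b, e b • oddDeriv P c b (l.map c).prod =
      ∑ j : Fin l.length, ((-1) ^ (j : ℕ) * e (l.get j)) • ((l.eraseIdx j).map c).prod := by
  induction l with
  | nil => simp [oddDeriv_one hP]
  | cons a l ih =>
    simp only [List.map_cons, List.prod_cons, List.length_cons, oddDeriv_mul hc hP]
    rw [Fin.sum_univ_succ]
    simp only [smul_sub, Finset.sum_sub_distrib, ← mul_smul_comm, ← Finset.mul_sum, ih]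
    simp only [Fin.val_zero, pow_zero, one_mul, List.get_cons_zero, List.eraseIdx_cons_zero,
      Fin.val_succ, List.eraseIdx_cons_succ, List.map_cons, List.prod_cons]
    rw [sub_eq_add_neg, Finset.mul_sum, ← Finset.sum_neg_distrib]
    congr 1
    · simp
    · refine Finset.sum_congr rfl fun j _ => ?_
      rw [mul_smul_comm, ← neg_smul, show (a :: l).get j.succ = l.get j from rfl]
      congr 1
      ring

theorem exists_prod_eq_smul (hc : IsCAR c) {a : ι} {l : List ι} (hl : l.Nodup) (ha : a ∈ l) :
    ∃ (s : ℂ) (l' : List ι), l'.Nodup ∧ a ∉ l' ∧ (l.map c).prod = s • (c a * (l'.map c).prod) := by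
  obtain ⟨l₁, l₂, rfl⟩ := List.append_of_mem ha
  refine ⟨moveSign a l₁, l₁ ++ l₂, ?_, ?_, ?_⟩
  · exact hl.sublist (by simp)
  · have := List.nodup_middle.1 hl
    exact (List.nodup_cons.1 this).1
  · have h := hc.mul_prod a l₁
    have hs : moveSign a l₁ * moveSign a l₁ = 1 := by
      rw [moveSign, ← List.prod_map_mul]
      refine List.prod_eq_one fun x hx => ?_
      obtain ⟨b, _, rfl⟩ := List.mem_map.1 hx
      split_ifs <;> simp
    simp only [List.map_append, List.prod_append, List.map_cons, List.prod_cons, ← mul_assoc]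
    rw [h, smul_mul_assoc, smul_smul, hs, one_smul]

variable {ρ : Matrix K K ℂ}

/-- Wick's theorem in operator form, for operators not containing a given Majorana operator. -/
theorem IsGaussianState.trace_mul_prod (hρ : IsGaussianState c ρ) (hc : IsCAR c)
    (hP : IsGrading P c) {a : ι} {l : List ι} (hl : l.Nodup) (ha : a ∉ l) :
    (ρ * (c a * (l.map c).prod)).trace =
      ∑ b, (ρ * (c a * c b)).trace * (ρ * oddDeriv P c b (l.map c).prod).trace := by
  have h1 := hρ.2 (a :: l) (List.nodup_cons.2 ⟨ha, hl⟩)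
  rw [List.map_cons, List.prod_cons] at h1
  rw [h1, wick]
  have h2 := congrArg (fun x => (ρ * x).trace)
    (sum_oddDeriv_prod hc hP (fun b => (ρ * (c a * c b)).trace) l)
  simp only [Finset.mul_sum, Matrix.trace_sum, mul_smul_comm, Matrix.trace_smul,
    smul_eq_mul] at h2
  rw [h2]
  refine Finset.sum_congr rfl fun j _ => ?_
  rw [hρ.2 _ (hl.sublist (List.eraseIdx_sublist _ _))]

theorem IsGaussianState.trace_mul_oddDeriv (hρ : IsGaussianState c ρ) (hc : IsCAR c)
    (hP : IsGrading P c) {a : ι} {l : List ι} (hl : l.Nodup) (ha : a ∉ l) (d : ι) :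
    (ρ * (c a * oddDeriv P c d (l.map c).prod)).trace =
      ∑ b, (ρ * (c a * c b)).trace *
        (ρ * oddDeriv P c b (oddDeriv P c d (l.map c).prod)).trace := by
  have h := sum_oddDeriv_prod hc hP (Pi.single d 1) l
  simp only [Pi.single_apply, ite_smul, one_smul, zero_smul, Finset.sum_ite_eq',
    Finset.mem_univ, if_true] at h
  rw [h]
  simp only [Finset.mul_sum, Matrix.trace_sum, mul_smul_comm, Matrix.trace_smul, smul_eq_mul,
    map_sum, map_smul]
  rw [Finset.sum_comm]
  refine Finset.sum_congr rfl fun j _ => ?_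
  rw [hρ.trace_mul_prod hc hP (hl.sublist (List.eraseIdx_sublist _ _))
    (fun h' => ha (List.mem_of_mem_eraseIdx h')), Finset.mul_sum]
  refine Finset.sum_congr rfl fun b _ => ?_
  ring

variable (hι : Even (Fintype.card ι)) (hK : 2 ^ Fintype.card ι = Fintype.card K ^ 2)
include hι hK

/-- Wick's theorem in operator form. -/
theorem IsGaussianState.trace_mul (hρ : IsGaussianState c ρ) (hc : IsCAR c)
    (hP : IsGrading P c) (a : ι) (y : Matrix K K ℂ) :
    (ρ * (c a * y)).trace =
      ∑ b, (ρ * (c a * c b)).trace * (ρ * oddDeriv P c b y).trace := by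
  have key := hc.linearMap_ext hι hK
    (f := Matrix.traceLinearMap K ℂ ℂ ∘ₗ LinearMap.mulLeft ℂ ρ ∘ₗ LinearMap.mulLeft ℂ (c a))
    (g := ∑ b, (ρ * (c a * c b)).trace •
      (Matrix.traceLinearMap K ℂ ℂ ∘ₗ LinearMap.mulLeft ℂ ρ ∘ₗ oddDeriv P c b)) ?_
  · have := LinearMap.congr_fun key y
    simpa using this
  intro l hl
  simp only [LinearMap.comp_apply, LinearMap.mulLeft_apply, Matrix.traceLinearMap_apply,
    LinearMap.sum_apply, LinearMap.smul_apply, smul_eq_mul]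
  -- Gaussianity only provides Wick's formula for distinct indices. If a already occurs in l, it is
  -- moved to the front; then c a * c a = 1, and the remaining double sum over contractions is
  -- antisymmetric, hence zero.
  by_cases ha : a ∈ l
  · obtain ⟨s, l', hl', ha', h⟩ := exists_prod_eq_smul hc hl ha
    rw [h]
    simp only [mul_smul_comm, map_smul, Matrix.trace_smul, smul_eq_mul, oddDeriv_mul hc hP, mul_sub,
      Matrix.trace_sub, hρ.trace_mul_oddDeriv hc hP hl' ha']
    rw [← mul_assoc (c a), hc.mul_self, one_mul]
    simp only [mul_left_comm _ s, ← mul_sub s]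
    rw [← Finset.mul_sum, Finset.sum_sub_distrib]
    congr 1
    have h1 : ∑ b, (ρ * (c a * c b)).trace * ∑ d, (ρ * (c a * c d)).trace *
        (ρ * oddDeriv P c d (oddDeriv P c b (l'.map c).prod)).trace = 0 := by
      have h2 : ∑ b, (ρ * (c a * c b)).trace * ∑ d, (ρ * (c a * c d)).trace *
          (ρ * oddDeriv P c d (oddDeriv P c b (l'.map c).prod)).trace =
          -∑ b, (ρ * (c a * c b)).trace * ∑ d, (ρ * (c a * c d)).trace *
          (ρ * oddDeriv P c d (oddDeriv P c b (l'.map c).prod)).trace := by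
        conv_lhs => simp only [Finset.mul_sum]
        rw [Finset.sum_comm]
        simp only [Finset.mul_sum, ← Finset.sum_neg_distrib]
        refine Finset.sum_congr rfl fun b _ => Finset.sum_congr rfl fun d _ => ?_
        rw [oddDeriv_comm hc hP b d]
        simp
        ring
      linear_combination h2 / 2
    rw [h1, sub_zero]
    simp [hc.mul_self, hρ.1.2]
  · exact hρ.trace_mul_prod hc hP hl ha

/-- Gaussian states are even. -/
theorem IsGaussianState.conj_parity (hρ : IsGaussianState c ρ) (hc : IsCAR c)
    (hP : IsGrading P c) : P * ρ * P = ρ := by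
  refine hc.ext_of_trace hι hK fun l hl => ?_
  have h : (P * ρ * P * (l.map c).prod).trace = (ρ * (P * (l.map c).prod * P)).trace := by
    rw [mul_assoc, mul_assoc, Matrix.trace_mul_comm]
    simp only [mul_assoc]
  rw [h, hP.conj_prod, mul_smul_comm, Matrix.trace_smul]
  rcases Nat.even_or_odd l.length with he | ho
  · simp [he.neg_one_pow]
  · rw [hρ.2 l hl, wick_of_odd _ _ ho, smul_zero]

theorem IsGaussianState.trace_odd (hρ : IsGaussianState c ρ) (hc : IsCAR c)
    (hP : IsGrading P c) {y : Matrix K K ℂ} (hy : P * y * P = -y) : (ρ * y).trace = 0 := by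
  have h : (P * ρ * P * y).trace = (ρ * (P * y * P)).trace := by
    rw [mul_assoc, mul_assoc, Matrix.trace_mul_comm]
    simp only [mul_assoc]
  rw [hρ.conj_parity hι hK hc hP, hy, mul_neg, Matrix.trace_neg] at h
  linear_combination h / 2

/-- A modular (KMS) relation: for odd y, the expectations of y * c a and c a * y are the same
contractions of y, weighted by the two-point functions of -M and M. Matching the weights lets a
Majorana combination pass through ρ. No inverse of either two-point matrix is needed. -/
theorem IsGaussianState.majComb_mul (hρ : IsGaussianState c ρ) (hc : IsCAR c)
    (hh : ∀ i, (c i).conjTranspose = c i) (hP : IsGrading P c) {v w : ι → ℂ}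
    (hvw : Matrix.vecMul v (twoPoint (-covMatrix c ρ)) = Matrix.vecMul w (twoPoint (covMatrix c ρ))) :
    majComb c v * ρ = ρ * majComb c w := by
  refine hc.ext_of_trace hι hK fun l hl => ?_
  rw [mul_assoc, Matrix.trace_mul_comm, mul_assoc, mul_assoc]
  have hodd : ∀ v : ι → ℂ, P * majComb c v * P = -majComb c v := by
    intro v
    simp only [majComb, Finset.mul_sum, Finset.sum_mul, mul_smul_comm, smul_mul_assoc,
      hP.anticomm, neg_mul, mul_assoc, hP.mul_self, mul_one, smul_neg, Finset.sum_neg_distrib]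
  have hPP : ∀ x y : Matrix K K ℂ, P * (x * y) * P = (P * x * P) * (P * y * P) := by
    intro x y
    have : P * x * P * (P * y * P) = P * x * (P * P) * y * P := by simp only [mul_assoc]
    rw [this, hP.mul_self]
    simp only [mul_assoc, one_mul]
  rcases Nat.even_or_odd l.length with he | ho
  -- For an even monomial both sides are expectations of odd operators in an even state.
  · have hl := hP.conj_prod l
    rw [he.neg_one_pow, one_smul] at hl
    rw [hρ.trace_odd hι hK hc hP, hρ.trace_odd hι hK hc hP]
    · rw [hPP, hl, hodd, neg_mul]
    · rw [hPP, hl, hodd, mul_neg]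
  · have hl := hP.conj_prod l
    rw [ho.neg_one_pow, neg_one_smul] at hl
    set y := (l.map c).prod
    have hE := trace_mul_mul_eq_twoPoint hc hh hρ.1
    have h1 : ∀ a, (ρ * (c a * y)).trace =
        ∑ b, twoPoint (covMatrix c ρ) a b * (ρ * oddDeriv P c b y).trace := by
      intro a
      rw [hρ.trace_mul hι hK hc hP]
      simp only [hE]
    have h2 : ∀ a, (ρ * (y * c a)).trace =
        ∑ b, twoPoint (-covMatrix c ρ) a b * (ρ * oddDeriv P c b y).trace := by
      intro a
      -- For odd y the definition of the contraction becomes an anticommutator.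
      have h3 : y * c a = (2 : ℂ) • oddDeriv P c a y - c a * y := by
        rw [oddDeriv_apply, hl, smul_smul]
        simp
      rw [h3, mul_sub, Matrix.trace_sub, h1, mul_smul_comm, Matrix.trace_smul]
      have h4 : (2 : ℂ) • (ρ * oddDeriv P c a y).trace =
          ∑ b, (if a = b then (2 : ℂ) else 0) * (ρ * oddDeriv P c b y).trace := by
        simp
      rw [h4, ← Finset.sum_sub_distrib]
      refine Finset.sum_congr rfl fun b _ => ?_
      rw [← sub_mul, twoPoint_apply, twoPoint_apply]
      congr 1
      split_ifs <;> (simp; try ring)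
    have h5 : (ρ * (y * majComb c v)).trace =
        ∑ b, Matrix.vecMul v (twoPoint (-covMatrix c ρ)) b * (ρ * oddDeriv P c b y).trace := by
      simp only [majComb, Finset.mul_sum, mul_smul_comm, Matrix.trace_sum, Matrix.trace_smul, h2,
        smul_eq_mul, Matrix.vecMul, dotProduct, Finset.sum_mul]
      rw [Finset.sum_comm]
      simp only [mul_assoc]
    have h6 : (ρ * (majComb c w * y)).trace =
        ∑ b, Matrix.vecMul w (twoPoint (covMatrix c ρ)) b * (ρ * oddDeriv P c b y).trace := by
      simp only [majComb, Finset.mul_sum, Finset.sum_mul, mul_smul_comm, smul_mul_assoc,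
        Matrix.trace_sum, Matrix.trace_smul, h1, smul_eq_mul, Matrix.vecMul, dotProduct]
      rw [Finset.sum_comm]
      simp only [mul_assoc]
    rw [h5, h6, hvw]

end QuasiFree


/-! ### Rank and pure modes of Gaussian states -/

section Rank

variable {K ι : Type} [Fintype K] [DecidableEq K] [Fintype ι] [DecidableEq ι]
  {c : ι → Matrix K K ℂ} {P : Matrix K K ℂ}

/-- An operator whose range is invariant under many Majorana operators has a large rank. -/
theorem two_pow_card_le_rank_sq {κ : Type} [Fintype κ] [DecidableEq κ] (hc : IsCAR c)
    (hκ : Even (Fintype.card κ)) {ρ : Matrix K K ℂ} (hρ : ρ ≠ 0) (w : κ → ι → ℂ)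
    (hw : ∀ a b, w a ⬝ᵥ w b = if a = b then 1 else 0)
    (hinv : ∀ a, ∃ X, majComb c (w a) * ρ = ρ * X) : 2 ^ Fintype.card κ ≤ ρ.rank ^ 2 := by
  -- The hypothesis `hinv` makes the range of ρ stable under the chosen Majorana combinations, which
  -- therefore represent a Clifford algebra there.
  set V := LinearMap.range ρ.mulVecLin with hV
  have hmem : ∀ a, ∀ x ∈ V, (majComb c (w a)).mulVecLin x ∈ V := by
    rintro a _ ⟨y, rfl⟩
    obtain ⟨X, hX⟩ := hinv a
    refine ⟨X.mulVec y, ?_⟩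
    simp only [Matrix.mulVecLin_apply, Matrix.mulVec_mulVec, hX]
  let C : κ → Module.End ℂ V := fun a => (majComb c (w a)).mulVecLin.restrict (hmem a)
  have hC : IsCAR C := by
    intro a b
    refine LinearMap.ext fun x => Subtype.ext ?_
    have h := congrArg (fun Y => Matrix.mulVec Y (x : K → ℂ)) (majComb_anticomm hc (w a) (w b))
    simp only [Matrix.add_mulVec, ← Matrix.mulVec_mulVec, hw] at h
    have h2 : (((C a * C b + C b * C a : Module.End ℂ V) x : V) : K → ℂ) =
      (majComb c (w a)).mulVec ((majComb c (w b)).mulVec x) +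
      (majComb c (w b)).mulVec ((majComb c (w a)).mulVec x) := rfl
    rw [h2, h]
    split_ifs
    · rw [show (2 : Module.End ℂ V) = (2 : ℂ) • 1 by rw [two_smul]; norm_num]
      simp [Matrix.smul_mulVec]
    · simp
  have hfin : Module.finrank ℂ V = ρ.rank := rfl
  have hpos : Module.finrank ℂ V ≠ 0 := by
    rw [hfin]
    intro h0
    have h1 := LinearMap.range_eq_bot.1 (Submodule.finrank_eq_zero.1 h0)
    exact hρ (Matrix.toLin'.injective (by rw [map_zero]; exact h1))
  have h := hC.two_pow_card_le (LinearMap.trace ℂ V) (fun x y => LinearMap.trace_mul_comm ℂ x y)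
    (by rw [LinearMap.trace_one]; exact_mod_cast hpos) hκ
  rwa [show Module.finrank ℂ (Module.End ℂ V) = Module.finrank ℂ V * Module.finrank ℂ V from
    Module.finrank_linearMap ℂ ℂ V V, ← sq, hfin] at h

/-- The kernel of `1 - i M` has half the dimension of the kernel of `1 + M²`. -/
theorem finrank_ker_real_eq (M : Matrix ι ι ℝ) :
    Module.finrank ℝ (LinearMap.ker (1 + M * M).mulVecLin) =
      2 * Module.finrank ℂ (LinearMap.ker (twoPoint M).mulVecLin) := by
  rw [← finrank_real_of_complex]
  have hv : ∀ (x y : ι → ℝ) , (twoPoint M).mulVec (fun i => (x i : ℂ) + Complex.I * y i) =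
      fun i => ((x i + M.mulVec y i : ℝ) : ℂ) + Complex.I * ((y i - M.mulVec x i : ℝ) : ℂ) := by
    intro x y
    funext i
    have hI := Complex.I_mul_I
    simp only [Matrix.mulVec, dotProduct, twoPoint_apply, sub_mul, Finset.sum_sub_distrib, ite_mul,
      one_mul, zero_mul, Finset.sum_ite_eq, Finset.mem_univ, if_true]
    push_cast
    have : ∑ j, Complex.I * (M i j : ℂ) * ((x j : ℂ) + Complex.I * y j) =
        Complex.I * ∑ j, (M i j : ℂ) * x j - ∑ j, (M i j : ℂ) * y j := by
      rw [Finset.mul_sum, ← Finset.sum_sub_distrib]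
      refine Finset.sum_congr rfl fun j _ => ?_
      linear_combination (M i j : ℂ) * y j * hI
    rw [this]
    ring
  have hker : ∀ x y : ι → ℝ, (twoPoint M).mulVec (fun i => (x i : ℂ) + Complex.I * y i) = 0 ↔
      x = -M.mulVec y ∧ y = M.mulVec x := by
    intro x y
    rw [hv]
    constructor
    · intro h
      constructor
      · funext i
        have := congrArg Complex.re (congrFun h i)
        simp at this ⊢
        linarith
      · funext i
        have := congrArg Complex.im (congrFun h i)
        simp at this ⊢
        linarith
    · rintro ⟨h1, h2⟩
      funext i
      have e1 := congrFun h1 i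
      have e2 := congrFun h2 i
      simp only [Pi.neg_apply] at e1
      rw [show x i + M.mulVec y i = 0 by linarith, show y i - M.mulVec x i = 0 by linarith]
      simp
  have hA : ∀ x : ι → ℝ, (1 + M * M).mulVec x = x + M.mulVec (M.mulVec x) := by
    intro x
    rw [Matrix.add_mulVec, Matrix.one_mulVec, Matrix.mulVec_mulVec]
  -- A vector x + iy lies in the kernel of 1 - iM exactly when y = Mx and x = -My, so x ↦ x + iMx is
  -- a real isomorphism.
  let φ : LinearMap.ker (1 + M * M).mulVecLin →ₗ[ℝ] LinearMap.ker (twoPoint M).mulVecLin :=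
    { toFun := fun x => ⟨fun i => ((x : ι → ℝ) i : ℂ) + Complex.I * (M.mulVec x i : ℝ), by
        have hx := x.2
        rw [LinearMap.mem_ker, Matrix.mulVecLin_apply, hA] at hx
        rw [LinearMap.mem_ker, Matrix.mulVecLin_apply, hker]
        exact ⟨eq_neg_of_add_eq_zero_left hx, rfl⟩⟩
      map_add' := by
        intro x y
        refine Subtype.ext (funext fun i => ?_)
        simp [Matrix.mulVec_add]
        ring
      map_smul' := by
        intro r x
        refine Subtype.ext (funext fun i => ?_)
        simp [Matrix.mulVec_smul]
        ring }
  refine (LinearEquiv.ofBijective φ ⟨?_, ?_⟩).finrank_eq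
  · intro x y hxy
    refine Subtype.ext (funext fun i => ?_)
    have := congrArg Complex.re (congrFun (congrArg Subtype.val hxy) i)
    simpa [φ] using this
  · rintro ⟨v, hvk⟩
    have hdec : v = fun i => ((v i).re : ℂ) + Complex.I * ((v i).im : ℂ) := by
      funext i
      rw [mul_comm]
      exact (Complex.re_add_im _).symm
    rw [LinearMap.mem_ker, Matrix.mulVecLin_apply, hdec, hker] at hvk
    refine ⟨⟨fun i => (v i).re, ?_⟩, ?_⟩
    · rw [LinearMap.mem_ker, Matrix.mulVecLin_apply, hA, ← hvk.2]
      nth_rw 1 [hvk.1]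
      simp
    · refine Subtype.ext (funext fun i => ?_)
      show ((v i).re : ℂ) + Complex.I * ((M.mulVec (fun i => (v i).re) i : ℝ) : ℂ) = v i
      rw [← hvk.2]
      exact (congrFun hdec i).symm

/-- A Gaussian state of small rank has many pure modes. -/
theorem IsGaussianState.card_le (hι : Even (Fintype.card ι))
    (hK : 2 ^ Fintype.card ι = Fintype.card K ^ 2) {ρ : Matrix K K ℂ}
    (hρ : IsGaussianState c ρ) (hc : IsCAR c)
    (hh : ∀ i, (c i).conjTranspose = c i) (hP : IsGrading P c) {m : ℕ} (hm : ρ.rank ≤ 2 ^ m) :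
    Fintype.card ι ≤ 2 * m +
      2 * Module.finrank ℂ (LinearMap.ker (twoPoint (covMatrix c ρ)).mulVecLin) := by
  set M := covMatrix c ρ with hM
  have hMt : M.transpose = -M := by
    ext a b
    simp only [Matrix.transpose_apply, Matrix.neg_apply, hM, covMatrix, Matrix.of_apply, mul_sub,
      Matrix.trace_sub, Complex.sub_re]
    ring
  have hA : (1 + M * M).IsHermitian := by
    rw [Matrix.IsHermitian, Matrix.conjTranspose_eq_transpose_of_trivial, Matrix.transpose_add,
      Matrix.transpose_mul, hMt]
    simp
  have hrk : (1 + M * M).rank + Module.finrank ℝ (LinearMap.ker (1 + M * M).mulVecLin) =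
      Fintype.card ι := by
    have := LinearMap.finrank_range_add_finrank_ker (1 + M * M).mulVecLin
    rwa [Module.finrank_fintype_fun_eq_card] at this
  rw [finrank_ker_real_eq] at hrk
  -- The rank of 1 + M² inherits evenness from the dimension, as its kernel has even dimension; the
  -- Clifford bound needs an even number of generators.
  have hκ : Even (1 + M * M).rank := by
    rw [Nat.even_iff] at hι ⊢
    omega
  have hρ0 : ρ ≠ 0 := by
    rintro rfl
    simpa using hρ.1.2
  have hcard := hA.rank_eq_card_non_zero_eigs
  rw [hcard] at hκ
  let w : {i // hA.eigenvalues i ≠ 0} → ι → ℝ := fun a => (hA.eigenvectorBasis a : ι → ℝ)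
  have hw : ∀ a b, w a ⬝ᵥ w b = if a = b then 1 else 0 := by
    intro a b
    have h := orthonormal_iff_ite.1 hA.eigenvectorBasis.orthonormal a b
    rw [EuclideanSpace.inner_eq_star_dotProduct] at h
    simp only [Subtype.val_inj] at h
    rw [dotProduct_comm, eq_comm]
    simpa using h.symm
  have hwA : ∀ a, (1 + M * M).mulVec (w a) = hA.eigenvalues a • w a := by
    intro a
    exact hA.mulVec_eigenvectorBasis a
  have h2 := two_pow_card_le_rank_sq hc hκ hρ0 (fun a i => (w a i : ℂ)) ?_ ?_
  · rw [← hcard] at h2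
    have h3 : 2 ^ (1 + M * M).rank ≤ 2 ^ (2 * m) := by
      refine h2.trans ?_
      rw [mul_comm, pow_mul]
      exact Nat.pow_le_pow_left hm 2
    have h4 := (Nat.pow_le_pow_iff_right (by norm_num)).1 h3
    omega
  · intro a b
    have h := congrArg Complex.ofReal (hw a b)
    simp only [dotProduct] at h ⊢
    push_cast at h
    rw [h]
    split_ifs <;> simp
  · intro a
    set v : ι → ℂ := fun i => (w a i : ℂ)
    -- The factors 1 + iM and 1 - iM commute and multiply to 1 + M². On an eigenvector with
    -- eigenvalue λ ≠ 0 this solves the matching equation of `IsGaussianState.majComb_mul` with w =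
    -- λ⁻¹ v(1 + iM)².
    have hEE : twoPoint (-M) * twoPoint M = 1 + (M * M).map Complex.ofReal := by
      have hmap : (M * M).map Complex.ofReal = M.map Complex.ofReal * M.map Complex.ofReal :=
        Matrix.map_mul (f := Complex.ofRealHom)
      have hneg : (-M).map Complex.ofReal = -M.map Complex.ofReal := by ext; simp
      rw [twoPoint, twoPoint, hmap, hneg, mul_sub, sub_mul, sub_mul]
      simp only [smul_neg, one_mul, mul_one, neg_mul, smul_mul_assoc, mul_smul_comm, smul_smul,
        Complex.I_mul_I]
      module
    have hEE' : twoPoint M * twoPoint (-M) = twoPoint (-M) * twoPoint M := by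
      rw [hEE]
      have hmap : (M * M).map Complex.ofReal = M.map Complex.ofReal * M.map Complex.ofReal :=
        Matrix.map_mul (f := Complex.ofRealHom)
      have hneg : (-M).map Complex.ofReal = -M.map Complex.ofReal := by ext; simp
      rw [twoPoint, twoPoint, hmap, hneg, mul_sub, sub_mul, sub_mul]
      simp only [smul_neg, one_mul, mul_one, mul_neg, smul_mul_assoc, mul_smul_comm, smul_smul,
        Complex.I_mul_I]
      module
    have hv : Matrix.vecMul v (1 + (M * M).map Complex.ofReal) =
        (hA.eigenvalues a : ℂ) • v := by
      have hT : (1 + M * M).transpose = 1 + M * M := by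
        rw [← Matrix.conjTranspose_eq_transpose_of_trivial]
        exact hA
      have h1 : Matrix.vecMul (w a) (1 + M * M) = hA.eigenvalues a • w a := by
        rw [← Matrix.mulVec_transpose, hT]
        exact hwA a
      funext i
      have h3 := congrArg Complex.ofReal (congrFun h1 i)
      have h4 : (1 + (M * M).map Complex.ofReal : Matrix ι ι ℂ) =
          (1 + M * M).map Complex.ofReal := by
        ext i j
        simp [Matrix.one_apply, apply_ite Complex.ofReal]
      rw [h4]
      simp only [Matrix.vecMul, dotProduct, Pi.smul_apply, smul_eq_mul] at h3 ⊢
      push_cast at h3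
      exact h3
    refine ⟨majComb c ((hA.eigenvalues a : ℂ)⁻¹ •
      Matrix.vecMul (Matrix.vecMul v (twoPoint (-M))) (twoPoint (-M))), ?_⟩
    refine hρ.majComb_mul hι hK hc hh hP ?_
    rw [← hM, Matrix.smul_vecMul, Matrix.vecMul_vecMul, Matrix.vecMul_vecMul,
      ← hEE', ← mul_assoc, hEE, ← Matrix.vecMul_vecMul, hv, Matrix.smul_vecMul,
      smul_smul, inv_mul_cancel₀, one_smul]
    exact_mod_cast a.2

end Rank


/-! ### Real matrices acting on complex subspaces -/

section RealAction

variable {ι κ : Type} [Fintype ι] [DecidableEq ι] [Fintype κ] [DecidableEq κ]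

/-- The action of a real matrix on complex vectors. -/
noncomputable def realMulVec (X : Matrix ι κ ℝ) (v : κ → ℂ) : ι → ℂ :=
  (X.map Complex.ofReal).mulVec v

theorem realMulVec_apply (X : Matrix ι κ ℝ) (v : κ → ℂ) (i : ι) :
    realMulVec X v i = ∑ j, (X i j : ℂ) * v j := rfl

theorem realMulVec_add (X Y : Matrix ι κ ℝ) (v : κ → ℂ) :
    realMulVec (X + Y) v = realMulVec X v + realMulVec Y v := by
  funext i
  simp [realMulVec_apply, add_mul, Finset.sum_add_distrib]

theorem realMulVec_sub (X Y : Matrix ι κ ℝ) (v : κ → ℂ) :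
    realMulVec (X - Y) v = realMulVec X v - realMulVec Y v := by
  funext i
  simp [realMulVec_apply, sub_mul, Finset.sum_sub_distrib]

theorem realMulVec_neg (X : Matrix ι κ ℝ) (v : κ → ℂ) :
    realMulVec (-X) v = -realMulVec X v := by
  funext i
  simp [realMulVec_apply]

theorem realMulVec_one (v : κ → ℂ) : realMulVec (1 : Matrix κ κ ℝ) v = v := by
  funext i
  simp [realMulVec_apply, Matrix.one_apply, apply_ite Complex.ofReal]

theorem realMulVec_mul {μ : Type} [Fintype μ] (X : Matrix ι κ ℝ) (Y : Matrix κ μ ℝ) (v : μ → ℂ) :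
    realMulVec (X * Y) v = realMulVec X (realMulVec Y v) := by
  rw [realMulVec, realMulVec, realMulVec, Matrix.mulVec_mulVec]
  congr 1
  exact Matrix.map_mul (f := Complex.ofRealHom)

theorem realMulVec_smul (X : Matrix ι κ ℝ) (r : ℂ) (v : κ → ℂ) :
    realMulVec X (r • v) = r • realMulVec X v := Matrix.mulVec_smul _ _ _

theorem realMulVec_neg_right (X : Matrix ι κ ℝ) (v : κ → ℂ) :
    realMulVec X (-v) = -realMulVec X v := Matrix.mulVec_neg _ _

theorem realMulVec_star (X : Matrix ι κ ℝ) (v : κ → ℂ) :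
    realMulVec X (star v) = star (realMulVec X v) := by
  funext i
  simp [realMulVec_apply]

theorem twoPoint_mulVec (M : Matrix ι ι ℝ) (v : ι → ℂ) :
    (twoPoint M).mulVec v = v - Complex.I • realMulVec M v := by
  rw [twoPoint, Matrix.sub_mulVec, Matrix.one_mulVec, Matrix.smul_mulVec, realMulVec]

theorem realMulVec_ofReal (X : Matrix ι κ ℝ) (v : κ → ℝ) :
    realMulVec X (fun i => (v i : ℂ)) = fun i => (X.mulVec v i : ℂ) := by
  funext i
  simp [realMulVec_apply, Matrix.mulVec, dotProduct]

/-- A real matrix is determined by its action on a complex subspace of at least half the dimension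
that contains no vector together with its complex conjugate. -/
theorem eq_zero_of_realMulVec {N : Submodule ℂ (κ → ℂ)}
    (hdim : Fintype.card κ ≤ 2 * Module.finrank ℂ N) (hN : ∀ v ∈ N, star v ∈ N → v = 0)
    {X : Matrix ι κ ℝ} (hX : ∀ v ∈ N, realMulVec X v = 0) : X = 0 := by
  -- Taking real parts is injective on N, since a purely imaginary v has conjugate -v in N. By the
  -- dimension hypothesis it is then onto, and X kills the real part of every vector it kills.
  let φ : N →ₗ[ℝ] (κ → ℝ) :=
    { toFun := fun v i => ((v : κ → ℂ) i).re
      map_add' := fun v w => by funext i; simp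
      map_smul' := fun r v => by funext i; simp }
  have hinj : Function.Injective φ := by
    rw [← LinearMap.ker_eq_bot, LinearMap.ker_eq_bot']
    intro v hv
    refine Subtype.ext (hN v v.2 ?_)
    have : star (v : κ → ℂ) = -v := by
      funext i
      have h0 : ((v : κ → ℂ) i).re = 0 := congrFun hv i
      apply Complex.ext <;> simp [h0]
    rw [this]
    exact N.neg_mem v.2
  have htop : LinearMap.range φ = ⊤ := by
    apply Submodule.eq_top_of_finrank_eq
    refine le_antisymm (Submodule.finrank_le _) ?_
    rw [LinearMap.finrank_range_of_inj hinj, finrank_real_of_complex, Module.finrank_fintype_fun_eq_card]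
    exact hdim
  ext i j
  obtain ⟨v, hv⟩ : Pi.single j 1 ∈ LinearMap.range φ := by rw [htop]; trivial
  have h := congrArg Complex.re (congrFun (hX v v.2) i)
  rw [realMulVec_apply, Complex.re_sum] at h
  have h2 : ∀ k, ((X i k : ℂ) * (v : κ → ℂ) k).re = X i k * (Pi.single j 1 : κ → ℝ) k := by
    intro k
    rw [← hv]
    simp [φ]
  simpa [h2, Pi.single_apply] using h

end RealAction

/-! ### Covariance matrices of extensions of the Choi state -/

section Extension

variable {ι : Type} [Fintype ι] [DecidableEq ι]

/-- The kernel of `1 - A Aᵀ - i B`, which describes the pure modes of the Choi state. -/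
noncomputable def pureSpace (A B : Matrix ι ι ℝ) : Submodule ℂ (ι → ℂ) :=
  LinearMap.ker (twoPoint B - (A * A.transpose).map Complex.ofReal).mulVecLin

theorem mem_pureSpace {A B : Matrix ι ι ℝ} {v : ι → ℂ} :
    v ∈ pureSpace A B ↔ v - realMulVec (A * A.transpose) v = Complex.I • realMulVec B v := by
  rw [pureSpace, LinearMap.mem_ker, Matrix.mulVecLin_apply, Matrix.sub_mulVec, twoPoint_mulVec,
    ← realMulVec, sub_right_comm, sub_eq_zero]

/-- The covariance matrix of an extension of the Choi state. -/
def extensionCov (A A' B B' Y : Matrix ι ι ℝ) : Matrix ((ι ⊕ ι) ⊕ ι) ((ι ⊕ ι) ⊕ ι) ℝ :=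
  Matrix.fromBlocks (Matrix.fromBlocks 0 A'.transpose (-A') B')
    (Matrix.fromRows A.transpose Y.transpose) (Matrix.fromCols (-A) (-Y)) B

theorem extensionCov_mulVec (A A' B B' Y : Matrix ι ι ℝ) (x u v : ι → ℂ) :
    (twoPoint (extensionCov A A' B B' Y)).mulVec (Sum.elim (Sum.elim x u) v) =
      Sum.elim (Sum.elim
        (x - Complex.I • (realMulVec A'.transpose u + realMulVec A.transpose v))
        (u - Complex.I • (-realMulVec A' x + realMulVec B' u + realMulVec Y.transpose v)))
        (v - Complex.I • (-realMulVec A x - realMulVec Y u + realMulVec B v)) := by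
  rw [twoPoint_mulVec]
  funext a
  rcases a with (i | i) | i <;>
    simp [extensionCov, realMulVec_apply, sub_eq_add_neg] <;> ring

/-- The three blocks are the reference, the output S and the recovered output S'. Here J = B + Y:
the kernel vectors show that it acts as -i on `pureSpace`, and identities between real matrices need
only be checked there. The block B' of S remains unconstrained throughout. -/
theorem exists_complexStructure_of_extension {A A' B B' Y : Matrix ι ι ℝ}
    (hB : B.transpose = -B)
    (hdim : Fintype.card ι ≤ 2 * Module.finrank ℂ (pureSpace A B))
    (hE : (twoPoint (extensionCov A A' B B' Y)).PosSemidef)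
    (hker : ∀ v ∈ pureSpace A B, (twoPoint (extensionCov A A' B B' Y)).mulVec
      (Sum.elim (Sum.elim (Complex.I • realMulVec A.transpose v) v) 0) = 0) :
    ∃ J : Matrix ι ι ℝ, J.transpose = -J ∧ J * J = -1 ∧
      A * A.transpose * J = J * (A * A.transpose) ∧ B = (1 - A * A.transpose) * J ∧
      ∀ u : ι → ℝ, 2 * (u ⬝ᵥ (A * A.transpose).mulVec u) ≤ u ⬝ᵥ u := by
  have hI := Complex.I_mul_I
  set H := A * A.transpose with hH
  have hHt : H.transpose = H := by rw [hH, Matrix.transpose_mul, Matrix.transpose_transpose]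
  have hHv : ∀ v, realMulVec H v = realMulVec A (realMulVec A.transpose v) :=
    fun v => realMulVec_mul _ _ _
  -- The S' component of the kernel equation: iYv = Hv.
  have hY : ∀ v ∈ pureSpace A B, Complex.I • realMulVec Y v = realMulVec H v := by
    intro v hv
    have h := hker v hv
    rw [extensionCov_mulVec] at h
    funext i
    have h1 := congrFun h (Sum.inr i)
    have h0 : ∀ X : Matrix ι ι ℝ, realMulVec X (0 : ι → ℂ) = 0 := fun X => Matrix.mulVec_zero _
    simp only [Sum.elim_inr, realMulVec_smul, ← hHv, h0, Pi.sub_apply, Pi.smul_apply, Pi.add_apply,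
      Pi.neg_apply, Pi.zero_apply, smul_eq_mul] at h1 ⊢
    linear_combination h1 - realMulVec H v i * hI
  -- If v and its conjugate are both in the space, adding each relation to its conjugate counterpart
  -- gives Hv = 0 and v = Hv.
  have hN : ∀ v ∈ pureSpace A B, star v ∈ pureSpace A B → v = 0 := by
    intro v hv hv'
    have h1 := hY v hv
    have h2 := hY _ hv'
    have h3 := mem_pureSpace.1 hv
    have h4 := mem_pureSpace.1 hv'
    rw [← hH] at h3 h4
    simp only [realMulVec_star] at h2 h4
    funext i
    have e1 := congrFun h1 i
    have e2 := congrArg star (congrFun h2 i)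
    have e3 := congrFun h3 i
    have e4 := congrArg star (congrFun h4 i)
    simp at e1 e2 e3 e4
    simp only [Pi.zero_apply]
    linear_combination (e3 + e4 - e1 - e2) / 2
  have hext : ∀ X X' : Matrix ι ι ℝ,
      (∀ v ∈ pureSpace A B, realMulVec X v = realMulVec X' v) → X = X' := by
    intro X X' h
    rw [← sub_eq_zero]
    refine eq_zero_of_realMulVec hdim hN fun v hv => ?_
    rw [realMulVec_sub, h v hv, sub_self]
  have hA' : A'.transpose = A.transpose := by
    refine hext _ _ fun v hv => ?_
    have h := hker v hv
    rw [extensionCov_mulVec] at h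
    funext i
    have h1 := congrFun h (Sum.inl (Sum.inl i))
    have h0 : ∀ X : Matrix ι ι ℝ, realMulVec X (0 : ι → ℂ) = 0 := fun X => Matrix.mulVec_zero _
    simp only [Sum.elim_inl, h0, Pi.sub_apply, Pi.smul_apply,
      Pi.zero_apply, smul_eq_mul, add_zero] at h1
    linear_combination Complex.I * h1 -
      (realMulVec A.transpose v i - realMulVec A'.transpose v i) * hI
  replace hA' : A' = A := Matrix.transpose_injective hA'
  subst hA'
  -- Reference and S' also carry the Choi covariances, so the vector z has zero expectation.
  -- Positivity promotes this to a kernel equation, whose S component is Yᵀv = iHv = -Yv.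
  have hYt : Y.transpose = -Y := by
    refine hext _ _ fun v hv => ?_
    have hv' := mem_pureSpace.1 hv
    rw [← hH] at hv'
    set z : (ι ⊕ ι) ⊕ ι → ℂ := Sum.elim (Sum.elim (Complex.I • realMulVec A'.transpose v) 0) v
      with hz
    have h0 : ∀ X : Matrix ι ι ℝ, realMulVec X (0 : ι → ℂ) = 0 := fun X => Matrix.mulVec_zero _
    have hEz := extensionCov_mulVec A' A' B B' Y (Complex.I • realMulVec A'.transpose v) 0 v
    rw [← hz] at hEz
    simp only [h0, realMulVec_smul, ← hHv] at hEz
    have hzero : (twoPoint (extensionCov A' A' B B' Y)).mulVec z = 0 := by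
      rw [← hE.dotProduct_mulVec_zero_iff, hEz, hz]
      simp only [dotProduct, Fintype.sum_sum_type, Pi.star_apply, Sum.elim_inl, Sum.elim_inr,
        Pi.zero_apply, star_zero, zero_mul, Finset.sum_const_zero, add_zero]
      rw [Finset.sum_eq_zero, Finset.sum_eq_zero, add_zero]
      · intro i _
        have := congrFun hv' i
        simp only [Pi.sub_apply, Pi.smul_apply, Pi.add_apply, Pi.neg_apply, smul_eq_mul,
          Pi.zero_apply] at this ⊢
        linear_combination star (v i) * this + star (v i) * realMulVec H v i * hI
      · intro i _
        simp
    rw [hEz] at hzero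
    funext i
    have h1 := congrFun hzero (Sum.inl (Sum.inr i))
    have h2 := congrFun (hY v hv) i
    rw [realMulVec_neg]
    simp only [Sum.elim_inl, Sum.elim_inr, Pi.sub_apply, Pi.smul_apply, Pi.add_apply, Pi.neg_apply,
      smul_eq_mul, Pi.zero_apply] at h1 h2 ⊢
    linear_combination Complex.I * h1 - Complex.I * h2 + (realMulVec Y.transpose v i +
      realMulVec Y v i - Complex.I * realMulVec H v i) * hI
  have hLv : ∀ v ∈ pureSpace A' B, realMulVec (B + Y) v = -Complex.I • v := by
    intro v hv
    have h1 := hY v hv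
    have h2 := mem_pureSpace.1 hv
    funext i
    have e1 := congrFun h1 i
    have e2 := congrFun h2 i
    rw [realMulVec_add]
    simp only [Pi.sub_apply, Pi.smul_apply, Pi.add_apply, smul_eq_mul, ← hH] at e1 e2 ⊢
    linear_combination Complex.I * e2 - Complex.I * e1 +
      (realMulVec B v i + realMulVec Y v i) * hI
  have hLL : (B + Y) * (B + Y) = -1 := by
    refine hext _ _ fun v hv => ?_
    rw [realMulVec_mul, hLv v hv, realMulVec_smul, hLv v hv, realMulVec_neg, realMulVec_one,
      smul_smul]
    simp
  have hHL : H * (B + Y) = Y := by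
    refine hext _ _ fun v hv => ?_
    rw [realMulVec_mul, hLv v hv, realMulVec_smul, ← hY v hv, smul_smul]
    simp
  have hLt : (B + Y).transpose = -(B + Y) := by
    rw [Matrix.transpose_add, hB, hYt, neg_add]
  have hLH : (B + Y) * H = Y := by
    have := congrArg Matrix.transpose hHL
    rw [Matrix.transpose_mul, hLt, hHt, hYt, neg_mul] at this
    exact neg_injective this
  refine ⟨B + Y, hLt, hLL, by rw [hHL, hLH], ?_, ?_⟩
  · rw [sub_mul, hHL]
    simp
  · intro u
    set w : ι → ℂ := fun i => (u i : ℂ) with hw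
    -- The same real vector is used on S and S'; the component on the reference is chosen to make
    -- the reference row vanish. For real u the terms with B, B' and Y are imaginary and disappear
    -- from the real part, leaving twice u·u - 2 u·Hu.
    have h := hE.re_dotProduct_nonneg
      (Sum.elim (Sum.elim ((2 * Complex.I) • realMulVec A'.transpose w) w) w)
    rw [extensionCov_mulVec] at h
    have h1 : ∀ i, ((2 * Complex.I) • realMulVec A'.transpose w -
        Complex.I • (realMulVec A'.transpose w + realMulVec A'.transpose w)) i = 0 := by
      intro i
      simp
      ring
    simp only [dotProduct, Fintype.sum_sum_type, Sum.elim_inl, Sum.elim_inr, h1, mul_zero,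
      Finset.sum_const_zero, zero_add, realMulVec_smul, ← hHv, Pi.star_apply] at h
    rw [hw] at h
    simp only [realMulVec_ofReal] at h
    simp at h
    simp only [dotProduct]
    have h2 : ∀ x, u x * (u x - 2 * H.mulVec u x) = u x * u x - 2 * (u x * H.mulVec u x) :=
      fun x => by ring
    simp only [h2, Finset.sum_sub_distrib, ← Finset.mul_sum] at h
    linarith

end Extension


/-! ### Orthogonal normal forms -/

section NormalForm

variable {n : ℕ}

/-- The covariance matrix of the vacuum. -/
def vacuumCov (n : ℕ) : Matrix (Maj n) (Maj n) ℝ := Matrix.of fun a b =>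
  if a.1 = b.1 then (if a.2 = 0 ∧ b.2 = 1 then 1 else if a.2 = 1 ∧ b.2 = 0 then -1 else 0) else 0

theorem mul_vacuumCov_apply {ι : Type} (X : Matrix ι (Maj n) ℝ) (i : ι) (k : Fin n) (e : Fin 2) :
    (X * vacuumCov n) i (k, e) = if e = 0 then -X i (k, 1) else X i (k, 0) := by
  rw [Matrix.mul_apply, Fintype.sum_prod_type, Finset.sum_eq_single k]
  · fin_cases e <;> simp [vacuumCov]
  · intro b _ hb
    simp [vacuumCov, hb]
  · simp

/-- A row-orthogonal matrix is the product of a diagonal matrix with an orthogonal matrix. -/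
theorem exists_eq_diagonal_mul {ι : Type} [Fintype ι] [DecidableEq ι] {X : Matrix ι ι ℝ}
    {d : ι → ℝ} (hX : X * X.transpose = Matrix.diagonal fun i => d i * d i) :
    ∃ O ∈ Matrix.orthogonalGroup ι ℝ, X = Matrix.diagonal d * O := by
  have hrow : ∀ i j, X i ⬝ᵥ X j = if i = j then d i * d i else 0 := by
    intro i j
    have := congrFun (congrFun hX i) j
    rwa [Matrix.mul_apply, Matrix.diagonal_apply] at this
  -- Only rows with d i ≠ 0 are normalised; the others vanish in X, so an arbitrary orthonormal
  -- completion is harmless.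
  let v : ι → EuclideanSpace ℝ ι := fun i => WithLp.toLp 2 ((d i)⁻¹ • X i)
  have hv : Orthonormal ℝ ({i | d i ≠ 0}.domRestrict v) := by
    rw [orthonormal_iff_ite]
    rintro ⟨i, hi⟩ ⟨j, hj⟩
    replace hi : d i ≠ 0 := hi
    replace hj : d j ≠ 0 := hj
    rw [show inner ℝ ({i | d i ≠ 0}.domRestrict v ⟨i, hi⟩) ({i | d i ≠ 0}.domRestrict v ⟨j, hj⟩) =
      ((d j)⁻¹ • X j) ⬝ᵥ star ((d i)⁻¹ • X i) from rfl]
    simp only [Subtype.mk.injEq]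
    rw [star_trivial, smul_dotProduct, dotProduct_smul, hrow]
    by_cases hij : i = j
    · subst hij
      simp
      field_simp
    · simp [hij, Ne.symm hij]
  obtain ⟨b, hb⟩ := hv.exists_orthonormalBasis_extension_of_card_eq (by simp)
  refine ⟨Matrix.of fun i j => b i j, ?_, ?_⟩
  · rw [Matrix.mem_orthogonalGroup_iff]
    ext i j
    have h := orthonormal_iff_ite.1 b.orthonormal i j
    rw [EuclideanSpace.inner_eq_star_dotProduct, star_trivial, dotProduct_comm] at h
    rw [Matrix.one_apply, ← h]
    rfl
  · ext i j
    rw [Matrix.diagonal_mul, Matrix.of_apply]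
    by_cases hi : d i = 0
    · have h := hrow i i
      rw [if_pos rfl, hi, mul_zero, dotProduct_self_eq_zero] at h
      rw [hi, zero_mul, h]
      rfl
    · rw [hb i hi]
      simp [v, hi]

/-- Simultaneous normal form of a symmetric matrix and a complex structure commuting with it. -/
theorem exists_orthogonal_normalForm {H J : Matrix (Maj n) (Maj n) ℝ} (hH : H.transpose = H)
    (hJt : J.transpose = -J) (hJ : J * J = -1) (hHJ : H * J = J * H) :
    ∃ O ∈ Matrix.orthogonalGroup (Maj n) ℝ, ∃ h : Fin n → ℝ, Antitone h ∧
      H * O = O * Matrix.diagonal (fun i : Maj n => h i.1) ∧ J * O = O * vacuumCov n := by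
  have hI := Complex.I_mul_I
  -- The eigenspace of J for the eigenvalue i. It has dimension n and is preserved by H, so H can be
  -- diagonalised unitarily inside it.
  set N₀ : Submodule ℂ (Maj n → ℂ) := LinearMap.ker (twoPoint (-J)).mulVecLin with hN₀
  have hmem₀ : ∀ v, v ∈ N₀ ↔ realMulVec J v = Complex.I • v := by
    intro v
    rw [hN₀, LinearMap.mem_ker, Matrix.mulVecLin_apply, twoPoint_mulVec, realMulVec_neg]
    constructor
    · intro h
      funext i
      have := congrFun h i
      simp at this ⊢
      linear_combination -Complex.I * this + realMulVec J v i * hI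
    · intro h
      rw [h]
      funext i
      simp
      linear_combination v i * hI
  have hfin₀ : Module.finrank ℂ N₀ = n := by
    have h := finrank_ker_real_eq (-J)
    rw [neg_mul_neg, hJ, add_neg_cancel, Matrix.mulVecLin_zero, LinearMap.ker_zero, finrank_top,
      Module.finrank_fintype_fun_eq_card, ← hN₀] at h
    simp at h
    omega
  let e := (WithLp.linearEquiv 2 ℂ (Maj n → ℂ)).symm
  set N : Submodule ℂ (EuclideanSpace ℂ (Maj n)) := N₀.map e.toLinearMap with hN
  have hmem : ∀ v : EuclideanSpace ℂ (Maj n), v ∈ N ↔ realMulVec J v.ofLp = Complex.I • v.ofLp := by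
    intro v
    rw [← hmem₀, hN, Submodule.mem_map]
    constructor
    · rintro ⟨w, hw, rfl⟩
      exact hw
    · intro hv
      exact ⟨v.ofLp, hv, rfl⟩
  have hfin : Module.finrank ℂ N = n := by
    rw [hN, LinearEquiv.finrank_map_eq, hfin₀]
  set T : EuclideanSpace ℂ (Maj n) →ₗ[ℂ] EuclideanSpace ℂ (Maj n) :=
    Matrix.toEuclideanLin (H.map Complex.ofReal) with hT
  have hTapp : ∀ v, (T v).ofLp = realMulVec H v.ofLp := fun v => rfl
  have hTsymm : T.IsSymmetric := by
    rw [hT, Matrix.isSymmetric_toEuclideanLin_iff]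
    ext i j
    have := congrFun (congrFun hH i) j
    rw [Matrix.transpose_apply] at this
    simp [this]
  have hTN : ∀ v ∈ N, T v ∈ N := by
    intro v hv
    rw [hmem] at hv ⊢
    rw [hTapp, ← realMulVec_mul, ← hHJ, realMulVec_mul, hv, realMulVec_smul]
  have hTs := hTsymm.restrict_invariant hTN
  set b := hTs.eigenvectorBasis hfin
  let v : Fin n → Maj n → ℂ := fun k => ((b k : N) : EuclideanSpace ℂ (Maj n)).ofLp
  have hvJ : ∀ k, realMulVec J (v k) = Complex.I • v k := fun k => (hmem _).1 (b k).2
  have hvH : ∀ k, realMulVec H (v k) = (hTs.eigenvalues hfin k : ℂ) • v k := by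
    intro k
    have h := hTs.apply_eigenvectorBasis hfin k
    exact congrArg (fun x : N => (x : EuclideanSpace ℂ (Maj n)).ofLp) h
  have hvv : ∀ k l, star (v k) ⬝ᵥ v l = if k = l then 1 else 0 := by
    intro k l
    have h := orthonormal_iff_ite.1 b.orthonormal k l
    rw [Submodule.coe_inner, EuclideanSpace.inner_eq_star_dotProduct, dotProduct_comm] at h
    exact h
  -- Eigenvectors of the antisymmetric J with the common eigenvalue i are isotropic for the bilinear
  -- form. With unitarity this makes real and imaginary parts orthogonal.
  have hvv' : ∀ k l, v k ⬝ᵥ v l = 0 := by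
    intro k l
    have h1 : realMulVec J (v k) ⬝ᵥ v l = -(v k ⬝ᵥ realMulVec J (v l)) := by
      have h2 : (J.map Complex.ofReal).transpose = -J.map Complex.ofReal := by
        ext i j
        have := congrFun (congrFun hJt i) j
        simp only [Matrix.transpose_apply, Matrix.neg_apply] at this
        simp [this]
      rw [realMulVec, realMulVec, Matrix.dotProduct_mulVec, ← Matrix.mulVec_transpose, h2,
        Matrix.neg_mulVec, neg_dotProduct, neg_neg]
    rw [hvJ, hvJ, smul_dotProduct, dotProduct_smul, smul_eq_mul] at h1
    have h3 : (2 * Complex.I) * (v k ⬝ᵥ v l) = 0 := by linear_combination h1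
    exact (mul_eq_zero.1 h3).resolve_left (by simp)
  set r := Real.sqrt 2 with hr
  have hr2 : r * r = 2 := Real.mul_self_sqrt (by norm_num)
  -- Real and imaginary parts of a unit isotropic vector each have norm 1/√2, hence the factor √2.
  let O : Matrix (Maj n) (Maj n) ℝ := Matrix.of fun i a =>
    r * if a.2 = 0 then (v a.1 i).re else (v a.1 i).im
  have hOre : ∀ i k, O i (k, 0) = r * (v k i).re := fun i k => by simp [O]
  have hOim : ∀ i k, O i (k, 1) = r * (v k i).im := fun i k => by simp [O]
  have hre : ∀ (X : Matrix (Maj n) (Maj n) ℝ) i k, (X * O) i (k, 0) =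
      r * (realMulVec X (v k) i).re := by
    intro X i k
    rw [realMulVec_apply, Matrix.mul_apply, Complex.re_sum, Finset.mul_sum]
    refine Finset.sum_congr rfl fun j _ => ?_
    rw [hOre, Complex.re_ofReal_mul]
    ring
  have him : ∀ (X : Matrix (Maj n) (Maj n) ℝ) i k, (X * O) i (k, 1) =
      r * (realMulVec X (v k) i).im := by
    intro X i k
    rw [realMulVec_apply, Matrix.mul_apply, Complex.im_sum, Finset.mul_sum]
    refine Finset.sum_congr rfl fun j _ => ?_
    rw [hOim, Complex.im_ofReal_mul]
    ring
  refine ⟨O, ?_, hTs.eigenvalues hfin, hTs.eigenvalues_antitone hfin, ?_, ?_⟩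
  · rw [Matrix.mem_orthogonalGroup_iff']
    ext ⟨k, a⟩ ⟨l, b⟩
    rw [Matrix.mul_apply]
    simp only [Matrix.transpose_apply]
    have h1 := hvv k l
    have h2 := hvv' k l
    simp only [dotProduct, Pi.star_apply] at h1 h2
    have e1 := congrArg Complex.re h1
    have e2 := congrArg Complex.im h1
    have e3 := congrArg Complex.re h2
    have e4 := congrArg Complex.im h2
    simp only [Complex.re_sum, Complex.im_sum, Complex.mul_re, Complex.mul_im, Complex.star_def,
      Complex.conj_re, Complex.conj_im, Finset.sum_sub_distrib, Finset.sum_add_distrib,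
      neg_mul, sub_neg_eq_add, Finset.sum_neg_distrib, Complex.zero_re, Complex.zero_im] at e1 e2 e3 e4
    have hs : ∀ f g : Maj n → ℝ, ∑ j, r * f j * (r * g j) = 2 * ∑ j, f j * g j := by
      intro f g
      rw [Finset.mul_sum]
      refine Finset.sum_congr rfl fun j _ => ?_
      linear_combination f j * g j * hr2
    rw [Matrix.one_apply]
    fin_cases a <;> fin_cases b <;>
      simp only [Fin.zero_eta, Fin.mk_one, hOre, hOim, hs, Prod.mk.injEq, and_true, and_false,
        if_false, Fin.isValue, one_ne_zero, zero_ne_one]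
    · split_ifs at e1 ⊢ <;> simp at e1 <;> linarith
    · split_ifs at e2 <;> simp at e2 <;> linarith
    · split_ifs at e2 <;> simp at e2 <;> linarith
    · split_ifs at e1 ⊢ <;> simp at e1 <;> linarith
  · ext i ⟨k, a⟩
    rw [Matrix.mul_diagonal]
    fin_cases a
    · simp only [Fin.zero_eta, hre, hOre, hvH, Pi.smul_apply, smul_eq_mul, Complex.re_ofReal_mul]
      ring
    · simp only [Fin.mk_one, him, hOim, hvH, Pi.smul_apply, smul_eq_mul, Complex.im_ofReal_mul]
      ring
  · ext i ⟨k, a⟩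
    rw [mul_vacuumCov_apply]
    fin_cases a
    · simp [hre, hOim, hvJ]
    · simp [him, hOre, hvJ]

end NormalForm


/-! ### Partial traces and ampliations -/

section PartialTrace

variable {K : Type} [Fintype K] [DecidableEq K] {n m : ℕ}

/-- The partial trace over the first party, weighted with an operator. -/
def weightedTrace {K' : Type} (X : Matrix (K × K') (K × K') ℂ) (z : Matrix K K ℂ) :
    Matrix K' K' ℂ :=
  ∑ p, ∑ q, z q p • Matrix.of fun x y => X (p, x) (q, y)

theorem trace_weightedTrace_mul {K' : Type} [Fintype K'] [DecidableEq K']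
    (X : Matrix (K × K') (K × K') ℂ) (z : Matrix K K ℂ)
    (w : Matrix K' K' ℂ) : (X * (z ⊗ₖ w)).trace = (weightedTrace X z * w).trace := by
  simp only [weightedTrace, Matrix.trace, Matrix.diag_apply, Matrix.mul_apply,
    Fintype.sum_prod_type, Matrix.kroneckerMap_apply, Matrix.sum_apply, Matrix.smul_apply,
    Matrix.of_apply, smul_eq_mul, Finset.sum_mul]
  rw [Finset.sum_comm]
  refine Finset.sum_congr rfl fun x _ => ?_
  conv_lhs => rw [Finset.sum_comm]
  conv_rhs => rw [Finset.sum_comm]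
  refine Finset.sum_congr rfl fun q _ => Finset.sum_congr rfl fun p _ =>
    Finset.sum_congr rfl fun y _ => ?_
  ring

theorem trace_ampliation_mul (T : Op n →ₗ[ℂ] Op m)
    (X : Matrix (K × Fock n) (K × Fock n) ℂ) (z : Matrix K K ℂ) (b : Op m) :
    (ampliation K T X * (z ⊗ₖ b)).trace = (T (weightedTrace X z) * b).trace := by
  rw [trace_weightedTrace_mul]
  congr 2
  simp only [weightedTrace, map_sum, map_smul]
  rfl

/-- An operator on the untouched factor only forms linear combinations of the blocks to which T is
applied. Thus an annihilator there remains an annihilator of the output. -/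
theorem ampliation_mul_left (T : Op n →ₗ[ℂ] Op m)
    (X : Matrix (K × Fock n) (K × Fock n) ℂ) (a : Matrix K K ℂ) :
    ampliation K T ((a ⊗ₖ (1 : Op n)) * X) = (a ⊗ₖ (1 : Op m)) * ampliation K T X := by
  ext ⟨p, x⟩ ⟨q, y⟩
  have h : (Matrix.of fun x y => ((a ⊗ₖ (1 : Op n)) * X) (p, x) (q, y) : Op n) =
      ∑ r, a p r • Matrix.of fun x y => X (r, x) (q, y) := by
    ext x y
    simp [Matrix.mul_apply, Fintype.sum_prod_type, Matrix.kroneckerMap_apply, Matrix.one_apply,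
      Matrix.sum_apply]
  simp only [ampliation, Matrix.of_apply]
  rw [h, map_sum]
  simp only [map_smul, Matrix.sum_apply, Matrix.smul_apply]
  simp [Matrix.mul_apply, Fintype.sum_prod_type, Matrix.kroneckerMap_apply, Matrix.one_apply]

theorem IsCompletelyPositive.ampliation_posSemidef {T : Op n →ₗ[ℂ] Op m}
    (hT : IsCompletelyPositive T) {X : Matrix (K × Fock n) (K × Fock n) ℂ} (hX : X.PosSemidef) :
    (ampliation K T X).PosSemidef := by
  let e := Fintype.equivFin K
  have h := hT (Fintype.card K) (X.submatrix (Prod.map e.symm id) (Prod.map e.symm id))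
    (hX.submatrix _)
  have h2 := h.submatrix (Prod.map e id)
  convert h2 using 1
  ext ⟨p, x⟩ ⟨q, y⟩
  simp [ampliation]

end PartialTrace

section States

variable {K ι : Type} [Fintype K] [DecidableEq K] [Fintype ι] [DecidableEq ι]
  {c : ι → Matrix K K ℂ}

theorem trace_mul_majComb (hc : IsCAR c) (hh : ∀ i, (c i).conjTranspose = c i) {ρ : Matrix K K ℂ}
    (hρ : IsState ρ) (a : ι) (v : ι → ℂ) :
    (ρ * (c a * majComb c v)).trace = (twoPoint (covMatrix c ρ)).mulVec v a := by
  simp only [majComb, Finset.mul_sum, mul_smul_comm, Matrix.trace_sum, Matrix.trace_smul,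
    trace_mul_mul_eq_twoPoint hc hh hρ, Matrix.mulVec, dotProduct, smul_eq_mul, mul_comm]

theorem trace_conjTranspose_mul_majComb (hc : IsCAR c) (hh : ∀ i, (c i).conjTranspose = c i)
    {ρ : Matrix K K ℂ} (hρ : IsState ρ) (v : ι → ℂ) :
    (ρ * ((majComb c v).conjTranspose * majComb c v)).trace =
      star v ⬝ᵥ (twoPoint (covMatrix c ρ)).mulVec v := by
  have h : (majComb c v).conjTranspose * majComb c v = ∑ a, star (v a) • (c a * majComb c v) := by
    rw [majComb_conjTranspose hh]
    conv_lhs => rw [majComb, Finset.sum_mul]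
    simp
  rw [h]
  simp only [Finset.mul_sum, mul_smul_comm, Matrix.trace_sum, Matrix.trace_smul,
    trace_mul_majComb hc hh hρ, dotProduct, smul_eq_mul, Pi.star_apply]

theorem covMatrix_transpose (c : ι → Matrix K K ℂ) (ρ : Matrix K K ℂ) :
    (covMatrix c ρ).transpose = -covMatrix c ρ := by
  ext a b
  simp only [Matrix.transpose_apply, Matrix.neg_apply, covMatrix, Matrix.of_apply, mul_sub,
    Matrix.trace_sub, Complex.sub_re]
  ring

/-- Its quadratic form at v is the expectation of the positive operator c(v)†c(v). -/
theorem twoPoint_covMatrix_posSemidef (hc : IsCAR c) (hh : ∀ i, (c i).conjTranspose = c i)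
    {ρ : Matrix K K ℂ} (hρ : IsState ρ) : (twoPoint (covMatrix c ρ)).PosSemidef := by
  refine Matrix.PosSemidef.of_dotProduct_mulVec_nonneg ?_ fun v => ?_
  · ext a b
    have h := congrFun (congrFun (covMatrix_transpose c ρ) a) b
    rw [Matrix.transpose_apply, Matrix.neg_apply] at h
    rw [Matrix.conjTranspose_apply, twoPoint_apply, twoPoint_apply, h]
    simp [eq_comm, apply_ite (starRingEnd ℂ), sub_eq_add_neg]
  · rw [← trace_conjTranspose_mul_majComb hc hh hρ, ← mul_assoc, Matrix.trace_mul_comm, ← mul_assoc]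
    exact (hρ.1.mul_mul_conjTranspose_same _).trace_nonneg

theorem covMatrix_apply_eq_of_trace_eq (hc : IsCAR c) (hh : ∀ i, (c i).conjTranspose = c i)
    {ρ : Matrix K K ℂ} (hρ : IsState ρ) {κ L : Type} [Fintype L] [DecidableEq L] [Fintype κ]
    [DecidableEq κ] {d : κ → Matrix L L ℂ} (hd : IsCAR d) (hdh : ∀ i, (d i).conjTranspose = d i)
    {σ : Matrix L L ℂ} (hσ : IsState σ) {a b : ι} {a' b' : κ} (hab : a = b ↔ a' = b')
    (h : (ρ * (c a * c b)).trace = (σ * (d a' * d b')).trace) :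
    covMatrix c ρ a b = covMatrix d σ a' b' := by
  rw [trace_mul_mul_eq_twoPoint hc hh hρ, trace_mul_mul_eq_twoPoint hd hdh hσ, twoPoint_apply,
    twoPoint_apply] at h
  simp only [hab] at h
  have h3 : Complex.I * (covMatrix c ρ a b : ℂ) = Complex.I * (covMatrix d σ a' b' : ℂ) := by
    linear_combination -h
  exact_mod_cast mul_left_cancel₀ Complex.I_ne_zero h3

end States

/-! ### The Choi state of a Gaussian channel -/

section ChoiState

variable {n : ℕ} {A B : Matrix (Maj n) (Maj n) ℝ} {T : Op n →ₗ[ℂ] Op n}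

/-- The Choi state of a channel, for the Gaussian maximally entangled state. -/
noncomputable def choiState (T : Op n →ₗ[ℂ] Op n) : Matrix (Fock n × Fock n) (Fock n × Fock n) ℂ :=
  ampliation (Fock n) T (pureState (maxEntangled n))

theorem diagonal_majSign_mul_self :
    Matrix.diagonal (majSign (n := n)) * Matrix.diagonal majSign = 1 := by
  rw [Matrix.diagonal_mul_diagonal, ← Matrix.diagonal_one]
  congr 1
  funext i
  simp only [majSign]
  split_ifs <;> simp

theorem IsFGC.isGaussianState_choiState (hT : IsFGC A B T) :
    IsGaussianState pairMajorana (choiState T) :=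
  (hT.2 n _ isGaussianState_maxEntangled).1

/-- The signs `majSign` come from transposing Majorana operators. They square to 1, so A and A *
diagonal majSign have the same product with their transposes. -/
theorem IsFGC.covMatrix_choiState (hT : IsFGC A B T) :
    covMatrix pairMajorana (choiState T) =
      Matrix.fromBlocks 0 (A * Matrix.diagonal majSign).transpose
        (-(A * Matrix.diagonal majSign)) B := by
  rw [choiState, (hT.2 n _ isGaussianState_maxEntangled).2, covMatrix_maxEntangled, maxEntangledCov,
    Matrix.fromBlocks_transpose, Matrix.fromBlocks_multiply, Matrix.fromBlocks_multiply,
    Matrix.fromBlocks_add]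
  simp [-Matrix.diagonal_neg]

theorem IsFGC.transpose_noise (hT : IsFGC A B T) : B.transpose = -B := by
  have h := covMatrix_transpose pairMajorana (choiState T)
  rw [hT.covMatrix_choiState, Matrix.fromBlocks_transpose, Matrix.fromBlocks_neg,
    Matrix.fromBlocks_inj] at h
  exact h.2.2.2

theorem maxEntangled_apply (r x : Fock n) : maxEntangled n (r, x) =
    if x = r then (Real.sqrt (2 ^ n) : ℂ)⁻¹ * parityPhase n r r else 0 := by
  rw [maxEntangled, Pi.smul_apply, Matrix.vec, smul_eq_mul]
  split_ifs with h
  · rw [h]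
  · simp [parityPhase, parity, h]

/-- The maximally entangled vector has diagonal coefficients, so the Choi state is the Choi matrix
multiplied by diagonal matrices on both sides. -/
theorem rank_choiState_le (T : Op n →ₗ[ℂ] Op n) : (choiState T).rank ≤ choiRank T := by
  set f : Fock n → ℂ := fun r => (Real.sqrt (2 ^ n) : ℂ)⁻¹ * parityPhase n r r
  have h : choiState T = Matrix.diagonal (fun p : Fock n × Fock n => f p.1) * choiMatrix T *
      Matrix.diagonal (fun p : Fock n × Fock n => star (f p.1)) := by
    ext ⟨r, s⟩ ⟨r', s'⟩
    rw [Matrix.mul_diagonal, Matrix.diagonal_mul]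
    have h1 : (Matrix.of fun x y => pureState (maxEntangled n) (r, x) (r', y) : Op n) =
        (f r * star (f r')) • Matrix.single r r' 1 := by
      ext x y
      simp only [pureState, Matrix.vecMulVec_apply, Pi.star_apply, maxEntangled_apply,
        Matrix.of_apply, Matrix.smul_apply, Matrix.single_apply, f,
        eq_comm (a := r) (b := x), eq_comm (a := r') (b := y)]
      by_cases hx : x = r <;> by_cases hy : y = r' <;> simp [hx, hy]
    simp only [choiState, ampliation, choiMatrix, Matrix.of_apply]
    rw [h1, map_smul, Matrix.smul_apply, smul_eq_mul]
    ring
  rw [h, choiRank]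
  exact (Matrix.rank_mul_le_left _ _).trans (Matrix.rank_mul_le_right _ _)

/-- A fermionic Gaussian channel of small Choi rank has many pure modes. -/
theorem IsFGC.card_le_finrank_pureSpace (hT : IsFGC A B T) {n' : ℕ} (hn' : n' ≤ n)
    (hrank : choiRank T = 2 ^ n') : Fintype.card (Maj n) ≤
      2 * Module.finrank ℂ (pureSpace (A * Matrix.diagonal majSign) B) := by
  have hr : (choiState T).rank ≤ 2 ^ n' := hrank ▸ rank_choiState_le T
  have h := hT.isGaussianState_choiState.card_le ⟨n + n, by simp; ring⟩
    (by simp [pow_add, pow_mul, mul_pow]) isCAR_pairMajorana pairMajorana_conjTranspose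
    isGrading_pairMajorana hr
  rw [hT.covMatrix_choiState] at h
  set A₁ := A * Matrix.diagonal majSign
  set M := Matrix.fromBlocks 0 A₁.transpose (-A₁) B
  -- The reference row determines the first component of a kernel vector from the second;
  -- substituting it in the other row gives the equation of `pureSpace`.
  have hk : ∀ v : Maj n ⊕ Maj n → ℂ, (twoPoint M).mulVec v = 0 →
      (v ∘ Sum.inl = Complex.I • realMulVec A₁.transpose (v ∘ Sum.inr)) ∧
      v ∘ Sum.inr ∈ pureSpace A₁ B := by
    intro v hv
    rw [twoPoint_mulVec] at hv
    have h1 : v ∘ Sum.inl = Complex.I • realMulVec A₁.transpose (v ∘ Sum.inr) := by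
      funext i
      have := congrFun hv (Sum.inl i)
      simp [realMulVec_apply, M] at this ⊢
      linear_combination this
    refine ⟨h1, mem_pureSpace.2 ?_⟩
    rw [realMulVec_mul]
    funext i
    have h2 := congrFun hv (Sum.inr i)
    have h3 : realMulVec M v (Sum.inr i) = -realMulVec A₁ (v ∘ Sum.inl) i +
        realMulVec B (v ∘ Sum.inr) i := by
      simp [realMulVec_apply, M]
    rw [h1, realMulVec_smul] at h3
    simp only [Pi.sub_apply, Pi.smul_apply, smul_eq_mul, h3, Pi.zero_apply, Function.comp_apply] at h2 ⊢
    have hI := Complex.I_mul_I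
    linear_combination h2 - realMulVec A₁ (realMulVec A₁.transpose (v ∘ Sum.inr)) i * hI
  let φ : LinearMap.ker (twoPoint M).mulVecLin →ₗ[ℂ] pureSpace A₁ B :=
    { toFun := fun v => ⟨(v : Maj n ⊕ Maj n → ℂ) ∘ Sum.inr, (hk v v.2).2⟩
      map_add' := fun v w => rfl
      map_smul' := fun r v => rfl }
  have hφ : Function.Injective φ := by
    intro v w hvw
    have h2 : (v : Maj n ⊕ Maj n → ℂ) ∘ Sum.inr = (w : Maj n ⊕ Maj n → ℂ) ∘ Sum.inr :=
      congrArg Subtype.val hvw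
    refine Subtype.ext (funext fun a => ?_)
    rcases a with i | i
    · have e1 := congrFun (hk v v.2).1 i
      have e2 := congrFun (hk w w.2).1 i
      rw [h2] at e1
      exact e1.trans e2.symm
    · exact congrFun h2 i
  have h2 := LinearMap.finrank_le_finrank_of_injective hφ
  simp at h ⊢
  omega

end ChoiState


/-! ### Dilations with a purifying reference -/

theorem prod_map_kronecker_one {K K' ι : Type} [Fintype K] [DecidableEq K] [Fintype K']
    [DecidableEq K'] (c : ι → Matrix K K ℂ) (l : List ι) :
    (l.map fun i => c i ⊗ₖ (1 : Matrix K' K' ℂ)).prod = (l.map c).prod ⊗ₖ (1 : Matrix K' K' ℂ) := by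
  induction l with
  | nil => simp
  | cons a l ih => simp [ih, ← Matrix.mul_kronecker_mul]

theorem prod_map_kronecker {K K' ι : Type} [Fintype K] [DecidableEq K] [Fintype K']
    [DecidableEq K'] (P : Matrix K K ℂ) (d : ι → Matrix K' K' ℂ) (l : List ι) :
    (l.map fun i => P ⊗ₖ d i).prod = (P ^ l.length) ⊗ₖ (l.map d).prod := by
  induction l with
  | nil => simp
  | cons a l ih => simp [ih, ← Matrix.mul_kronecker_mul, pow_succ']

/-- The embedding `X ↦ X ⊗ 1`. -/
def kroneckerOne (K K' : Type) [DecidableEq K'] : Matrix K K ℂ →ₗ[ℂ] Matrix (K × K') (K × K') ℂ where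
  toFun X := X ⊗ₖ 1
  map_add' X Y := Matrix.add_kronecker X Y 1
  map_smul' r X := Matrix.smul_kronecker r X 1

section Dilation

variable {n k : ℕ}

/-- The joint state of system and environment after the interaction. -/
def dilate (U : Matrix (Fock n × Fock k) (Fock n × Fock k) ℂ) (ψ : Fock k → ℂ) (ρ : Op n) :
    Matrix (Fock n × Fock k) (Fock n × Fock k) ℂ :=
  U * (ρ ⊗ₖ Matrix.vecMulVec ψ (star ψ)) * U.conjTranspose

/-- The joint vector of reference, system and environment after the interaction. -/
noncomputable def dilatedVector (U : Matrix (Fock n × Fock k) (Fock n × Fock k) ℂ)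
    (ψ : Fock k → ℂ) (r : Fock n) : Fock n × Fock k → ℂ :=
  U.mulVec fun p => maxEntangled n (r, p.1) * ψ p.2

/-- The joint state of reference, system and environment after the interaction. -/
noncomputable def dilatedState (U : Matrix (Fock n × Fock k) (Fock n × Fock k) ℂ)
    (ψ : Fock k → ℂ) : Matrix ((Fock n × Fock n) × Fock k) ((Fock n × Fock n) × Fock k) ℂ :=
  pureState fun p => dilatedVector U ψ p.1.1 (p.1.2, p.2)

variable (U : Matrix (Fock n × Fock k) (Fock n × Fock k) ℂ) (ψ : Fock k → ℂ)

theorem dilate_vecMulVec (a b : Fock n → ℂ) :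
    dilate U ψ (Matrix.vecMulVec a (star b)) =
      Matrix.vecMulVec (U.mulVec fun p => a p.1 * ψ p.2)
        (star (U.mulVec fun p => b p.1 * ψ p.2)) := by
  have h : Matrix.vecMulVec a (star b) ⊗ₖ Matrix.vecMulVec ψ (star ψ) =
      Matrix.vecMulVec (fun p : Fock n × Fock k => a p.1 * ψ p.2)
        (star fun p : Fock n × Fock k => b p.1 * ψ p.2) := by
    ext p q
    simp [Matrix.kroneckerMap_apply, Matrix.vecMulVec_apply]
    ring
  rw [dilate, h, Matrix.mul_vecMulVec, Matrix.vecMulVec_mul, Matrix.vecMul_conjTranspose, star_star]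

/-- Turns statements about the dilation of arbitrary inputs into expectations in a single pure state
of reference, system and environment. -/
theorem trace_dilate_weightedTrace (y Z : Op n) (w : Op k) :
    (dilate U ψ (weightedTrace (pureState (maxEntangled n)) y) * (Z ⊗ₖ w)).trace =
      (dilatedState U ψ * ((y ⊗ₖ Z) ⊗ₖ w)).trace := by
  have h : dilate U ψ (weightedTrace (pureState (maxEntangled n)) y) =
      ∑ p, ∑ q, y q p • Matrix.vecMulVec (dilatedVector U ψ p) (star (dilatedVector U ψ q)) := by
    have h1 : weightedTrace (pureState (maxEntangled n)) y =
        ∑ p, ∑ q, y q p • Matrix.vecMulVec (fun x => maxEntangled n (p, x))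
          (star fun x => maxEntangled n (q, x)) := rfl
    have h2 : ∀ f : Fock n → Op n, dilate U ψ (∑ p, f p) = ∑ p, dilate U ψ (f p) := by
      intro f
      simp only [dilate]
      rw [← Finset.sum_mul, ← Finset.mul_sum]
      congr 2
      ext p q
      simp [Matrix.kroneckerMap_apply, Matrix.sum_apply, Finset.sum_mul]
    have h3 : ∀ (r : ℂ) (X : Op n), dilate U ψ (r • X) = r • dilate U ψ X := by
      intro r X
      simp [dilate, Matrix.smul_kronecker]
    simp only [h1, h2, h3, dilate_vecMulVec]
    rfl
  rw [h]
  simp only [Finset.sum_mul, Matrix.trace_sum, smul_mul_assoc, Matrix.trace_smul]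
  simp only [dilatedState, pureState, Matrix.trace, Matrix.diag_apply, Matrix.mul_apply,
    Matrix.vecMulVec_apply, Matrix.kroneckerMap_apply, Fintype.sum_prod_type, Pi.star_apply,
    smul_eq_mul, Finset.mul_sum]
  refine Finset.sum_congr rfl fun p _ => ?_
  conv_lhs => rw [Finset.sum_comm]
  refine Finset.sum_congr rfl fun s _ => ?_
  conv_lhs => rw [Finset.sum_comm]
  refine Finset.sum_congr rfl fun e _ => Finset.sum_congr rfl fun q _ =>
    Finset.sum_congr rfl fun s' _ => Finset.sum_congr rfl fun e' _ => ?_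
  ring

/-- The entangled vector is supported on equal occupations and so is even; ψ has definite parity and
U preserves or flips it. The product of the two signs is the total parity. -/
theorem dilatedVector_parity {ψ : Fock k → ℂ}
    (hψ : (parity k).mulVec ψ = ψ ∨ (parity k).mulVec ψ = -ψ)
    (hU : U * (parity n ⊗ₖ parity k) = (parity n ⊗ₖ parity k) * U ∨
      U * (parity n ⊗ₖ parity k) = -((parity n ⊗ₖ parity k) * U)) :
    ∃ s : ℂ, s * star s = 1 ∧ ((parity n ⊗ₖ parity n) ⊗ₖ parity k).mulVec
      (fun p : (Fock n × Fock n) × Fock k => dilatedVector U ψ p.1.1 (p.1.2, p.2)) =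
      s • fun p => dilatedVector U ψ p.1.1 (p.1.2, p.2) := by
  obtain ⟨s₁, hs₁, h₁⟩ : ∃ s : ℂ, (s = 1 ∨ s = -1) ∧ (parity k).mulVec ψ = s • ψ := by
    rcases hψ with h | h
    · exact ⟨1, Or.inl rfl, by simp [h]⟩
    · exact ⟨-1, Or.inr rfl, by simp [h]⟩
  obtain ⟨s₂, hs₂, h₂⟩ : ∃ s : ℂ, (s = 1 ∨ s = -1) ∧
      (parity n ⊗ₖ parity k) * U = s • (U * (parity n ⊗ₖ parity k)) := by
    rcases hU with h | h
    · exact ⟨1, Or.inl rfl, by simp [h]⟩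
    · exact ⟨-1, Or.inr rfl, by simp [h]⟩
  have hd : ∀ (m : ℕ) (f : Fock m → ℂ) (x : Fock m), (parity m).mulVec f x = paritySign x * f x := by
    intro m f x
    rw [parity, Matrix.mulVec_diagonal]
    rfl
  have hd2 : ∀ (f : Fock n × Fock k → ℂ) x e, (parity n ⊗ₖ parity k).mulVec f (x, e) =
      paritySign x * paritySign e * f (x, e) := by
    intro f x e
    rw [parity, parity, Matrix.diagonal_kronecker_diagonal, Matrix.mulVec_diagonal]
    rfl
  have hd3 : ∀ (f : (Fock n × Fock n) × Fock k → ℂ) r x e,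
      ((parity n ⊗ₖ parity n) ⊗ₖ parity k).mulVec f ((r, x), e) =
      paritySign r * (paritySign x * paritySign e * f ((r, x), e)) := by
    intro f r x e
    rw [parity, parity, Matrix.diagonal_kronecker_diagonal, Matrix.diagonal_kronecker_diagonal,
      Matrix.mulVec_diagonal, ← mul_assoc, ← mul_assoc]
    rfl
  refine ⟨s₂ * s₁, ?_, ?_⟩
  · rcases hs₁ with rfl | rfl <;> rcases hs₂ with rfl | rfl <;> simp
  · funext ⟨⟨r, x⟩, e⟩
    rw [hd3]
    simp only [Pi.smul_apply, smul_eq_mul]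
    rw [← hd2 (dilatedVector U ψ r), dilatedVector, Matrix.mulVec_mulVec, h₂, Matrix.smul_mulVec,
      ← Matrix.mulVec_mulVec]
    have h3 : ((parity n ⊗ₖ parity k).mulVec fun p => maxEntangled n (r, p.1) * ψ p.2) =
        (paritySign r * s₁) • fun p => maxEntangled n (r, p.1) * ψ p.2 := by
      funext ⟨x, e⟩
      have := congrFun h₁ e
      rw [hd] at this
      rw [hd2, maxEntangled_apply]
      simp only [Pi.smul_apply, smul_eq_mul, maxEntangled_apply] at this ⊢
      split_ifs with hx
      · rw [hx]
        linear_combination paritySign r * ((Real.sqrt (2 ^ n) : ℂ)⁻¹ * parityPhase n r r) * this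
      · simp
    rw [h3, Matrix.mulVec_smul]
    simp only [Pi.smul_apply, smul_eq_mul]
    linear_combination s₂ * s₁ * (U.mulVec fun p => maxEntangled n (r, p.1) * ψ p.2) (x, e) *
      paritySign_sq r

theorem dilatedState_parity {ψ : Fock k → ℂ}
    (hψ : (parity k).mulVec ψ = ψ ∨ (parity k).mulVec ψ = -ψ)
    (hU : U * (parity n ⊗ₖ parity k) = (parity n ⊗ₖ parity k) * U ∨
      U * (parity n ⊗ₖ parity k) = -((parity n ⊗ₖ parity k) * U)) :
    ((parity n ⊗ₖ parity n) ⊗ₖ parity k) * dilatedState U ψ *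
      ((parity n ⊗ₖ parity n) ⊗ₖ parity k) = dilatedState U ψ := by
  obtain ⟨s, hs, h⟩ := dilatedVector_parity U hψ hU
  have hP : ((parity n ⊗ₖ parity n) ⊗ₖ parity k).conjTranspose =
      (parity n ⊗ₖ parity n) ⊗ₖ parity k := by
    simp only [Matrix.conjTranspose_kronecker, parity_conjTranspose]
  nth_rw 2 [← hP]
  rw [dilatedState, pureState, Matrix.mul_vecMulVec, Matrix.vecMulVec_mul,
    Matrix.vecMul_conjTranspose, star_star, h, star_smul, Matrix.smul_vecMulVec,
    Matrix.vecMulVec_smul, smul_smul, hs, one_smul]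

end Dilation

/-! ### From antidegradability to the covariance condition -/

section Forward

variable {n k : ℕ} {A B : Matrix (Maj n) (Maj n) ℝ} {T : Op n →ₗ[ℂ] Op n}
  {Tc : Op n →ₗ[ℂ] Op k} {U : Matrix (Fock n × Fock k) (Fock n × Fock k) ℂ} {ψ : Fock k → ℂ}

/-- The reduction to the system is the partial trace. -/
theorem trace_mul_eq_of_isReduction {σ : Op n} {ρ : Matrix (Fock n × Fock k) (Fock n × Fock k) ℂ}
    (h : IsReduction majorana (fun i => pairMajorana (Sum.inl i)) σ ρ) (Z : Op n) :
    (σ * Z).trace = (ρ * (Z ⊗ₖ (1 : Op k))).trace := by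
  have key := (isCAR_majorana (n := n)).linearMap_ext (by simp) (by simp [pow_mul])
    (f := Matrix.traceLinearMap (Fock n) ℂ ℂ ∘ₗ LinearMap.mulLeft ℂ σ)
    (g := Matrix.traceLinearMap _ ℂ ℂ ∘ₗ LinearMap.mulLeft ℂ ρ ∘ₗ
      kroneckerOne (Fock n) (Fock k)) ?_
  · exact LinearMap.congr_fun key Z
  · intro l _
    have h2 := h l
    have h3 : (fun i => pairMajorana (r := n) (n := k) (Sum.inl i)) =
        fun i => majorana i ⊗ₖ (1 : Op k) := rfl
    rw [h3, prod_map_kronecker_one] at h2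
    exact h2

/-- The dilated state purifies the Choi state, the environment being the purifying system. An
operator of zero variance in the Choi state therefore annihilates the dilated vector. -/
theorem trace_choiState_mul (hred : ∀ ρ, IsReduction majorana (fun i => pairMajorana (Sum.inl i))
    (T ρ) (dilate U ψ ρ)) (z : Matrix (Fock n × Fock n) (Fock n × Fock n) ℂ) :
    (choiState T * z).trace = (dilatedState U ψ * (z ⊗ₖ (1 : Op k))).trace := by
  have key := (isCAR_pairMajorana (r := n) (n := n)).linearMap_ext ⟨n + n, by simp; ring⟩
    (by simp [pow_add, pow_mul, mul_pow])
    (f := Matrix.traceLinearMap _ ℂ ℂ ∘ₗ LinearMap.mulLeft ℂ (choiState T))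
    (g := Matrix.traceLinearMap _ ℂ ℂ ∘ₗ LinearMap.mulLeft ℂ (dilatedState U ψ) ∘ₗ
      kroneckerOne (Fock n × Fock n) (Fock k)) ?_
  · exact LinearMap.congr_fun key z
  · intro l _
    rw [pairMajorana_eq, prod_map_joinMajorana]
    have : ∀ y Z : Op n, (choiState T * (y ⊗ₖ Z)).trace =
        (dilatedState U ψ * ((y ⊗ₖ Z) ⊗ₖ (1 : Op k))).trace := by
      intro y Z
      rw [choiState, trace_ampliation_mul, trace_mul_eq_of_isReduction (hred _),
        trace_dilate_weightedTrace]
    exact this _ _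

theorem parity_pow_eq {m l : ℕ} (h : Even (m + l)) : parity n ^ m = parity n ^ l := by
  have hsq : ∀ j, parity n ^ (2 * j) = 1 := by
    intro j
    rw [pow_mul, sq, parity_mul_self, one_pow]
  rcases le_total m l with hml | hml
  · obtain ⟨d, rfl⟩ := Nat.exists_eq_add_of_le hml
    obtain ⟨e, rfl⟩ : Even d := by
      rw [Nat.even_iff] at h ⊢; omega
    rw [pow_add, ← two_mul, hsq, mul_one]
  · obtain ⟨d, rfl⟩ := Nat.exists_eq_add_of_le hml
    obtain ⟨e, rfl⟩ : Even d := by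
      rw [Nat.even_iff] at h ⊢; omega
    rw [pow_add, ← two_mul, hsq, mul_one]

/-- The output of the complementary channel, in terms of the joint state. -/
theorem complementary_weightedTrace
    (hψ : (parity k).mulVec ψ = ψ ∨ (parity k).mulVec ψ = -ψ)
    (hU : U * (parity n ⊗ₖ parity k) = (parity n ⊗ₖ parity k) * U ∨
      U * (parity n ⊗ₖ parity k) = -((parity n ⊗ₖ parity k) * U))
    (hred : ∀ ρ, IsReduction majorana (fun j => pairMajorana (Sum.inr j)) (Tc ρ) (dilate U ψ ρ))
    {y : Op n} {ε : ℕ} (hy : parity n * y * parity n = (-1 : ℂ) ^ ε • y) :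
    Tc (weightedTrace (pureState (maxEntangled n)) y) =
      weightedTrace (dilatedState U ψ) (y ⊗ₖ (parity n ^ ε)) := by
  refine ext_of_trace_majorana fun l _ => ?_
  have h := hred (weightedTrace (pureState (maxEntangled n)) y) l
  have h3 : (fun j => pairMajorana (r := n) (n := k) (Sum.inr j)) =
      fun j => parity n ⊗ₖ majorana j := rfl
  rw [h3, prod_map_kronecker, trace_dilate_weightedTrace] at h
  rw [h, ← trace_weightedTrace_mul]
  rcases Nat.even_or_odd (l.length + ε) with he | ho
  · rw [parity_pow_eq he]
  · have hz : ∀ m, (dilatedState U ψ * ((y ⊗ₖ (parity n ^ m)) ⊗ₖ (l.map majorana).prod)).trace = 0 := by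
      intro m
      set Q := (parity n ⊗ₖ parity n) ⊗ₖ parity k with hQ
      set X := (y ⊗ₖ (parity n ^ m)) ⊗ₖ (l.map (majorana (n := k))).prod with hX
      have h1 : (Q * dilatedState U ψ * Q * X).trace = (dilatedState U ψ * (Q * X * Q)).trace := by
        rw [mul_assoc, mul_assoc, Matrix.trace_mul_comm]
        simp only [mul_assoc]
      have hpm : parity n * parity n ^ m * parity n = parity n ^ m := by
        rw [← pow_succ', ← pow_succ]
        exact parity_pow_eq (by rw [Nat.even_iff]; omega)
      have h2 : Q * X * Q = -X := by
        rw [hQ, hX, ← Matrix.mul_kronecker_mul, ← Matrix.mul_kronecker_mul,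
          ← Matrix.mul_kronecker_mul, ← Matrix.mul_kronecker_mul, hy, hpm,
          isGrading_parity.conj_prod, Matrix.smul_kronecker, Matrix.smul_kronecker,
          Matrix.kronecker_smul, smul_smul, ← pow_add, add_comm, ho.neg_one_pow, neg_one_smul]
      rw [hQ, dilatedState_parity U hψ hU, ← hQ, h2, mul_neg, Matrix.trace_neg] at h1
      linear_combination h1 / 2
    rw [hz, hz]

/-- The extension of the Choi state that an antidegrading map produces. -/
noncomputable def extendedState (P : Op k →ₗ[ℂ] Op n)
    (U : Matrix (Fock n × Fock k) (Fock n × Fock k) ℂ) (ψ : Fock k → ℂ) :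
    Matrix ((Fock n × Fock n) × Fock n) ((Fock n × Fock n) × Fock n) ℂ :=
  ampliation (Fock n × Fock n) P (dilatedState U ψ)

/-- The parity power on S is the Jordan–Wigner string that the graded product of reference, S and S'
prescribes. With this string, the marginal on reference and S' is the Choi state. -/
theorem trace_extendedState_mul {P : Op k →ₗ[ℂ] Op n}
    (hψ : (parity k).mulVec ψ = ψ ∨ (parity k).mulVec ψ = -ψ)
    (hU : U * (parity n ⊗ₖ parity k) = (parity n ⊗ₖ parity k) * U ∨
      U * (parity n ⊗ₖ parity k) = -((parity n ⊗ₖ parity k) * U))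
    (hred : ∀ ρ, IsReduction majorana (fun j => pairMajorana (Sum.inr j)) (Tc ρ) (dilate U ψ ρ))
    (hP : P ∘ₗ Tc = T) {y : Op n} {ε : ℕ} (hy : parity n * y * parity n = (-1 : ℂ) ^ ε • y)
    (w : Op n) : (extendedState P U ψ * ((y ⊗ₖ (parity n ^ ε)) ⊗ₖ w)).trace =
      (choiState T * (y ⊗ₖ w)).trace := by
  rw [extendedState, trace_ampliation_mul, ← complementary_weightedTrace hψ hU hred hy, choiState,
    trace_ampliation_mul, ← hP]
  rfl

/-- The covariance matrix of an antidegradable Gaussian channel of small Choi rank. -/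
theorem IsFGC.exists_complexStructure_of_isAntidegradable (hT : IsFGC A B T) {n' : ℕ}
    (hn' : n' ≤ n) (hrank : choiRank T = 2 ^ n') (h : IsAntidegradable T) :
    ∃ J : Matrix (Maj n) (Maj n) ℝ, J.transpose = -J ∧ J * J = -1 ∧
      A * A.transpose * J = J * (A * A.transpose) ∧ B = (1 - A * A.transpose) * J ∧
      ∀ u : Maj n → ℝ, 2 * (u ⬝ᵥ (A * A.transpose).mulVec u) ≤ u ⬝ᵥ u := by
  obtain ⟨k, Tc, P, ⟨ψ, U, hψ1, hψ, hUu, hU, hred⟩, hPcp, hP⟩ := h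
  set A₁ := A * Matrix.diagonal majSign with hA₁
  have hAA : A₁ * A₁.transpose = A * A.transpose := by
    rw [hA₁, Matrix.transpose_mul, Matrix.diagonal_transpose, mul_assoc, ← mul_assoc _ _ A.transpose,
      diagonal_majSign_mul_self, one_mul]
  have hred₁ : ∀ ρ, IsReduction majorana (fun i => pairMajorana (Sum.inl i)) (T ρ)
      (dilate U ψ ρ) := fun ρ => (hred ρ).1
  have hred₂ : ∀ ρ, IsReduction majorana (fun j => pairMajorana (Sum.inr j)) (Tc ρ)
      (dilate U ψ ρ) := fun ρ => (hred ρ).2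
  have hmarg := @trace_extendedState_mul n k T Tc U ψ P hψ hU hred₂ hP
  have hχ := hT.isGaussianState_choiState.1
  set τ := extendedState P U ψ with hτ
  let C : (Maj n ⊕ Maj n) ⊕ Maj n →
      Matrix ((Fock n × Fock n) × Fock n) ((Fock n × Fock n) × Fock n) ℂ :=
    joinMajorana (parity n ⊗ₖ parity n) pairMajorana majorana
  have hC : IsCAR C := isCAR_joinMajorana isGrading_pairMajorana isCAR_pairMajorana isCAR_majorana
  have hCh : ∀ a, (C a).conjTranspose = C a :=
    joinMajorana_conjTranspose isGrading_pairMajorana.conjTranspose pairMajorana_conjTranspose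
      majorana_conjTranspose
  -- The recovery map is only completely positive; the trace is 1 because its composition with the
  -- complementary channel is T.
  have hτs : IsState τ := by
    refine ⟨hPcp.ampliation_posSemidef (pureState_posSemidef _), ?_⟩
    have := hmarg (y := 1) (ε := 0) (by simp [parity_mul_self]) 1
    rw [pow_zero, Matrix.one_kronecker_one, Matrix.one_kronecker_one, mul_one, mul_one, hχ.2] at this
    exact this
  set Γ := covMatrix C τ with hΓ
  have hΓt : Γ.transpose = -Γ := covMatrix_transpose C τ
  have hΓt' : ∀ a b, Γ a b = -Γ b a := fun a b => congrFun (congrFun hΓt b) a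
  have hcov := hT.covMatrix_choiState
  have hRR : ∀ i j, Γ (Sum.inl (Sum.inl i)) (Sum.inl (Sum.inl j)) = 0 := by
    intro i j
    have h1 := covMatrix_apply_eq_of_trace_eq hC hCh hτs isCAR_pairMajorana
      pairMajorana_conjTranspose hχ (a := Sum.inl (Sum.inl i)) (b := Sum.inl (Sum.inl j))
      (a' := Sum.inl i) (b' := Sum.inl j) (by simp) ?_
    · rw [hΓ, h1, hcov, Matrix.fromBlocks_apply₁₁, Matrix.zero_apply]
    · have := hmarg (y := majorana i * majorana j) (ε := 0) (by
        have := isGrading_parity.conj_prod [i, j]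
        simpa using this) 1
      simp only [C, joinMajorana, pairMajorana, Sum.elim_inl, ← Matrix.mul_kronecker_mul, mul_one]
      rw [pow_zero] at this
      exact this
  have hRS : ∀ i j, Γ (Sum.inl (Sum.inl i)) (Sum.inr j) = A₁ j i := by
    intro i j
    have h1 := covMatrix_apply_eq_of_trace_eq hC hCh hτs isCAR_pairMajorana
      pairMajorana_conjTranspose hχ (a := Sum.inl (Sum.inl i)) (b := Sum.inr j)
      (a' := Sum.inl i) (b' := Sum.inr j) (by simp) ?_
    · rw [hΓ, h1, hcov, Matrix.fromBlocks_apply₁₂, Matrix.transpose_apply]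
    -- On the reference the product of the two operators is the odd operator c i times the string,
    -- which explains the exponent 1.
    · have := hmarg (y := majorana i * parity n) (ε := 1) (by
        rw [← mul_assoc, parity_mul_majorana, neg_mul, mul_assoc, parity_mul_self]
        simp) (majorana j)
      simp only [C, joinMajorana, pairMajorana, Sum.elim_inl, Sum.elim_inr,
        ← Matrix.mul_kronecker_mul, one_mul]
      rw [pow_one] at this
      exact this
  have hSS : ∀ i j, Γ (Sum.inr i) (Sum.inr j) = B i j := by
    intro i j
    have h1 := covMatrix_apply_eq_of_trace_eq hC hCh hτs isCAR_pairMajorana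
      pairMajorana_conjTranspose hχ (a := Sum.inr i) (b := Sum.inr j)
      (a' := Sum.inr i) (b' := Sum.inr j) (by simp) ?_
    · rw [hΓ, h1, hcov, Matrix.fromBlocks_apply₂₂]
    · have := hmarg (y := 1) (ε := 0) (by simp [parity_mul_self]) (majorana i * majorana j)
      simp only [C, joinMajorana, pairMajorana, Sum.elim_inr, ← Matrix.mul_kronecker_mul,
        parity_mul_self]
      rw [pow_zero] at this
      exact this
  let A' : Matrix (Maj n) (Maj n) ℝ :=
    Matrix.of fun i j => Γ (Sum.inl (Sum.inl j)) (Sum.inl (Sum.inr i))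
  let B' : Matrix (Maj n) (Maj n) ℝ :=
    Matrix.of fun i j => Γ (Sum.inl (Sum.inr i)) (Sum.inl (Sum.inr j))
  let Y : Matrix (Maj n) (Maj n) ℝ :=
    Matrix.of fun i j => Γ (Sum.inl (Sum.inr j)) (Sum.inr i)
  have hΓE : Γ = extensionCov A₁ A' B B' Y := by
    ext a b
    rcases a with (i | i) | i <;> rcases b with (j | j) | j
    · simp [extensionCov, hRR]
    · simp [extensionCov, A']
    · simp [extensionCov, hRS]
    · rw [hΓt']; simp [extensionCov, A']
    · simp [extensionCov, B']
    · simp [extensionCov, Y]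
    · rw [hΓt']; simp [extensionCov, hRS]
    · rw [hΓt']; simp [extensionCov, Y]
    · simp [extensionCov, hSS]
  have hE := twoPoint_covMatrix_posSemidef hC hCh hτs
  rw [← hΓ, hΓE] at hE
  have hmain := exists_complexStructure_of_extension hT.transpose_noise
    (hT.card_le_finrank_pureSpace hn' hrank) hE ?_
  · rwa [← hA₁, hAA] at hmain
  intro v hv
  rw [← hA₁] at hv ⊢
  rw [← hΓE]
  set x : Maj n ⊕ Maj n → ℂ := Sum.elim (Complex.I • realMulVec A₁.transpose v) v with hx
  have hxE : (twoPoint (covMatrix pairMajorana (choiState T))).mulVec x = 0 := by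
    rw [hcov, twoPoint_mulVec]
    have hv2 := mem_pureSpace.1 hv
    funext a
    rcases a with i | i
    · simp [realMulVec_apply, hx, ← hA₁]
    · have h2 : realMulVec (Matrix.fromBlocks 0 A₁.transpose (-A₁) B) x (Sum.inr i) =
          -realMulVec A₁ (Complex.I • realMulVec A₁.transpose v) i + realMulVec B v i := by
        simp [realMulVec_apply, hx]
      have h3 := congrFun hv2 i
      rw [realMulVec_mul] at h3
      rw [realMulVec_smul] at h2
      simp only [Pi.sub_apply, Pi.smul_apply, smul_eq_mul, Pi.zero_apply, ← hA₁, h2] at h3 ⊢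
      simp only [hx, Sum.elim_inr]
      have hI := Complex.I_mul_I
      linear_combination h3 + realMulVec A₁ (realMulVec A₁.transpose v) i * hI
  set a := majComb (pairMajorana (r := n) (n := n)) x with ha
  -- Only on reference and S' is the full Choi marginal available. On reference and S, the recovery
  -- map need not preserve the marginal, but an annihilator of the purification still kills the
  -- extended state, and this is all that is needed.
  have h0 : (choiState T * (a.conjTranspose * a)).trace = 0 := by
    rw [ha, trace_conjTranspose_mul_majComb isCAR_pairMajorana pairMajorana_conjTranspose hχ, hxE,
      dotProduct_zero]
  rw [trace_choiState_mul hred₁, dilatedState, trace_pureState_mul] at h0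
  set Ψ : (Fock n × Fock n) × Fock k → ℂ := fun p => dilatedVector U ψ p.1.1 (p.1.2, p.2) with hΨ
  have haΨ : (a ⊗ₖ (1 : Op k)).mulVec Ψ = 0 := by
    have h1 : (a.conjTranspose * a) ⊗ₖ (1 : Op k) =
        (a ⊗ₖ (1 : Op k)).conjTranspose * (a ⊗ₖ (1 : Op k)) := by
      rw [Matrix.conjTranspose_kronecker, Matrix.conjTranspose_one, ← Matrix.mul_kronecker_mul,
        one_mul]
    rw [h1, ← Matrix.mulVec_mulVec, Matrix.dotProduct_mulVec, ← Matrix.star_mulVec,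
      dotProduct_star_self_eq_zero] at h0
    exact h0
  have haτ : (a ⊗ₖ (1 : Op n)) * τ = 0 := by
    rw [hτ, extendedState, ← ampliation_mul_left, dilatedState, pureState, Matrix.mul_vecMulVec,
      ← hΨ, haΨ]
    ext p q
    have h0 : (Matrix.of fun x y : Fock k => Matrix.vecMulVec (0 : (Fock n × Fock n) × Fock k → ℂ)
        (star Ψ) (p.1, x) (q.1, y)) = 0 := by
      ext x y
      simp [Matrix.vecMulVec_apply]
    simp only [ampliation, Matrix.of_apply, h0, map_zero, Matrix.zero_apply]
  have hCx : majComb C (Sum.elim x 0) = a ⊗ₖ (1 : Op n) := by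
    simp only [majComb, Fintype.sum_sum_type (α₁ := Maj n ⊕ Maj n), Sum.elim_inl, Sum.elim_inr, C,
      joinMajorana, ha, Pi.zero_apply, zero_smul, Finset.sum_const_zero, add_zero]
    ext p q
    simp [Matrix.kroneckerMap_apply, Matrix.sum_apply, Finset.sum_mul, mul_assoc, add_mul]
  funext b
  rw [hΓ, ← trace_mul_majComb hC hCh hτs, hCx, ← mul_assoc, Matrix.trace_mul_comm, ← mul_assoc,
    haτ]
  simp

end Forward


/-! ### Normal form of the covariance data -/

section NormalForm

variable {n : ℕ} {A B : Matrix (Maj n) (Maj n) ℝ}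

/-- The covariance data of an antidegradable channel, before bringing them to normal form. -/
def IsAntidegradableCov (A B J : Matrix (Maj n) (Maj n) ℝ) : Prop :=
  J.transpose = -J ∧ J * J = -1 ∧ A * A.transpose * J = J * (A * A.transpose) ∧
    B = (1 - A * A.transpose) * J ∧
    ∀ u : Maj n → ℝ, 2 * (u ⬝ᵥ (A * A.transpose).mulVec u) ≤ u ⬝ᵥ u

/-- The d k are the square roots of the doubled eigenvalues of A Aᵀ in a basis adapted to J; the
bound on them comes from testing the quadratic form on the columns of that basis. -/
theorem IsAntidegradableCov.exists_normalForm {J : Matrix (Maj n) (Maj n) ℝ}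
    (h : IsAntidegradableCov A B J) :
    ∃ O₁ ∈ Matrix.orthogonalGroup (Maj n) ℝ, ∃ O₂ ∈ Matrix.orthogonalGroup (Maj n) ℝ,
      ∃ d : Fin n → ℝ, A = O₁ * Matrix.diagonal (fun i : Maj n => d i.1) * O₂ ∧
        B = O₁ * (Matrix.diagonal (fun i : Maj n => 1 - d i.1 * d i.1) * vacuumCov n) *
          O₁.transpose ∧ Antitone d ∧ ∀ k, 0 ≤ d k ∧ 2 * (d k * d k) ≤ 1 := by
  obtain ⟨hJt, hJ, hHJ, hB, hbound⟩ := h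
  obtain ⟨O, hO, h, hh, hHO, hJO⟩ := exists_orthogonal_normalForm (H := A * A.transpose)
    (by rw [Matrix.transpose_mul, Matrix.transpose_transpose]) hJt hJ hHJ
  have hO1 : O.transpose * O = 1 := (Matrix.mem_orthogonalGroup_iff' (Maj n) ℝ).1 hO
  have hO2 : O * O.transpose = 1 := (Matrix.mem_orthogonalGroup_iff (Maj n) ℝ).1 hO
  have hD : O.transpose * (A * A.transpose) * O = Matrix.diagonal fun i : Maj n => h i.1 := by
    rw [mul_assoc, hHO, ← mul_assoc, hO1, one_mul]
  have hentry : ∀ a : Maj n, (fun i => O i a) ⬝ᵥ (A * A.transpose).mulVec (fun i => O i a) =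
      h a.1 := by
    intro a
    have := congrFun (congrFun hD a) a
    rw [Matrix.diagonal_apply_eq, mul_assoc] at this
    rw [← this]
    rfl
  have hpos : ∀ k, 0 ≤ h k := by
    intro k
    rw [← hentry (k, 0), ← Matrix.mulVec_mulVec, Matrix.dotProduct_mulVec, ← Matrix.mulVec_transpose]
    exact Finset.sum_nonneg fun i _ => mul_self_nonneg _
  have hle : ∀ k, 2 * h k ≤ 1 := by
    intro k
    have h1 := hbound fun i => O i (k, 0)
    rw [hentry] at h1
    have h2 := congrFun (congrFun hO1 (k, 0)) (k, 0)
    rw [Matrix.one_apply_eq] at h2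
    rw [← h2]
    exact h1
  have hsq : ∀ k, Real.sqrt (h k) * Real.sqrt (h k) = h k := fun k => Real.mul_self_sqrt (hpos k)
  obtain ⟨O₂, hO₂, hX⟩ := exists_eq_diagonal_mul (X := O.transpose * A)
    (d := fun i : Maj n => Real.sqrt (h i.1)) (by
      rw [Matrix.transpose_mul, Matrix.transpose_transpose]
      simp only [hsq]
      rw [← hD]
      simp only [mul_assoc])
  refine ⟨O, hO, O₂, hO₂, fun k => Real.sqrt (h k), ?_, ?_, ?_, ?_⟩
  · rw [mul_assoc, ← hX, ← mul_assoc, hO2, one_mul]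
  · simp only [hsq]
    have h1 : Matrix.diagonal (fun i : Maj n => 1 - h i.1) =
        1 - Matrix.diagonal (fun i : Maj n => h i.1) := by
      rw [← Matrix.diagonal_one, Matrix.diagonal_sub]
    have h2 : O * (1 - Matrix.diagonal (fun i : Maj n => h i.1)) = (1 - A * A.transpose) * O := by
      rw [mul_sub, sub_mul, mul_one, one_mul, hHO]
    rw [hB, h1, ← mul_assoc O, h2, mul_assoc _ O, ← hJO, mul_assoc, mul_assoc, hO2, mul_one]
  · exact fun i j hij => Real.sqrt_le_sqrt (hh hij)
  · exact fun k => ⟨Real.sqrt_nonneg _, by rw [hsq]; exact hle k⟩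

/-- The candidate is J = (1 - A Aᵀ)⁻¹ B. The block condition on B' makes the inverse commute with B,
giving antisymmetry; J² = -1 is where the Choi rank enters. -/
theorem exists_isAntidegradableCov {T : Op n →ₗ[ℂ] Op n} (hT : IsFGC A B T) {n' : ℕ} (hn' : n' ≤ n)
    (hrank : choiRank T = 2 ^ n') {O₁ O₂ B' : Matrix (Maj n) (Maj n) ℝ}
    (hO₁ : O₁ ∈ Matrix.orthogonalGroup (Maj n) ℝ) (hO₂ : O₂ ∈ Matrix.orthogonalGroup (Maj n) ℝ)
    {d : Fin n → ℝ} (hA : A = O₁ * Matrix.diagonal (fun i : Maj n => d i.1) * O₂)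
    (hB : B = O₁ * B' * O₁.transpose) (hd : ∀ k, 2 * (d k * d k) ≤ 1)
    (hB' : ∀ i j, d i.1 ≠ d j.1 → B' i j = 0) : ∃ J, IsAntidegradableCov A B J := by
  have hO1 : O₁.transpose * O₁ = 1 := (Matrix.mem_orthogonalGroup_iff' (Maj n) ℝ).1 hO₁
  have hO2 : O₁ * O₁.transpose = 1 := (Matrix.mem_orthogonalGroup_iff (Maj n) ℝ).1 hO₁
  have hO3 : O₂ * O₂.transpose = 1 := (Matrix.mem_orthogonalGroup_iff (Maj n) ℝ).1 hO₂
  have hcomm : ∀ f : ℝ → ℝ, Matrix.diagonal (fun i : Maj n => f (d i.1)) * B' =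
      B' * Matrix.diagonal (fun i : Maj n => f (d i.1)) := by
    intro f
    ext i j
    rw [Matrix.diagonal_mul, Matrix.mul_diagonal]
    by_cases hij : d i.1 = d j.1
    · rw [hij, mul_comm]
    · rw [hB' i j hij, mul_zero, zero_mul]
  have hconj : ∀ X Y : Matrix (Maj n) (Maj n) ℝ,
      O₁ * X * O₁.transpose * (O₁ * Y * O₁.transpose) = O₁ * (X * Y) * O₁.transpose := by
    intro X Y
    have : O₁ * X * O₁.transpose * (O₁ * Y * O₁.transpose) =
        O₁ * X * (O₁.transpose * O₁) * Y * O₁.transpose := by simp only [mul_assoc]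
    rw [this, hO1, mul_one]
    simp only [mul_assoc]
  have hH : A * A.transpose = O₁ * Matrix.diagonal (fun i : Maj n => d i.1 * d i.1) *
      O₁.transpose := by
    have h1 : A * A.transpose = O₁ * Matrix.diagonal (fun i : Maj n => d i.1) * (O₂ * O₂.transpose) *
        Matrix.diagonal (fun i : Maj n => d i.1) * O₁.transpose := by
      rw [hA, Matrix.transpose_mul, Matrix.transpose_mul, Matrix.diagonal_transpose]
      simp only [mul_assoc]
    rw [h1, hO3, mul_one, mul_assoc O₁, Matrix.diagonal_mul_diagonal]
  set K := O₁ * Matrix.diagonal (fun i : Maj n => (1 - d i.1 * d i.1)⁻¹) * O₁.transpose with hK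
  have hG : 1 - A * A.transpose =
      O₁ * Matrix.diagonal (fun i : Maj n => 1 - d i.1 * d i.1) * O₁.transpose := by
    have h1 : Matrix.diagonal (fun i : Maj n => 1 - d i.1 * d i.1) =
        1 - Matrix.diagonal (fun i : Maj n => d i.1 * d i.1) := by
      rw [← Matrix.diagonal_one, Matrix.diagonal_sub]
    rw [h1, mul_sub, sub_mul, mul_one, hO2, hH]
  have hKG : K * (1 - A * A.transpose) = 1 := by
    rw [hG, hK, hconj, Matrix.diagonal_mul_diagonal]
    have : (fun i : Maj n => (1 - d i.1 * d i.1)⁻¹ * (1 - d i.1 * d i.1)) = fun _ => 1 := by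
      funext i
      exact inv_mul_cancel₀ (by nlinarith [hd i.1])
    rw [this, Matrix.diagonal_one, mul_one, hO2]
  have hGK : (1 - A * A.transpose) * K = 1 := mul_eq_one_comm.1 hKG
  have hKB : K * B = B * K := by
    rw [hK, hB, hconj, hconj, hcomm fun x => (1 - x * x)⁻¹]
  have hKt : K.transpose = K := by
    rw [hK, Matrix.transpose_mul, Matrix.transpose_mul, Matrix.transpose_transpose,
      Matrix.diagonal_transpose, mul_assoc]
  have hHB : A * A.transpose * B = B * (A * A.transpose) := by
    rw [hH, hB, hconj, hconj, hcomm fun x => x * x]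
  have hHK : A * A.transpose * K = K * (A * A.transpose) := by
    rw [hH, hK, hconj, hconj, Matrix.diagonal_mul_diagonal, Matrix.diagonal_mul_diagonal]
    simp only [mul_comm]
  refine ⟨K * B, ?_, ?_, ?_, ?_, ?_⟩
  · rw [Matrix.transpose_mul, hT.transpose_noise, hKt, neg_mul, hKB]
  · have hAA : A * Matrix.diagonal majSign * (A * Matrix.diagonal majSign).transpose =
        A * A.transpose := by
      rw [Matrix.transpose_mul, Matrix.diagonal_transpose, mul_assoc, ← mul_assoc _ _ A.transpose,
        diagonal_majSign_mul_self, one_mul]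
    have hmem : ∀ v ∈ pureSpace (A * Matrix.diagonal majSign) B,
        realMulVec (1 - A * A.transpose) v = Complex.I • realMulVec B v := by
      intro v hv
      rw [mem_pureSpace, hAA] at hv
      rw [realMulVec_sub, realMulVec_one, hv]
    have hinj : ∀ v, realMulVec K (realMulVec (1 - A * A.transpose) v) = v := by
      intro v
      rw [← realMulVec_mul, hKG, realMulVec_one]
    -- On `pureSpace` the equation (1 - H)v = iBv says Jv = -iv, hence (J² + 1)v = 0. A conjugate
    -- pair in the space would satisfy (1 - H)v = 0, impossible as 1 - H is invertible.
    have h0 := eq_zero_of_realMulVec (hT.card_le_finrank_pureSpace hn' hrank) (X := K * B * (K * B) + 1)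
      ?_ ?_
    · exact eq_neg_of_add_eq_zero_left h0
    · intro v hv hv'
      have h1 := hmem v hv
      have h2 := congrArg star (hmem _ hv')
      rw [realMulVec_star, realMulVec_star, star_smul, star_star, star_star, Complex.star_def,
        Complex.conj_I, neg_smul, ← h1] at h2
      have h3 : realMulVec (1 - A * A.transpose) v = 0 := by
        funext i
        have := congrFun h2 i
        simp only [Pi.neg_apply] at this
        simp only [Pi.zero_apply]
        linear_combination this / 2
      rw [← hinj v, h3]
      exact Matrix.mulVec_zero _
    · intro v hv
      have h1 : v = Complex.I • realMulVec (K * B) v := by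
        conv_lhs => rw [← hinj v, hmem v hv, realMulVec_smul, ← realMulVec_mul]
      have h2 : realMulVec (K * B) v = -(Complex.I • v) := by
        conv_rhs => rw [h1, smul_smul, Complex.I_mul_I, neg_one_smul, neg_neg]
      rw [realMulVec_add, realMulVec_mul, realMulVec_one, h2, realMulVec_neg_right, realMulVec_smul,
        h2, smul_neg, neg_neg, smul_smul, Complex.I_mul_I, neg_one_smul, neg_add_cancel]
  · rw [← mul_assoc, hHK, mul_assoc, hHB, ← mul_assoc]
  · rw [← mul_assoc, hGK, one_mul]
  · intro u
    set w := O₁.transpose.mulVec u with hw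
    have hu : u = O₁.mulVec w := by rw [hw, Matrix.mulVec_mulVec, hO2, Matrix.one_mulVec]
    have h1 : u ⬝ᵥ u = ∑ i, w i * w i := by
      nth_rw 2 [hu]
      rw [Matrix.dotProduct_mulVec, ← Matrix.mulVec_transpose]
      rfl
    have h2 : u ⬝ᵥ (A * A.transpose).mulVec u = ∑ i, w i * (d i.1 * d i.1 * w i) := by
      rw [hH, ← Matrix.mulVec_mulVec, ← Matrix.mulVec_mulVec, Matrix.dotProduct_mulVec,
        ← Matrix.mulVec_transpose, ← hw]
      simp only [dotProduct, Matrix.mulVec_diagonal]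
    rw [h1, h2, Finset.mul_sum]
    refine Finset.sum_le_sum fun i _ => ?_
    nlinarith [hd i.1, mul_self_nonneg (w i)]

end NormalForm


/-! ### Unitary implementation of orthogonal transformations -/

section Implementation

variable {K ι : Type} [Fintype K] [DecidableEq K] [Fintype ι] [DecidableEq ι]

/-- The unitary `U` of definite parity implements the rotation `φ` of the Majorana operators. -/
def Implements (P : Matrix K K ℂ) (c : ι → Matrix K K ℂ)
    (φ : EuclideanSpace ℝ ι ≃ₗᵢ[ℝ] EuclideanSpace ℝ ι) (U : Matrix K K ℂ) : Prop :=
  U ∈ Matrix.unitaryGroup K ℂ ∧ (U * P = P * U ∨ U * P = -(P * U)) ∧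
    ∀ x : EuclideanSpace ℝ ι, U.conjTranspose * majComb c (fun i => (x i : ℂ)) * U =
      majComb c fun i => (φ x i : ℂ)

theorem Implements.one (P : Matrix K K ℂ) (c : ι → Matrix K K ℂ) : Implements P c 1 1 :=
  ⟨one_mem _, Or.inl (by rw [one_mul, mul_one]), fun x => by
    rw [Matrix.conjTranspose_one, one_mul, mul_one]; rfl⟩

theorem Implements.mul {P : Matrix K K ℂ} {c : ι → Matrix K K ℂ}
    {φ φ' : EuclideanSpace ℝ ι ≃ₗᵢ[ℝ] EuclideanSpace ℝ ι} {U U' : Matrix K K ℂ}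
    (h : Implements P c φ U) (h' : Implements P c φ' U') : Implements P c (φ * φ') (U' * U) := by
  refine ⟨mul_mem h'.1 h.1, ?_, fun x => ?_⟩
  · rcases h.2.1 with h1 | h1 <;> rcases h'.2.1 with h2 | h2
    · exact Or.inl (by rw [mul_assoc, h1, ← mul_assoc, h2, mul_assoc])
    · exact Or.inr (by rw [mul_assoc, h1, ← mul_assoc, h2, neg_mul, mul_assoc])
    · exact Or.inr (by rw [mul_assoc, h1, mul_neg, ← mul_assoc, h2, mul_assoc])
    · exact Or.inl (by rw [mul_assoc, h1, mul_neg, ← mul_assoc, h2, neg_mul, neg_neg, mul_assoc])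
  · have h1 := h'.2.2 x
    have h2 := h.2.2 (φ' x)
    rw [← h1] at h2
    rw [Matrix.conjTranspose_mul]
    simp only [mul_assoc] at h2 ⊢
    exact h2

theorem exists_implements_reflection {P : Matrix K K ℂ} {c : ι → Matrix K K ℂ} (hc : IsCAR c)
    (hh : ∀ i, (c i).conjTranspose = c i) (hP : IsGrading P c) (v : EuclideanSpace ℝ ι) :
    ∃ U, Implements P c ((ℝ ∙ v)ᗮ.reflection) U := by
  rcases eq_or_ne v 0 with rfl | hv
  · refine ⟨1, ?_⟩
    have : (ℝ ∙ (0 : EuclideanSpace ℝ ι))ᗮ.reflection = 1 := by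
      ext x : 1
      rw [Submodule.reflection_orthogonal_apply, Submodule.reflection_singleton_apply]
      simp
    rw [this]
    exact Implements.one P c
  have hnorm : ‖v‖ ≠ 0 := norm_ne_zero_iff.2 hv
  set w : ι → ℂ := fun i => ((‖v‖⁻¹ * v i : ℝ) : ℂ) with hw
  set C := majComb c w with hC
  have hCh : C.conjTranspose = C := by
    rw [hC, majComb_conjTranspose hh]
    congr 1
    funext i
    simp [hw]
  have hdot : ∀ x : EuclideanSpace ℝ ι, w ⬝ᵥ (fun i => (x i : ℂ)) =
      ((‖v‖⁻¹ * inner ℝ v x : ℝ) : ℂ) := by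
    intro x
    simp only [dotProduct, hw, PiLp.inner_apply, RCLike.inner_apply, conj_trivial, Finset.mul_sum]
    push_cast
    refine Finset.sum_congr rfl fun i _ => ?_
    ring
  have hanti : ∀ x : EuclideanSpace ℝ ι, C * majComb c (fun i => (x i : ℂ)) =
      (2 * ((‖v‖⁻¹ * inner ℝ v x : ℝ) : ℂ)) • (1 : Matrix K K ℂ) -
        majComb c (fun i => (x i : ℂ)) * C := by
    intro x
    rw [← hdot, ← majComb_anticomm hc, add_sub_cancel_right]
  have hCC : C * C = 1 := by
    have h1 := majComb_anticomm hc w w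
    have h2 : w ⬝ᵥ w = 1 := by
      have : w = fun i => ((((‖v‖⁻¹ : ℝ) • v : EuclideanSpace ℝ ι) i : ℝ) : ℂ) := by
        funext i; simp [hw]
      nth_rw 2 [this]
      rw [hdot, real_inner_smul_right, real_inner_self_eq_norm_sq]
      field_simp
      simp
    rw [h2, ← hC, ← two_smul ℂ (C * C), mul_one] at h1
    exact smul_right_injective _ (two_ne_zero' ℂ) h1
  have hPc : ∀ u, P * majComb c u = -(majComb c u * P) := by
    intro u
    simp only [majComb, Finset.mul_sum, Finset.sum_mul, mul_smul_comm, smul_mul_assoc, hP.anticomm,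
      smul_neg, Finset.sum_neg_distrib]
  -- Conjugation by the Majorana operator C of the unit vector fixes v and negates its orthogonal
  -- complement. The parity factor negates everything once more, leaving the reflection.
  refine ⟨C * P, ?_, Or.inr ?_, fun x => ?_⟩
  · rw [Matrix.mem_unitaryGroup_iff', Matrix.star_eq_conjTranspose, Matrix.conjTranspose_mul, hCh,
      hP.conjTranspose, mul_assoc, ← mul_assoc C, hCC, one_mul, hP.mul_self]
  · rw [← mul_assoc, hPc, neg_mul, neg_neg]
  · have h1 : (fun i => (((ℝ ∙ v)ᗮ.reflection x) i : ℂ)) =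
        (fun i => (x i : ℂ)) + (-(2 * ((‖v‖⁻¹ * inner ℝ v x : ℝ) : ℂ))) • w := by
      funext i
      rw [Submodule.reflection_orthogonal_apply, Submodule.reflection_singleton_apply]
      simp [hw]
      field_simp
      ring
    rw [h1, majComb_add, majComb_smul, ← hC, Matrix.conjTranspose_mul, hCh, hP.conjTranspose]
    have h2 : P * C * majComb c (fun i => (x i : ℂ)) * (C * P) =
        P * (C * majComb c (fun i => (x i : ℂ))) * C * P := by simp only [mul_assoc]
    rw [h2, hanti, mul_sub, sub_mul, sub_mul]
    have h3 : P * (majComb c (fun i => (x i : ℂ)) * C) * C * P =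
        P * majComb c (fun i => (x i : ℂ)) * (C * C) * P := by simp only [mul_assoc]
    rw [h3, hCC, mul_one, hPc, neg_mul, mul_assoc _ P P, hP.mul_self, mul_one, mul_smul_comm, mul_one,
      smul_mul_assoc, smul_mul_assoc, hPc, neg_mul, mul_assoc _ P P, hP.mul_self, mul_one, neg_smul,
      smul_neg, sub_neg_eq_add, add_comm]

/-- Every orthogonal transformation of the Majorana operators is implemented by a unitary operator
of definite parity. -/
theorem exists_implements {P : Matrix K K ℂ} {c : ι → Matrix K K ℂ} (hc : IsCAR c)
    (hh : ∀ i, (c i).conjTranspose = c i) (hP : IsGrading P c) {O : Matrix ι ι ℝ}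
    (hO : O ∈ Matrix.orthogonalGroup ι ℝ) : ∃ U ∈ Matrix.unitaryGroup K ℂ,
      (U * P = P * U ∨ U * P = -(P * U)) ∧
      ∀ a, U.conjTranspose * c a * U = majComb c fun b => (O a b : ℂ) := by
  have hO2 : O * O.transpose = 1 := (Matrix.mem_orthogonalGroup_iff ι ℝ).1 hO
  -- The transpose sends the basis vector a to row a of O, as required by the Heisenberg action on c
  -- a.
  let f : EuclideanSpace ℝ ι →ₗ[ℝ] EuclideanSpace ℝ ι := Matrix.toEuclideanLin O.transpose
  have hf : ∀ x i, f x i = O.transpose.mulVec (fun j => x j) i := fun x i => rfl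
  have hinner : ∀ x y, inner ℝ (f x) (f y) = inner ℝ x y := by
    intro x y
    have h1 : ∀ x y : EuclideanSpace ℝ ι, inner ℝ x y = (fun i => x i) ⬝ᵥ (fun i => y i) := by
      intro x y
      simp [PiLp.inner_apply, dotProduct, mul_comm]
    rw [h1, h1]
    simp only [hf]
    change O.transpose.mulVec _ ⬝ᵥ O.transpose.mulVec _ = _
    rw [Matrix.dotProduct_mulVec, ← Matrix.mulVec_transpose, Matrix.transpose_transpose,
      Matrix.mulVec_mulVec, hO2, Matrix.one_mulVec]
  let φ := (f.isometryOfInner hinner).toLinearIsometryEquiv rfl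
  -- Cartan–Dieudonné: an orthogonal map is a product of reflections.
  obtain ⟨l, -, hl⟩ := φ.reflections_generate_dim
  have key : ∀ l : List (EuclideanSpace ℝ ι),
      ∃ U, Implements P c (l.map fun v => (ℝ ∙ v)ᗮ.reflection).prod U := by
    intro l
    induction l with
    | nil => exact ⟨1, Implements.one P c⟩
    | cons v l ih =>
      obtain ⟨U, hU⟩ := ih
      obtain ⟨V, hV⟩ := exists_implements_reflection hc hh hP v
      exact ⟨U * V, by simpa using hV.mul hU⟩
  obtain ⟨U, hU⟩ := key l
  rw [← hl] at hU
  refine ⟨U, hU.1, hU.2.1, fun a => ?_⟩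
  have h := hU.2.2 (EuclideanSpace.single a 1)
  have h1 : (fun i => ((EuclideanSpace.single a (1 : ℝ) : EuclideanSpace ℝ ι) i : ℂ)) =
      Pi.single a 1 := by
    funext i
    simp [Pi.single_apply, apply_ite Complex.ofReal]
  rw [h1, majComb_single] at h
  rw [h]
  congr 1
  funext b
  have : φ (EuclideanSpace.single a 1) b =
      O.transpose.mulVec (fun j => (EuclideanSpace.single a (1 : ℝ) : EuclideanSpace ℝ ι) j) b := rfl
  rw [this]
  simp [Matrix.mulVec, dotProduct]

end Implementation


/-! ### Rotated pure states and the initial state of the dilation -/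

theorem wick_map {ι κ : Type} (E : ι → ι → ℂ) (g : κ → ι) (l : List κ) :
    wick E (l.map g) = wick (fun a b => E (g a) (g b)) l := by
  induction hl : l.length using Nat.strong_induction_on generalizing l with
  | _ m ih =>
    cases l with
    | nil => simp [wick]
    | cons a l =>
      rw [List.map_cons, wick, wick]
      refine Fintype.sum_equiv (finCongr (List.length_map g)) _ _ fun j => ?_
      rw [List.eraseIdx_map, ih _ ?_ _ rfl]
      · simp
      · have := List.length_eraseIdx_le l j
        simp only [List.length_cons] at hl
        omega

section Rotation

variable {K ι κ : Type} [Fintype K] [DecidableEq K] [Fintype ι] [DecidableEq ι]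

theorem majComb_rotate {c c' : ι → Matrix K K ℂ} {R : Matrix ι ι ℝ}
    (hc' : ∀ a, c' a = majComb c fun b => (R a b : ℂ)) (v : ι → ℂ) :
    majComb c' v = majComb c (Matrix.vecMul v (R.map Complex.ofReal)) := by
  simp only [majComb, hc', Finset.smul_sum, smul_smul]
  rw [Finset.sum_comm]
  simp only [← Finset.sum_smul]
  rfl

/-- Rotating the Majorana operators rotates the covariance matrix of a pure Gaussian state. -/
theorem twoPoint_rotate_mulVec {c c' : ι → Matrix K K ℂ} {R M : Matrix ι ι ℝ}
    (hc' : ∀ a, c' a = majComb c fun b => (R a b : ℂ)) (hR : R.transpose * R = 1) {Ψ : K → ℂ}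
    (h : ∀ a, (majComb c (twoPoint M a)).mulVec Ψ = 0) (a : ι) :
    (majComb c' (twoPoint (R * M * R.transpose) a)).mulVec Ψ = 0 := by
  -- The rotated annihilators are linear combinations of the original ones, since orthogonality of R
  -- intertwines the two-point matrices.
  have h1 : twoPoint (R * M * R.transpose) * R.map Complex.ofReal =
      R.map Complex.ofReal * twoPoint M := by
    have h2 : (R * M * R.transpose).map Complex.ofReal * R.map Complex.ofReal =
        R.map Complex.ofReal * M.map Complex.ofReal := by
      have hm : ∀ X Y : Matrix ι ι ℝ, (X * Y).map Complex.ofReal =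
          X.map Complex.ofReal * Y.map Complex.ofReal :=
        fun X Y => Matrix.map_mul (f := Complex.ofRealHom)
      rw [← hm, ← hm, mul_assoc, hR, mul_one]
    rw [twoPoint, twoPoint, sub_mul, mul_sub, one_mul, mul_one, smul_mul_assoc, h2, mul_smul_comm]
  have h3 : Matrix.vecMul (twoPoint (R * M * R.transpose) a) (R.map Complex.ofReal) =
      ∑ b, (R a b : ℂ) • twoPoint M b := by
    have h4 := congrFun h1 a
    rw [Matrix.mul_apply_eq_vecMul, Matrix.mul_apply_eq_vecMul] at h4
    rw [h4]
    funext j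
    simp [Matrix.vecMul, dotProduct]
  rw [majComb_rotate hc', h3]
  have h5 : ∀ (s : Finset ι) (v : ι → ι → ℂ), majComb c (∑ b ∈ s, v b) = ∑ b ∈ s, majComb c (v b) := by
    intro s v
    simp only [majComb, Finset.sum_apply, Finset.sum_smul]
    rw [Finset.sum_comm]
  rw [h5, Matrix.sum_mulVec]
  refine Finset.sum_eq_zero fun b _ => ?_
  rw [majComb_smul, Matrix.smul_mulVec, h, smul_zero]

end Rotation

section Vacuum

variable {n k : ℕ}

/-- The vacuum vector. -/
def vacuum (k : ℕ) : Fock k → ℂ := Pi.single (fun _ => false) 1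

theorem star_vacuum_dotProduct : star (vacuum k) ⬝ᵥ vacuum k = 1 := by
  simp [vacuum]

theorem parity_mulVec_vacuum : (parity k).mulVec (vacuum k) = vacuum k := by
  funext x
  rw [parity, Matrix.mulVec_diagonal, vacuum, Pi.single_apply]
  split_ifs with h
  · simp [h]
  · simp

theorem twoPoint_mulVec_vacuum (a : Maj k) :
    (majComb majorana (twoPoint (vacuumCov k) a)).mulVec (vacuum k) = 0 := by
  have hI := Complex.I_mul_I
  have h1 : ∀ j : Fin k, (majorana (j, 1)).mulVec (vacuum k) =
      -(Complex.I • (majorana (j, 0)).mulVec (vacuum k)) := by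
    intro j
    funext x
    simp only [vacuum, Matrix.mulVec_single_one, majorana, Pi.neg_apply, Pi.smul_apply,
      Matrix.col_apply, Matrix.of_apply]
    split_ifs <;> simp_all
  obtain ⟨j, e⟩ := a
  have h2 : majComb majorana (twoPoint (vacuumCov k) (j, e)) =
      majorana (j, e) - Complex.I • (if e = 0 then majorana (j, 1) else -majorana (j, 0)) := by
    rw [majComb, Fintype.sum_prod_type, Finset.sum_eq_single j]
    · fin_cases e <;> simp [twoPoint_apply, vacuumCov, sub_eq_add_neg, add_comm]
    · intro b _ hb
      simp [twoPoint_apply, vacuumCov, hb.symm]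
    · simp
  rw [h2]
  fin_cases e
  · simp [Matrix.sub_mulVec, Matrix.smul_mulVec, h1, smul_smul]
  · simp [Matrix.add_mulVec, Matrix.smul_mulVec, h1]

/-- The initial joint vector of reference, system and environment. -/
noncomputable def initialVector (n k : ℕ) : Fock n × (Fock n × Fock k) → ℂ :=
  fun p => maxEntangled n (p.1, p.2.1) * vacuum k p.2.2

/-- The covariance matrix of the vacuum on the environment, extended by zero. -/
def environmentCov (n k : ℕ) : Matrix (Maj n ⊕ Maj k) (Maj n ⊕ Maj k) ℝ :=
  Matrix.fromBlocks 0 0 0 (vacuumCov k)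

/-- The correlations of the reference with system and environment. -/
def referenceCov (n k : ℕ) : Matrix (Maj n) (Maj n ⊕ Maj k) ℝ :=
  Matrix.fromCols (Matrix.diagonal majSign) 0

/-- The covariance matrix of the initial joint state of reference, system and environment. -/
def initialCov (n k : ℕ) : Matrix (Maj n ⊕ (Maj n ⊕ Maj k)) (Maj n ⊕ (Maj n ⊕ Maj k)) ℝ :=
  Matrix.fromBlocks 0 (referenceCov n k) (-(referenceCov n k).transpose) (environmentCov n k)

theorem referenceCov_mul_transpose_apply (O : Matrix (Maj n ⊕ Maj k) (Maj n ⊕ Maj k) ℝ) (i : Maj n)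
    (a : Maj n ⊕ Maj k) :
    (referenceCov n k * O.transpose) i a = majSign i * O a (Sum.inl i) := by
  rw [Matrix.mul_apply, Fintype.sum_sum_type]
  simp [referenceCov, Matrix.diagonal_apply]

theorem star_initialVector_dotProduct : star (initialVector n k) ⬝ᵥ initialVector n k = 1 := by
  have h1 := star_maxEntangled_dotProduct (n := n)
  have h2 := star_vacuum_dotProduct (k := k)
  rw [← mul_one 1]
  nth_rw 1 [← h1]
  rw [← h2]
  simp only [dotProduct, Fintype.sum_prod_type, Pi.star_apply, initialVector, star_mul',
    Finset.sum_mul]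
  simp only [Finset.mul_sum]
  refine Finset.sum_congr rfl fun p _ => Finset.sum_congr rfl fun x _ =>
    Finset.sum_congr rfl fun e _ => ?_
  ring

theorem kronecker_mulVec_initialVector (y Z : Op n) (w : Op k) :
    (y ⊗ₖ (Z ⊗ₖ w)).mulVec (initialVector n k) =
      fun p => (y ⊗ₖ Z).mulVec (maxEntangled n) (p.1, p.2.1) * w.mulVec (vacuum k) p.2.2 := by
  funext p
  simp only [Matrix.mulVec, dotProduct, Fintype.sum_prod_type, initialVector,
    Matrix.kroneckerMap_apply, Finset.sum_mul]
  simp only [Finset.mul_sum]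
  refine Finset.sum_congr rfl fun q _ => Finset.sum_congr rfl fun x _ =>
    Finset.sum_congr rfl fun e _ => ?_
  ring

/-- The initial vector is a product, but the environment operators carry the parity string of
reference and system; hence the factor P ⊗ P in the second term. -/
theorem majComb_mulVec_initialVector (v : Maj n ⊕ (Maj n ⊕ Maj k) → ℂ) :
    (majComb (joinMajorana (parity n) majorana pairMajorana) v).mulVec (initialVector n k) =
      fun p => (majComb pairMajorana (Sum.elim (v ∘ Sum.inl) (v ∘ Sum.inr ∘ Sum.inl))).mulVec
          (maxEntangled n) (p.1, p.2.1) * vacuum k p.2.2 +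
        (parity n ⊗ₖ parity n).mulVec (maxEntangled n) (p.1, p.2.1) *
          (majComb majorana (v ∘ Sum.inr ∘ Sum.inr)).mulVec (vacuum k) p.2.2 := by
  have h1 : ∀ i : Maj n, (majorana i ⊗ₖ (1 : Matrix (Fock n × Fock k) (Fock n × Fock k) ℂ)).mulVec
      (initialVector n k) = fun p => (majorana i ⊗ₖ (1 : Op n)).mulVec (maxEntangled n)
        (p.1, p.2.1) * vacuum k p.2.2 := by
    intro i
    rw [← Matrix.one_kronecker_one, kronecker_mulVec_initialVector, Matrix.one_mulVec]
  funext p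
  simp only [majComb, Fintype.sum_sum_type, joinMajorana, pairMajorana, Sum.elim_inl, Sum.elim_inr,
    Matrix.add_mulVec, Matrix.sum_mulVec, Matrix.smul_mulVec, h1, kronecker_mulVec_initialVector,
    Matrix.one_mulVec, Function.comp_apply, Pi.add_apply, Finset.sum_apply, Pi.smul_apply,
    smul_eq_mul, add_mul, Finset.sum_mul, Finset.mul_sum, mul_assoc, add_assoc]
  congr 2
  refine Finset.sum_congr rfl fun i _ => ?_
  ring

theorem twoPoint_mulVec_initialVector (a : Maj n ⊕ (Maj n ⊕ Maj k)) :
    (majComb (joinMajorana (parity n) majorana pairMajorana)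
      (twoPoint (initialCov n k) a)).mulVec (initialVector n k) = 0 := by
  rw [majComb_mulVec_initialVector]
  have hz : ∀ {m : ℕ}, majComb (majorana (n := m)) (0 : Maj m → ℂ) = 0 := by
    intro m; simp [majComb]
  have hz2 : majComb (pairMajorana (r := n) (n := n)) 0 = 0 := by simp [majComb]
  rcases a with i | i | i
  · have h1 : Sum.elim (twoPoint (initialCov n k) (Sum.inl i) ∘ Sum.inl)
        (twoPoint (initialCov n k) (Sum.inl i) ∘ Sum.inr ∘ Sum.inl) =
        twoPoint (maxEntangledCov n) (Sum.inl i) := by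
      funext b
      rcases b with j | j <;> simp [twoPoint_apply, initialCov, referenceCov, maxEntangledCov]
    have h2 : twoPoint (initialCov n k) (Sum.inl i) ∘ Sum.inr ∘ Sum.inr = 0 := by
      funext b
      simp [twoPoint_apply, initialCov, referenceCov]
    rw [h1, h2, twoPoint_mulVec_maxEntangled, hz]
    funext p
    simp
  · have h1 : Sum.elim (twoPoint (initialCov n k) (Sum.inr (Sum.inl i)) ∘ Sum.inl)
        (twoPoint (initialCov n k) (Sum.inr (Sum.inl i)) ∘ Sum.inr ∘ Sum.inl) =
        twoPoint (maxEntangledCov n) (Sum.inr i) := by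
      funext b
      rcases b with j | j <;> simp [twoPoint_apply, initialCov, referenceCov, environmentCov,
        maxEntangledCov, Matrix.diagonal_apply, apply_ite Complex.ofReal, eq_comm (a := i)]
      split_ifs with h <;> simp [h]
    have h2 : twoPoint (initialCov n k) (Sum.inr (Sum.inl i)) ∘ Sum.inr ∘ Sum.inr = 0 := by
      funext b
      simp [twoPoint_apply, initialCov, referenceCov, environmentCov]
    rw [h1, h2, twoPoint_mulVec_maxEntangled, hz]
    funext p
    simp
  · have h1 : Sum.elim (twoPoint (initialCov n k) (Sum.inr (Sum.inr i)) ∘ Sum.inl)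
        (twoPoint (initialCov n k) (Sum.inr (Sum.inr i)) ∘ Sum.inr ∘ Sum.inl) = 0 := by
      funext b
      rcases b with j | j <;> simp [twoPoint_apply, initialCov, referenceCov, environmentCov]
    have h2 : twoPoint (initialCov n k) (Sum.inr (Sum.inr i)) ∘ Sum.inr ∘ Sum.inr =
        twoPoint (vacuumCov k) i := by
      funext b
      simp [twoPoint_apply, initialCov, referenceCov, environmentCov]
    rw [h1, h2, twoPoint_mulVec_vacuum, hz2]
    funext p
    simp

theorem weightedTrace_initialVector (y : Op n) :
    weightedTrace (pureState (initialVector n k)) y =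
      weightedTrace (pureState (maxEntangled n)) y ⊗ₖ
        Matrix.vecMulVec (vacuum k) (star (vacuum k)) := by
  ext ⟨x, e⟩ ⟨x', e'⟩
  simp only [weightedTrace, Matrix.sum_apply, Matrix.smul_apply, Matrix.of_apply, pureState,
    Matrix.vecMulVec_apply, Matrix.kroneckerMap_apply, Pi.star_apply, initialVector, star_mul',
    Finset.sum_mul, smul_eq_mul]
  refine Finset.sum_congr rfl fun p _ => Finset.sum_congr rfl fun q _ => ?_
  ring

end Vacuum

/-! ### Covariance data determine the channel -/

section Dilation

variable {n k : ℕ} {A B : Matrix (Maj n) (Maj n) ℝ} {T T' : Op n →ₗ[ℂ] Op n}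

/-- The maximally entangled vector has no vanishing diagonal coefficient, so each block of the Choi
state is a nonzero multiple of the image of a matrix unit. -/
theorem choiState_injective (h : choiState T' = choiState T) : T' = T := by
  have hf : ∀ r : Fock n, (Real.sqrt (2 ^ n) : ℂ)⁻¹ * parityPhase n r r ≠ 0 := by
    intro r h0
    have h1 : parityPhase n r r = 0 := by
      rcases mul_eq_zero.1 h0 with h2 | h2
      · exfalso
        rw [inv_eq_zero, Complex.ofReal_eq_zero, Real.sqrt_eq_zero (by positivity)] at h2
        exact absurd h2 (by positivity)
      · exact h2
    have h2 : maxEntangled n ∘ Prod.mk r = 0 := by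
      funext x
      simp [maxEntangled_apply, h1]
    have h3 := congrFun (congrFun (parityPhase_conjTranspose_mul (n := n)) r) r
    have h4 : ∀ x, parityPhase n x r = 0 := by
      intro x
      by_cases hx : x = r
      · rw [hx, h1]
      · simp [parityPhase, parity, hx]
    rw [Matrix.mul_apply, Matrix.one_apply_eq] at h3
    simp [h4] at h3
  refine Matrix.ext_linearMap ℂ fun r s => LinearMap.ext_ring ?_
  change T' (Matrix.single r s 1) = T (Matrix.single r s 1)
  ext x y
  have h1 := congrFun (congrFun h (r, x)) (s, y)
  simp only [choiState, ampliation, Matrix.of_apply] at h1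
  have h2 : (Matrix.of fun x y => pureState (maxEntangled n) (r, x) (s, y) : Op n) =
      ((Real.sqrt (2 ^ n) : ℂ)⁻¹ * parityPhase n r r *
        star ((Real.sqrt (2 ^ n) : ℂ)⁻¹ * parityPhase n s s)) • Matrix.single r s 1 := by
    ext x y
    simp only [pureState, Matrix.vecMulVec_apply, Pi.star_apply, maxEntangled_apply,
      Matrix.of_apply, Matrix.smul_apply, Matrix.single_apply,
      eq_comm (a := r) (b := x), eq_comm (a := s) (b := y)]
    by_cases hx : x = r <;> by_cases hy : y = s <;> simp [hx, hy]
  rw [h2, map_smul, map_smul] at h1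
  exact mul_left_cancel₀ (mul_ne_zero (hf r) (star_ne_zero.2 (hf s))) h1

/-- A Gaussian dilation with the right covariance data determines the channel. -/
theorem IsFGC.eq_of_isReduction (hT : IsFGC A B T)
    {U : Matrix (Fock n × Fock k) (Fock n × Fock k) ℂ}
    (hU : U ∈ Matrix.unitaryGroup (Fock n × Fock k) ℂ)
    {O : Matrix (Maj n ⊕ Maj k) (Maj n ⊕ Maj k) ℝ}
    (hO : O ∈ Matrix.orthogonalGroup (Maj n ⊕ Maj k) ℝ)
    (hUO : ∀ a, U.conjTranspose * pairMajorana a * U = majComb pairMajorana fun b => (O a b : ℂ))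
    {f : Maj n → Maj n ⊕ Maj k} (hf : Function.Injective f)
    (hred : ∀ ρ, IsReduction majorana (fun i => pairMajorana (f i)) (T' ρ) (dilate U (vacuum k) ρ))
    (hA : ∀ i j, O (f i) (Sum.inl j) = A i j)
    (hB : ∀ i j, (O * environmentCov n k * O.transpose) (f i) (f j) = B i j) : T' = T := by
  have hUU : U * U.conjTranspose = 1 := Matrix.mem_unitaryGroup_iff.1 hU
  have hUU' : U.conjTranspose * U = 1 := Matrix.mem_unitaryGroup_iff'.1 hU
  -- Heisenberg picture: the Majorana operators are rotated while the initial pure Gaussian state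
  -- stays fixed.
  set D : Maj n ⊕ Maj k → Matrix (Fock n × Fock k) (Fock n × Fock k) ℂ :=
    fun a => U.conjTranspose * pairMajorana a * U with hD
  have hDmul : ∀ a b, D a * D b = U.conjTranspose * (pairMajorana a * pairMajorana b) * U := by
    intro a b
    have : D a * D b = U.conjTranspose * pairMajorana a * (U * U.conjTranspose) *
        pairMajorana b * U := by simp only [hD, mul_assoc]
    rw [this, hUU, mul_one]
    simp only [mul_assoc]
  have hDcar : IsCAR D := by
    intro a b
    rw [hDmul, hDmul, ← add_mul, ← mul_add, isCAR_pairMajorana a b]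
    split_ifs
    · rw [mul_assoc, show (2 : Matrix (Fock n × Fock k) (Fock n × Fock k) ℂ) * U = U + U from two_mul U,
        mul_add, hUU', one_add_one_eq_two]
    · rw [mul_zero, zero_mul]
  have hDh : ∀ a, (D a).conjTranspose = D a := by
    intro a
    rw [hD]
    simp only [Matrix.conjTranspose_mul, Matrix.conjTranspose_conjTranspose,
      pairMajorana_conjTranspose, mul_assoc]
  have hDprod : ∀ l : List (Maj n), (l.map fun i => D (f i)).prod =
      U.conjTranspose * (l.map fun i => pairMajorana (f i)).prod * U := by
    intro l
    induction l with
    | nil => simp [hUU']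
    | cons a l ih =>
      rw [List.map_cons, List.prod_cons, ih, List.map_cons, List.prod_cons]
      have : D (f a) * (U.conjTranspose * (l.map fun i => pairMajorana (f i)).prod * U) =
        U.conjTranspose * pairMajorana (f a) * (U * U.conjTranspose) *
        (l.map fun i => pairMajorana (f i)).prod * U := by simp only [hD, mul_assoc]
      rw [this, hUU, mul_one]
      simp only [mul_assoc]
  -- The reference is left alone. Selecting reference and the modes f from the rotated covariance
  -- gives the Choi covariance, so Wick's theorem equates all moments.
  set R : Matrix (Maj n ⊕ (Maj n ⊕ Maj k)) (Maj n ⊕ (Maj n ⊕ Maj k)) ℝ :=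
    Matrix.fromBlocks 1 0 0 O with hR
  have hRR : R.transpose * R = 1 := by
    rw [hR, Matrix.fromBlocks_transpose, Matrix.fromBlocks_multiply]
    have : O.transpose * O = 1 := (Matrix.mem_orthogonalGroup_iff' _ ℝ).1 hO
    simp [this]
  set C := joinMajorana (parity n) (majorana (n := n)) D with hC
  have hCR : ∀ a, C a = majComb (joinMajorana (parity n) majorana pairMajorana)
      fun b => (R a b : ℂ) := by
    intro a
    rcases a with i | a
    · rw [majComb, Fintype.sum_sum_type]
      simp [hR, hC, joinMajorana, Matrix.one_apply, apply_ite Complex.ofReal, ite_smul]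
    · rw [majComb, Fintype.sum_sum_type]
      simp only [hR, hC, joinMajorana, Sum.elim_inr, hD, hUO, Matrix.fromBlocks_apply₂₁,
        Matrix.fromBlocks_apply₂₂, Matrix.zero_apply, Complex.ofReal_zero, zero_smul,
        Finset.sum_const_zero, zero_add, majComb]
      ext p q
      simp [Matrix.kroneckerMap_apply, Matrix.sum_apply, Finset.mul_sum, mul_add, mul_left_comm]
  set M := R * initialCov n k * R.transpose with hM
  have hMblocks : M = Matrix.fromBlocks 0 (referenceCov n k * O.transpose)
      (-(referenceCov n k * O.transpose).transpose) (O * environmentCov n k * O.transpose) := by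
    rw [hM, hR, initialCov, Matrix.fromBlocks_transpose, Matrix.fromBlocks_multiply,
      Matrix.fromBlocks_multiply]
    simp only [Matrix.transpose_one, Matrix.transpose_zero, Matrix.one_mul, Matrix.zero_mul,
      Matrix.mul_one, Matrix.mul_zero, add_zero, zero_add, Matrix.mul_neg, neg_zero, Matrix.transpose_mul,
      Matrix.transpose_transpose]
  have hwick := trace_pureState_prod (isCAR_joinMajorana isGrading_parity isCAR_majorana hDcar)
    (joinMajorana_conjTranspose parity_conjTranspose majorana_conjTranspose hDh) M
    star_initialVector_dotProduct (twoPoint_rotate_mulVec hCR hRR twoPoint_mulVec_initialVector)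
  have hχ := hT.isGaussianState_choiState
  refine choiState_injective (ext_of_trace_pairMajorana fun l hl => ?_)
  rw [hχ.2 l hl, pairMajorana_eq, prod_map_joinMajorana, choiState, trace_ampliation_mul, hred _ _,
    dilate, ← weightedTrace_initialVector]
  set y := (l.map (Sum.elim majorana fun _ => parity n)).prod
  have h1 : ∀ X V : Matrix (Fock n × Fock k) (Fock n × Fock k) ℂ,
      (U * X * U.conjTranspose * V).trace = (X * (U.conjTranspose * V * U)).trace := by
    intro X V
    rw [mul_assoc, mul_assoc, Matrix.trace_mul_comm]
    simp only [mul_assoc]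
  rw [h1, ← hDprod, ← trace_weightedTrace_mul, ← prod_map_joinMajorana]
  have h2 : joinMajorana (parity n) majorana (fun i => D (f i)) = fun a => C (Sum.map id f a) := by
    funext a
    rcases a with i | i <;> rfl
  have h3 : l.map (fun a => C (Sum.map id f a)) = (l.map (Sum.map id f)).map C := by
    rw [List.map_map]
    rfl
  rw [h2, h3, hC, hwick]
  refine (wick_map _ _ _).trans ?_
  congr 1
  funext a b
  rw [← pairMajorana_eq, trace_mul_mul_eq_twoPoint isCAR_pairMajorana pairMajorana_conjTranspose hχ.1,
    hT.covMatrix_choiState, twoPoint_apply, twoPoint_apply]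
  congr 2
  · simp only [(Function.injective_id.sumMap hf).eq_iff]
  · congr 1
    rw [hMblocks]
    rcases a with i | i <;> rcases b with j | j
    · simp
    · simp [referenceCov_mul_transpose_apply, hA, mul_comm]
    · simp [-Matrix.transpose_mul, referenceCov_mul_transpose_apply, hA, mul_comm]
    · simp [hB]

end Dilation


/-! ### Discarding the last modes -/

section PartialTrace

variable {m n : ℕ}

/-- The partial trace over the last `n` of `m + n` modes. -/
def partialTrace (m n : ℕ) : Op (m + n) →ₗ[ℂ] Op m where
  toFun X := ∑ z : Fock n, Matrix.of fun x y => X (Fin.append x z) (Fin.append y z)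
  map_add' X Y := by
    rw [← Finset.sum_add_distrib]
    rfl
  map_smul' r X := by
    rw [RingHom.id_apply, Finset.smul_sum]
    rfl

theorem isCompletelyPositive_partialTrace : IsCompletelyPositive (partialTrace m n) := by
  intro k X hX
  have h : ampliation (Fin k) (partialTrace m n) X = ∑ z : Fock n,
      X.submatrix (fun p : Fin k × Fock m => (p.1, Fin.append p.2 z))
        (fun p : Fin k × Fock m => (p.1, Fin.append p.2 z)) := by
    ext p q
    simp [ampliation, partialTrace, Matrix.sum_apply]
  rw [h]
  exact Matrix.posSemidef_sum _ fun z _ => hX.submatrix _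

/-- The string of a mode runs only over earlier modes, so for the first m modes the discarded ones
contribute an identity factor. -/
theorem majorana_castAdd_submatrix (i : Maj m) :
    (majorana (n := m + n) (Fin.castAdd n i.1, i.2)).submatrix (Fin.appendEquiv m n)
      (Fin.appendEquiv m n) = majorana i ⊗ₖ (1 : Op n) := by
  ext ⟨x, z⟩ ⟨y, w⟩
  have h1 : Function.update (Fin.append y w) (Fin.castAdd n i.1) (!y i.1) =
      Fin.append (Function.update y i.1 (!y i.1)) w := by
    funext j
    refine Fin.addCases (fun j => ?_) (fun j => ?_) j
    · by_cases hj : j = i.1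
      · subst hj; simp
      · rw [Function.update_of_ne (by simpa [Fin.ext_iff] using fun h => hj (Fin.ext h))]
        simp [hj]
    · rw [Function.update_of_ne (by simp [Fin.ext_iff]; omega)]
      simp
  have h2 : Fin.append x z = Fin.append (Function.update y i.1 (!y i.1)) w ↔
      x = Function.update y i.1 (!y i.1) ∧ z = w := by
    rw [← Prod.mk.injEq, ← (Fin.appendEquiv m n).injective.eq_iff]
    rfl
  have h3 : (∏ j ∈ Finset.univ.filter (fun j : Fin (m + n) => j < Fin.castAdd n i.1),
      if Fin.append y w j then (-1 : ℂ) else 1) =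
      ∏ j ∈ Finset.univ.filter (fun j => j < i.1), if y j then (-1 : ℂ) else 1 := by
    rw [Finset.prod_filter, Finset.prod_filter, Fin.prod_univ_add]
    have h4 : ∀ j : Fin n, ¬ Fin.natAdd m j < Fin.castAdd n i.1 := by
      intro j
      simp only [Fin.lt_def, Fin.val_natAdd, Fin.val_castAdd]
      omega
    have h5 : ∀ j : Fin m, Fin.castAdd n j < Fin.castAdd n i.1 ↔ j < i.1 := fun j => Iff.rfl
    simp only [h4, h5, if_false, Finset.prod_const_one, mul_one, Fin.append_left]
  simp only [majorana, Matrix.submatrix_apply, Matrix.of_apply, Fin.appendEquiv, Equiv.coe_fn_mk,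
    Matrix.kroneckerMap_apply, Fin.append_left, h1, h2, h3, Matrix.one_apply]
  by_cases hx : x = Function.update y i.1 (!y i.1) <;> by_cases hz : z = w <;> simp [hx, hz]

theorem prod_majorana_castAdd_submatrix (l : List (Maj m)) :
    ((l.map fun i => majorana (n := m + n) (Fin.castAdd n i.1, i.2)).prod).submatrix
      (Fin.appendEquiv m n) (Fin.appendEquiv m n) = (l.map majorana).prod ⊗ₖ (1 : Op n) := by
  induction l with
  | nil => simp
  | cons a l ih =>
    rw [List.map_cons, List.prod_cons, ← Matrix.submatrix_mul_equiv _ _ _ (Fin.appendEquiv m n), ih,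
      majorana_castAdd_submatrix, ← Matrix.mul_kronecker_mul, List.map_cons, List.prod_cons, one_mul]

theorem trace_partialTrace_mul (X : Op (m + n)) (l : List (Maj m)) :
    (partialTrace m n X * (l.map majorana).prod).trace =
      (X * (l.map fun i => majorana (Fin.castAdd n i.1, i.2)).prod).trace := by
  set Z := (l.map (majorana (n := m))).prod
  set W := (l.map fun i => majorana (n := m + n) (Fin.castAdd n i.1, i.2)).prod with hW
  have h1 : (X * W).trace = (X.submatrix (Fin.appendEquiv m n) (Fin.appendEquiv m n) *
      (Z ⊗ₖ (1 : Op n))).trace := by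
    rw [← prod_majorana_castAdd_submatrix, Matrix.submatrix_mul_equiv]
    exact (Equiv.sum_comp (Fin.appendEquiv m n) fun i => (X * W) i i).symm
  rw [h1]
  simp only [partialTrace, LinearMap.coe_mk, AddHom.coe_mk, Matrix.trace, Matrix.diag_apply,
    Matrix.mul_apply, Fintype.sum_prod_type, Matrix.sum_apply, Matrix.of_apply,
    Matrix.submatrix_apply, Matrix.kroneckerMap_apply, Fin.appendEquiv, Equiv.coe_fn_mk,
    Finset.sum_mul, Matrix.one_apply]
  refine Finset.sum_congr rfl fun x _ => ?_
  refine Finset.sum_congr rfl fun z _ => Finset.sum_congr rfl fun y _ => ?_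
  simp

end PartialTrace

/-! ### Reductions to the system and to the environment -/

section Environment

variable {n k : ℕ}

theorem weightedTrace_add {K K' : Type} [Fintype K] (X Y : Matrix (K × K') (K × K') ℂ)
    (z : Matrix K K ℂ) : weightedTrace (X + Y) z = weightedTrace X z + weightedTrace Y z := by
  ext x y
  simp [weightedTrace, Matrix.sum_apply, mul_add, Finset.sum_add_distrib]

theorem weightedTrace_smul {K K' : Type} [Fintype K] (r : ℂ) (X : Matrix (K × K') (K × K') ℂ)
    (z : Matrix K K ℂ) : weightedTrace (r • X) z = r • weightedTrace X z := by
  ext x y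
  simp [weightedTrace, Matrix.sum_apply, mul_left_comm, Finset.mul_sum]

theorem dilate_add (U : Matrix (Fock n × Fock k) (Fock n × Fock k) ℂ) (ψ : Fock k → ℂ)
    (ρ σ : Op n) : dilate U ψ (ρ + σ) = dilate U ψ ρ + dilate U ψ σ := by
  rw [dilate, Matrix.add_kronecker, mul_add, add_mul]
  rfl

theorem dilate_smul (U : Matrix (Fock n × Fock k) (Fock n × Fock k) ℂ) (ψ : Fock k → ℂ) (r : ℂ)
    (ρ : Op n) : dilate U ψ (r • ρ) = r • dilate U ψ ρ := by
  rw [dilate, Matrix.smul_kronecker, mul_smul_comm, smul_mul_assoc]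
  rfl

/-- The reduction to the system. -/
def systemMap (U : Matrix (Fock n × Fock k) (Fock n × Fock k) ℂ) (ψ : Fock k → ℂ) :
    Op n →ₗ[ℂ] Op n where
  toFun ρ := Matrix.of fun x y => ∑ e, dilate U ψ ρ (x, e) (y, e)
  map_add' ρ σ := by
    ext x y
    simp [dilate_add, Finset.sum_add_distrib]
  map_smul' r ρ := by
    ext x y
    simp [dilate_smul, Finset.mul_sum]

theorem isReduction_systemMap (U : Matrix (Fock n × Fock k) (Fock n × Fock k) ℂ) (ψ : Fock k → ℂ)
    (ρ : Op n) : IsReduction majorana (fun i => pairMajorana (Sum.inl i)) (systemMap U ψ ρ)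
      (dilate U ψ ρ) := by
  intro l
  have h3 : (fun i => pairMajorana (r := n) (n := k) (Sum.inl i)) =
      fun i => majorana i ⊗ₖ (1 : Op k) := rfl
  rw [h3, prod_map_kronecker_one]
  simp only [systemMap, LinearMap.coe_mk, AddHom.coe_mk, Matrix.trace, Matrix.diag_apply,
    Matrix.mul_apply, Fintype.sum_prod_type, Matrix.of_apply, Matrix.kroneckerMap_apply,
    Finset.sum_mul, Matrix.one_apply]
  refine Finset.sum_congr rfl fun x _ => ?_
  conv_lhs => rw [Finset.sum_comm]
  refine Finset.sum_congr rfl fun z _ => Finset.sum_congr rfl fun y _ => ?_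
  simp

/-- The reduction to the environment; the part of the operators of the environment that is odd under
parity carries the parity string of the system. -/
noncomputable def environmentMap (U : Matrix (Fock n × Fock k) (Fock n × Fock k) ℂ)
    (ψ : Fock k → ℂ) : Op n →ₗ[ℂ] Op k where
  toFun ρ := (1 / 2 : ℂ) • (weightedTrace (dilate U ψ ρ) 1 +
    parity k * weightedTrace (dilate U ψ ρ) 1 * parity k +
    (weightedTrace (dilate U ψ ρ) (parity n) -
      parity k * weightedTrace (dilate U ψ ρ) (parity n) * parity k))
  map_add' ρ σ := by
    rw [← smul_add]
    congr 1
    simp only [dilate_add, weightedTrace_add, mul_add, add_mul]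
    abel
  map_smul' r ρ := by
    simp only [dilate_smul, weightedTrace_smul, mul_smul_comm, smul_mul_assoc, RingHom.id_apply,
      ← smul_add, ← smul_sub, smul_comm r]

/-- A word of length ℓ in the environment carries the string parity^ℓ on the system. The even part
of the ordinary partial trace and the odd part of the parity-weighted one supply exactly the moments
of even and odd words. -/
theorem isReduction_environmentMap (U : Matrix (Fock n × Fock k) (Fock n × Fock k) ℂ)
    (ψ : Fock k → ℂ) (ρ : Op n) : IsReduction majorana (fun j => pairMajorana (Sum.inr j))
      (environmentMap U ψ ρ) (dilate U ψ ρ) := by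
  intro l
  have h3 : (fun j => pairMajorana (r := n) (n := k) (Sum.inr j)) =
      fun j => parity n ⊗ₖ majorana j := rfl
  rw [h3, prod_map_kronecker, trace_weightedTrace_mul]
  set Z := (l.map (majorana (n := k))).prod with hZ
  have hconj : ∀ X : Op k, (parity k * X * parity k * Z).trace =
      (-1 : ℂ) ^ l.length * (X * Z).trace := by
    intro X
    rw [mul_assoc, mul_assoc, Matrix.trace_mul_comm, mul_assoc, mul_assoc, ← mul_assoc (parity k),
      isGrading_parity.conj_prod, mul_smul_comm, Matrix.trace_smul, smul_eq_mul]
  have h4 : ∀ X Y : Op k, ((1 / 2 : ℂ) • (X + parity k * X * parity k +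
      (Y - parity k * Y * parity k)) * Z).trace =
      1 / 2 * ((1 + (-1 : ℂ) ^ l.length) * (X * Z).trace +
        (1 - (-1 : ℂ) ^ l.length) * (Y * Z).trace) := by
    intro X Y
    rw [smul_mul_assoc, Matrix.trace_smul, add_mul, add_mul, sub_mul, Matrix.trace_add,
      Matrix.trace_add, Matrix.trace_sub, hconj, hconj, smul_eq_mul]
    ring
  change ((1 / 2 : ℂ) • _ * Z).trace = _
  rw [h4]
  rcases Nat.even_or_odd l.length with he | ho
  · rw [he.neg_one_pow, parity_pow_eq (l := 0) (by simpa using he), pow_zero]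
    ring
  · rw [ho.neg_one_pow, parity_pow_eq (l := 1) (by simpa using ho.add_odd odd_one), pow_one]
    ring

end Environment

/-! ### The symmetric dilation -/

section Rotation

variable {n : ℕ} {A B : Matrix (Maj n) (Maj n) ℝ}

/-- The Majorana operators of `n + n` modes consist of those of two parts. -/
def splitMaj (n : ℕ) : Maj (n + n) ≃ Maj n ⊕ Maj n :=
  (Equiv.prodCongrLeft fun _ => finSumFinEquiv.symm).trans (Equiv.sumProdDistrib _ _ _)

theorem splitMaj_castAdd (i : Maj n) : splitMaj n (Fin.castAdd n i.1, i.2) = Sum.inl i := by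
  simp [splitMaj]

theorem vacuumCov_eq_submatrix : vacuumCov (n + n) =
    (Matrix.fromBlocks (vacuumCov n) 0 0 (vacuumCov n)).submatrix (splitMaj n) (splitMaj n) := by
  have h : ∀ i j : Fin n, ¬ Fin.castAdd n i = Fin.natAdd n j := by
    intro i j hij
    have := congrArg Fin.val hij
    simp only [Fin.val_natAdd, Fin.val_castAdd] at this
    omega
  have h' : ∀ i j : Fin n, ¬ Fin.natAdd n i = Fin.castAdd n j := fun i j hij => h j i hij.symm
  ext ⟨i, e⟩ ⟨j, f⟩
  refine Fin.addCases (fun i => ?_) (fun i => ?_) i <;>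
    refine Fin.addCases (fun j => ?_) (fun j => ?_) j <;>
    simp [splitMaj, vacuumCov, h, h', -Fin.natAdd_eq_addNat]

/-- System and first half of the environment receive the same noise and the same share of the input.
Orthogonality of the two groups of rows comes from the opposite signs of S: A Aᵀ - S Sᵀ + G Gᵀ = 0.
The bound 2d² ≤ 1 is what makes the square root in G available. -/
theorem exists_dilationRotation {O₁ O₂ : Matrix (Maj n) (Maj n) ℝ}
    (hO₁ : O₁ ∈ Matrix.orthogonalGroup (Maj n) ℝ) (hO₂ : O₂ ∈ Matrix.orthogonalGroup (Maj n) ℝ)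
    {d : Fin n → ℝ} (hA : A = O₁ * Matrix.diagonal (fun i : Maj n => d i.1) * O₂)
    (hB : B = O₁ * (Matrix.diagonal (fun i : Maj n => 1 - d i.1 * d i.1) * vacuumCov n) *
      O₁.transpose) (hd : ∀ k, 2 * (d k * d k) ≤ 1) :
    ∃ O ∈ Matrix.orthogonalGroup (Maj n ⊕ Maj (n + n)) ℝ, ∀ f : Maj n → Maj n ⊕ Maj (n + n),
      (f = Sum.inl ∨ f = fun i => Sum.inr (Fin.castAdd n i.1, i.2)) →
      (∀ i j, O (f i) (Sum.inl j) = A i j) ∧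
      ∀ i j, (O * environmentCov n (n + n) * O.transpose) (f i) (f j) = B i j := by
  have hO2 : O₁ * O₁.transpose = 1 := (Matrix.mem_orthogonalGroup_iff (Maj n) ℝ).1 hO₁
  have hO3 : O₂ * O₂.transpose = 1 := (Matrix.mem_orthogonalGroup_iff (Maj n) ℝ).1 hO₂
  set F := Matrix.diagonal fun i : Maj n => Real.sqrt (1 / 2 - d i.1 * d i.1) with hF
  set s := Real.sqrt (1 / 2) with hs
  have hss : s * s = 1 / 2 := Real.mul_self_sqrt (by norm_num)
  have hAA : A * A.transpose = O₁ * Matrix.diagonal (fun i : Maj n => d i.1 * d i.1) *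
      O₁.transpose := by
    have h1 : A * A.transpose = O₁ * Matrix.diagonal (fun i : Maj n => d i.1) * (O₂ * O₂.transpose) *
        Matrix.diagonal (fun i : Maj n => d i.1) * O₁.transpose := by
      rw [hA, Matrix.transpose_mul, Matrix.transpose_mul, Matrix.diagonal_transpose]
      simp only [mul_assoc]
    rw [h1, hO3, mul_one, mul_assoc O₁, Matrix.diagonal_mul_diagonal]
  have hFF : F * F = (1 / 2 : ℝ) • (1 : Matrix (Maj n) (Maj n) ℝ) -
      Matrix.diagonal fun i : Maj n => d i.1 * d i.1 := by
    rw [hF, Matrix.diagonal_mul_diagonal, ← Matrix.diagonal_one, ← Matrix.diagonal_smul,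
      Matrix.diagonal_sub]
    congr 1
    funext i
    rw [Real.mul_self_sqrt (by linarith [hd i.1])]
    simp
  have hGG : O₁ * F * (O₁ * F).transpose = (1 / 2 : ℝ) • (1 : Matrix (Maj n) (Maj n) ℝ) -
      A * A.transpose := by
    rw [Matrix.transpose_mul, hF, Matrix.diagonal_transpose, ← hF, mul_assoc O₁, ← mul_assoc F, hFF,
      hAA, sub_mul, mul_sub, smul_mul_assoc, one_mul, mul_smul_comm, hO2, ← mul_assoc]
  have hFJ : F * vacuumCov n * F = F * F * vacuumCov n := by
    rw [mul_assoc, mul_assoc]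
    congr 1
    ext a b
    rw [hF, Matrix.mul_diagonal, Matrix.diagonal_mul]
    by_cases hab : a.1 = b.1
    · rw [hab, mul_comm]
    · simp [vacuumCov, hab]
  have hBB : (1 / 2 : ℝ) • (O₁ * vacuumCov n * O₁.transpose) +
      O₁ * F * vacuumCov n * (O₁ * F).transpose = B := by
    have h1 : O₁ * F * vacuumCov n * (O₁ * F).transpose = O₁ * (F * vacuumCov n * F) *
        O₁.transpose := by
      rw [Matrix.transpose_mul, hF, Matrix.diagonal_transpose]
      simp only [mul_assoc]
    rw [h1, hFJ, hFF, hB, ← smul_mul_assoc, ← mul_smul_comm, ← add_mul, ← mul_add]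
    congr 2
    ext a b
    simp [sub_mul, Matrix.diagonal_mul]
    ring
  set G := O₁ * F with hG
  set S := s • O₁ with hS
  have hSS : S * S.transpose = (1 / 2 : ℝ) • (1 : Matrix (Maj n) (Maj n) ℝ) := by
    rw [hS, Matrix.transpose_smul, smul_mul_assoc, mul_smul_comm, hO2, smul_smul, hss]
  have hSJ : S * vacuumCov n * S.transpose = (1 / 2 : ℝ) • (O₁ * vacuumCov n * O₁.transpose) := by
    rw [hS, Matrix.transpose_smul, smul_mul_assoc, smul_mul_assoc, mul_smul_comm, smul_smul, hss]
  rw [← hSJ] at hBB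
  let X : Matrix (Maj n ⊕ (Maj n ⊕ Maj n)) (Maj n ⊕ (Maj n ⊕ Maj n)) ℝ :=
    Matrix.fromBlocks A (Matrix.fromCols S G) (Matrix.fromRows A 0)
      (Matrix.fromBlocks (-S) G 0 0)
  let env : Matrix (Maj n ⊕ (Maj n ⊕ Maj n)) (Maj n ⊕ (Maj n ⊕ Maj n)) ℝ :=
    Matrix.fromBlocks 0 0 0 (Matrix.fromBlocks (vacuumCov n) 0 0 (vacuumCov n))
  -- Weight 0 marks the last n modes, whose rows in X are blank; `exists_eq_diagonal_mul` completes
  -- X to an orthogonal matrix without altering the rows of weight 1.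
  let w : Maj n ⊕ (Maj n ⊕ Maj n) → ℝ := Sum.elim (fun _ => 1) (Sum.elim (fun _ => 1) fun _ => 0)
  have happ : ∀ (P Q : Matrix (Maj n) (Maj n) ℝ) i j,
      (P * Q.transpose) i j = ∑ x, P i x * Q j x := fun P Q i j => rfl
  have hX : X * X.transpose = Matrix.diagonal fun a => w a * w a := by
    ext a b
    rw [Matrix.mul_apply, Fintype.sum_sum_type, Fintype.sum_sum_type, Matrix.diagonal_apply]
    have h1 := fun i j => congrFun (congrFun hGG i) j
    have h2 := fun i j => congrFun (congrFun hSS i) j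
    simp only [Matrix.sub_apply, happ, Matrix.smul_apply, Matrix.one_apply, smul_eq_mul] at h1 h2
    rcases a with i | i | i <;> rcases b with j | j | j <;>
      simp [X, w, h1, h2, -one_div] <;> split_ifs <;> ring
  have hcov : ∀ g : Maj n → Maj n ⊕ (Maj n ⊕ Maj n), (g = Sum.inl ∨ g = fun i => Sum.inr (Sum.inl i)) →
      ∀ i j, (X * env * X.transpose) (g i) (g j) = B i j := by
    have hXE : X * env = Matrix.fromBlocks 0 (Matrix.fromCols (S * vacuumCov n) (G * vacuumCov n)) 0
        (Matrix.fromBlocks (-(S * vacuumCov n)) (G * vacuumCov n) 0 0) := by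
      ext a b
      rw [Matrix.mul_apply, Fintype.sum_sum_type, Fintype.sum_sum_type]
      rcases a with i | i | i <;> rcases b with j | j | j <;> simp [X, env, Matrix.mul_apply]
    have h1 := fun i j => congrFun (congrFun hBB i) j
    simp only [Matrix.add_apply, happ] at h1
    intro g hg i j
    rw [hXE, Matrix.mul_apply, Fintype.sum_sum_type, Fintype.sum_sum_type]
    rcases hg with rfl | rfl <;> simp [X, h1]
  obtain ⟨O, hO, hXO⟩ := exists_eq_diagonal_mul hX
  have hrow : ∀ a b, w a = 1 → O a b = X a b := by
    intro a b ha
    rw [hXO, Matrix.diagonal_mul, ha, one_mul]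
  have hcovO : ∀ a b, w a = 1 → w b = 1 →
      (O * env * O.transpose) a b = (X * env * X.transpose) a b := by
    intro a b ha hb
    have : X * env * X.transpose = Matrix.diagonal w * (O * env * O.transpose) *
        Matrix.diagonal w := by
      rw [hXO, Matrix.transpose_mul, Matrix.diagonal_transpose]
      simp only [mul_assoc]
    rw [this, Matrix.mul_diagonal, Matrix.diagonal_mul, ha, hb, one_mul, mul_one]
  let e : Maj n ⊕ Maj (n + n) ≃ Maj n ⊕ (Maj n ⊕ Maj n) :=
    Equiv.sumCongr (Equiv.refl _) (splitMaj n)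
  have henv : environmentCov n (n + n) = env.submatrix e e := by
    rw [environmentCov, vacuumCov_eq_submatrix]
    ext a b
    rcases a with i | i <;> rcases b with j | j <;> simp [env, e]
  refine ⟨O.submatrix e e, ?_, fun f hf => ?_⟩
  · rw [Matrix.mem_orthogonalGroup_iff, Matrix.transpose_submatrix,
      Matrix.submatrix_mul_equiv, (Matrix.mem_orthogonalGroup_iff _ ℝ).1 hO,
      Matrix.submatrix_one_equiv]
  · obtain ⟨g, hg, hgw, hgf⟩ : ∃ g : Maj n → Maj n ⊕ (Maj n ⊕ Maj n),
        (g = Sum.inl ∨ g = fun i => Sum.inr (Sum.inl i)) ∧ (∀ i, w (g i) = 1) ∧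
        ∀ i, e (f i) = g i := by
      rcases hf with rfl | rfl
      · exact ⟨_, Or.inl rfl, fun _ => rfl, fun _ => rfl⟩
      · refine ⟨_, Or.inr rfl, fun _ => rfl, fun i => ?_⟩
        simp [e, splitMaj_castAdd]
    constructor
    · intro i j
      rw [Matrix.submatrix_apply, hgf, hrow _ _ (hgw i)]
      rcases hg with rfl | rfl <;> simp [X, e]
    · intro i j
      rw [henv, Matrix.transpose_submatrix, Matrix.submatrix_mul_equiv, Matrix.submatrix_mul_equiv,
        Matrix.submatrix_apply, hgf, hgf, hcovO _ _ (hgw i) (hgw j), hcov g hg]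

end Rotation


/-! ### Conclusion -/

/-- A Gaussian channel whose covariance data are in the normal form is antidegradable. -/
theorem IsFGC.isAntidegradable {n : ℕ} {A B : Matrix (Maj n) (Maj n) ℝ} {T : Op n →ₗ[ℂ] Op n}
    (hT : IsFGC A B T) {O₁ O₂ : Matrix (Maj n) (Maj n) ℝ}
    (hO₁ : O₁ ∈ Matrix.orthogonalGroup (Maj n) ℝ) (hO₂ : O₂ ∈ Matrix.orthogonalGroup (Maj n) ℝ)
    {d : Fin n → ℝ} (hA : A = O₁ * Matrix.diagonal (fun i : Maj n => d i.1) * O₂)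
    (hB : B = O₁ * (Matrix.diagonal (fun i : Maj n => 1 - d i.1 * d i.1) * vacuumCov n) *
      O₁.transpose) (hd : ∀ k, 2 * (d k * d k) ≤ 1) : IsAntidegradable T := by
  obtain ⟨O, hO, hOf⟩ := exists_dilationRotation hO₁ hO₂ hA hB hd
  obtain ⟨U, hU, hUP, hUO⟩ := exists_implements isCAR_pairMajorana pairMajorana_conjTranspose
    isGrading_pairMajorana hO
  have hinj : Function.Injective fun i : Maj n => (Fin.castAdd n i.1, i.2) := by
    rintro ⟨i, e⟩ ⟨j, f⟩ h
    simpa using h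
  have hS : systemMap U (vacuum (n + n)) = T :=
    hT.eq_of_isReduction hU hO hUO Sum.inl_injective (isReduction_systemMap U _)
      (hOf _ (Or.inl rfl)).1 (hOf _ (Or.inl rfl)).2
  -- The first n environment modes satisfy the same covariance identities as the system, so the
  -- uniqueness statement applies to them verbatim.
  have hE : partialTrace n n ∘ₗ environmentMap U (vacuum (n + n)) = T := by
    refine hT.eq_of_isReduction hU hO hUO (Sum.inr_injective.comp hinj) (fun ρ l => ?_)
      (hOf _ (Or.inr rfl)).1 (hOf _ (Or.inr rfl)).2
    rw [LinearMap.comp_apply, trace_partialTrace_mul]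
    have h := isReduction_environmentMap U (vacuum (n + n)) ρ
      (l.map fun i => (Fin.castAdd n i.1, i.2))
    rw [List.map_map, List.map_map] at h
    exact h
  refine ⟨n + n, environmentMap U (vacuum (n + n)), partialTrace n n,
    ⟨vacuum (n + n), U, star_vacuum_dotProduct, Or.inl parity_mulVec_vacuum, hU, hUP, fun ρ =>
      ⟨?_, isReduction_environmentMap U _ ρ⟩⟩, isCompletelyPositive_partialTrace, hE⟩
  rw [← hS]
  exact isReduction_systemMap U _ ρ

theorem two_mul_mul_self_le_one_iff {d : ℝ} (hd : 0 ≤ d) :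
    2 * (d * d) ≤ 1 ↔ d ≤ 1 / Real.sqrt 2 := by
  have h2 : 0 < Real.sqrt 2 := by positivity
  have h3 : Real.sqrt 2 * Real.sqrt 2 = 2 := Real.mul_self_sqrt (by norm_num)
  rw [le_div_iff₀ h2]
  constructor
  · intro h
    nlinarith [mul_nonneg hd h2.le]
  · intro h
    nlinarith [mul_nonneg hd h2.le]

end Fermion

theorem mainTheorem5 (n n' : ℕ) (hn' : n' ≤ n)
    (A B : Matrix (Fermion.Maj n) (Fermion.Maj n) ℝ)
    (T : Fermion.Op n →ₗ[ℂ] Fermion.Op n) (hT : Fermion.IsFGC A B T)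
    (hrank : Fermion.choiRank T = 2 ^ n') :
    Fermion.IsAntidegradable T ↔
      ∃ O₁ ∈ Matrix.orthogonalGroup (Fermion.Maj n) ℝ,
      ∃ O₂ ∈ Matrix.orthogonalGroup (Fermion.Maj n) ℝ,
      ∃ (d : Fin n → ℝ) (B' : Matrix (Fermion.Maj n) (Fermion.Maj n) ℝ),
        A = O₁ * Matrix.diagonal (fun i : Fermion.Maj n => d i.1) * O₂ ∧
        B = O₁ * B' * O₁.transpose ∧
        Antitone d ∧
        (∀ k, 0 ≤ d k ∧ d k ≤ 1 / Real.sqrt 2) ∧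
        ∀ i j, d i.1 ≠ d j.1 → B' i j = 0 := by
  constructor
  · intro h
    obtain ⟨J, hJ⟩ := hT.exists_complexStructure_of_isAntidegradable hn' hrank h
    obtain ⟨O₁, hO₁, O₂, hO₂, d, hA, hB, hmono, hd⟩ :=
      Fermion.IsAntidegradableCov.exists_normalForm hJ
    refine ⟨O₁, hO₁, O₂, hO₂, d, _, hA, hB, hmono, fun k => ⟨(hd k).1,
      (Fermion.two_mul_mul_self_le_one_iff (hd k).1).1 (hd k).2⟩, fun i j hij => ?_⟩
    -- The B' obtained here, diag(1 - d²) times the vacuum covariance, does not couple distinct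
    -- modes at all.
    have : i.1 ≠ j.1 := fun h => hij (congrArg d h)
    simp [Matrix.diagonal_mul, Fermion.vacuumCov, this]
  · rintro ⟨O₁, hO₁, O₂, hO₂, d, B', hA, hB, -, hd, hB'⟩
    obtain ⟨J, hJ⟩ := Fermion.exists_isAntidegradableCov hT hn' hrank hO₁ hO₂ hA hB
      (fun k => (Fermion.two_mul_mul_self_le_one_iff (hd k).1).2 (hd k).2) hB'
    -- The given B' is only block diagonal over equal values of d; a further rotation inside these
    -- blocks is needed before the explicit dilation applies, hence the passage through J.
    obtain ⟨P₁, hP₁, P₂, hP₂, e, hA, hB, -, he⟩ := hJ.exists_normalForm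
    exact hT.isAntidegradable hP₁ hP₂ hA hB fun k => (he k).2
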